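/- **Model.** Fix constants $0<\varepsilon<1$, $R,P>0$, $1\le\lambda<\zeta$, $C_0>0$, $\rho_c\ge 0$, $I_c,I_{ack},I_{cd}>0$, $\phi_0\ge 1$, $h_1,h_2>1$, $\rho>1$. A (static) network is a finite metric space $(V,d)$ with $n=|V|\ge 1$ nodes and $(\varepsilon R/8,\lambda)$-bounded independence: with $r=\varepsilon R/8$, for every $q\ge 1$ and every ball $D$ of radius $qr$, every set of nodes whose $r$-balls are pairwise disjoint and contained in $D$ has at most $C_0q^\lambda$ elements (balls are open, and are sets of nodes). The communication graph $G$ joins distinct nodes at distance at most $(1-\varepsilon)R$; it is assumed to be connected, with diameter $D_G$. Time proceeds in synchronous rounds and all nodes start simultaneously (spontaneous mode). In round $t$, each node $v$ transmits, independently of the other nodes given the past, with a probability $p_t(v)$ determined by its current local state. If $S$ is the set of transmitters, the interference at $u$ is $\sum_{w\in S\setminus\{u\}}P/d(w,u)^\zeta$. An adaptive, possibly randomized adversary, which knows the past and $S$, decides who receives which transmissions and what the nodes sense, subject only to the following rules. * *Clear channel.* If $u\in S$, no other $w\in S$ has $d(w,u)<\rho_cR$, and the interference at $u$ is at most $I_c$,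 then every node $v\neq u$ with $d(u,v)\le(1-\varepsilon/2)R$ receives $u$'s transmission. * *ACK.* If $u\in S$ and all nodes $v\ne u$ with $d(u,v)\le (1-\varepsilon/2)R$ receive $u$'s transmission and the interference at $u$ is at most $I_{ack}$, then $u$'s ACK outcome is $1$; if some such $v$ does not receive it, the outcome is $0$. * *NTD.* The NTD outcome of $v$ is $1$ exactly if $v$ receives the transmission of some $u$ with $d(u,v)<\varepsilon R/4$. * *CD.* Each node senses Busy or Idle. Conditionally on the past: (i) for every node $v$ and $\phi>\phi_0$, if $\sum_{w:\,d(w,v)<R/2}p_t(w)>\phi$, then with probability at least $1-h_1^{-\phi}$ all nodes $w$ with $d(w,v)<R/2$ sense Busy; (ii) for every node $v$ and $\eta>0$, if $\sum_{w:\,d(w,v)<\rho R}p_t(w)\le\eta$, then, given that the interference at $v$ from the transmitters at distance at least $\rho R$ is less than $I_{cd}$, $v$ senses Idle with probability at least $h_2^{-\eta}$. An algorithm is *uniform* if all nodes run the same program, which depends only on the constants of the model; initially a node knows only whether it is the source, and after each round it updates its state from whether it transmitted, the packets it received, and its CD, ACK and NTD outcomes. Packets carry a control symbol from a fixed finite alphabet,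 and packets sent by nodes that hold the source's message also carry this message. Initially only the source holds the message; a node gets it by receiving a packet from a node that holds it. **Theorem.** For every choice of the constants of the model there is a uniform algorithm (in particular, one that does not know $n$) that performs broadcast in $O(D_G+\log n)$ rounds with high probability. That is, for every $k\in\mathbb N$ there is $C>0$, depending only on $k$ and the constants of the model, such that for every network as above, every source and every adversary obeying the rules, and every integer $T\ge C(D_G+\log n)$, all nodes hold the message after $T$ rounds with probability at least $1-n^{-k}$. -/

import Mathlib

open scoped NNReal ENNReal

noncomputable section

namespace WirelessBroadcast

/-- The constants of the communication model. None of them depends on the network or on the number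
of nodes. The signal of a transmitting node `u` has strength `P / d(u,v)^ζ` at `v`. The constants
`ρc`, `Ic` (clear channel) and `Iack` (acknowledgement) belong to the precision `ε / 2`. -/
structure Model where
  /-- precision: nodes at distance at most `(1 - ε) R` are neighbours -/
  ε : ℝ
  /-- maximum transmission distance -/
  R : ℝ
  /-- transmission power -/
  P : ℝ
  /-- metricity (path loss exponent) -/
  ζ : ℝ
  /-- growth exponent of the bounded independence property -/
  lam : ℝ
  /-- leading constant of the bounded independence property -/
  Cind : ℝ
  /-- radius (in units of `R`) of the zone that has to be silent on a clear channel -/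
  ρc : ℝ
  /-- interference tolerated on a clear channel -/
  Ic : ℝ
  /-- interference up to which a successful transmission is sure to be acknowledged -/
  Iack : ℝ
  /-- contention from which on contention detection is reliable -/
  φ₀ : ℝ
  /-- base of the failure probability of the detection of a busy channel -/
  h₁ : ℝ
  /-- base of the success probability of the detection of an idle channel -/
  h₂ : ℝ
  /-- radius of the vicinity (in units of `R`) in contention detection -/
  ρ : ℝ
  /-- outside interference tolerated in the detection of an idle channel -/
  Icd : ℝ
  ε_pos : 0 < ε
  ε_lt_one : ε < 1
  R_pos : 0 < R
  P_pos : 0 < P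
  one_le_lam : 1 ≤ lam
  lam_lt_ζ : lam < ζ
  Cind_pos : 0 < Cind
  ρc_nonneg : 0 ≤ ρc
  Ic_pos : 0 < Ic
  Iack_pos : 0 < Iack
  one_le_φ₀ : 1 ≤ φ₀
  one_lt_h₁ : 1 < h₁
  one_lt_h₂ : 1 < h₂
  one_lt_ρ : 1 < ρ
  Icd_pos : 0 < Icd

/-! ### Static networks -/

/-- `S` is an `r`-packing of `D`: the balls of radius `r` around the nodes of `S` are contained in
`D` and pairwise disjoint. Balls are sets of nodes. -/
def IsPacking {V : Type} [MetricSpace V] (r : ℝ) (S : Finset V) (D : Set V) : Prop :=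
  (∀ u ∈ S, Metric.ball u r ⊆ D) ∧
    (S : Set V).PairwiseDisjoint fun u => Metric.ball u r

/-- `(r, lam)`-bounded independence with leading constant `C`. -/
def BoundedIndependence (V : Type) [MetricSpace V] (r lam C : ℝ) : Prop :=
  ∀ q : ℝ, 1 ≤ q → ∀ v : V, ∀ S : Finset V,
    IsPacking r S (Metric.ball v (q * r)) → (S.card : ℝ) ≤ C * q ^ lam

/-- The communication graph: distinct nodes are adjacent iff they are at distance at most
`(1 - ε) R`. -/
def commGraph (M : Model) (V : Type) [MetricSpace V] : SimpleGraph V where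
  Adj u v := u ≠ v ∧ dist u v ≤ (1 - M.ε) * M.R
  symm := ⟨fun u v h => ⟨h.1.symm, by rw [dist_comm]; exact h.2⟩⟩
  loopless := ⟨fun _ h => h.1 rfl⟩

/-! ### Algorithms -/

/-- What a node learns in a round. -/
structure Observation (Msg : Type) where
  /-- whether the node itself transmitted -/
  sent : Bool
  /-- the packets received: a control message, and whether the packet carries the broadcast
  message -/
  received : Set (Msg × Bool)
  /-- contention detection: `true` is a busy channel, `false` is an idle channel -/
  busy : Bool
  /-- successful transmission detection (not meaningful unless the node transmitted) -/
  ack : Bool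
  /-- near transmission detection -/
  ntd : Bool

/-- A uniform distributed algorithm. All nodes run the same program, which depends neither on the
network nor on the number of nodes. Initially a node only knows whether it is the source. In every
round it transmits with a probability determined by its current state, and then it updates its
state from what it has observed. Control messages come from a fixed finite alphabet; in addition,
every transmission of a node that holds the broadcast message carries that message. -/
structure Algorithm where
  State : Type
  Msg : Type
  finite_msg : Finite Msg
  init : Bool → State
  prob : State → ℝ≥0
  prob_le_one : ∀ q, prob q ≤ 1
  msg : State → Msg
  next : State → Observation Msg → State

/-! ### Executions -/

/-- The part of a round that is not decided by the nodes. -/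
structure Outcome (V : Type) where
  /-- `received v` is the set of the nodes whose transmission is received by `v` -/
  received : V → Finset V
  ack : V → Bool
  busy : V → Bool

/-- The rounds that have passed, the most recent one first: the set of transmitting nodes and the
outcome of each round. -/
abbrev History (V : Type) := List (Finset V × Outcome V)

/-- An adaptive adversary: it knows the history and the set of the nodes that transmit in the
current round, and determines the outcome of the round, possibly at random. -/
abbrev Adversary (V : Type) := History V → Finset V → PMF (Outcome V)

/-- The nodes that hold the broadcast message after a history, when `s` is the source. -/
def informed {V : Type} (s : V) : History V → Set V
  | [] => {s}
  | (_, o) :: h => {v | v ∈ informed s h ∨ ∃ u ∈ o.received v, u ∈ informed s h}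

open Classical in
/-- The states of the nodes after a history, when `s` is the source. All nodes start
simultaneously. Near transmission detection at precision `ε / 2` reports whether the node has
received the transmission of a node at distance less than `ε R / 4`. -/
def state {V : Type} [MetricSpace V] (M : Model) (A : Algorithm) (s : V) :
    History V → V → A.State
  | [], v => A.init (decide (v = s))
  | (S, o) :: h, v => A.next (state M A s h v)
      { sent := decide (v ∈ S)
        received := {x | ∃ u ∈ o.received v,
          x = (A.msg (state M A s h u), decide (u ∈ informed s h))}
        busy := o.busy v
        ack := o.ack v
        ntd := decide (∃ u ∈ o.received v, dist u v < M.ε / 4 * M.R) }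

open Classical in
/-- The law of the random set that contains every `v` independently with probability `p v`. -/
def independentSet {V : Type} [Fintype V] (p : V → ℝ≥0) (hp : ∀ v, p v ≤ 1) : PMF (Finset V) :=
  PMF.ofFintype (fun S => (∏ v ∈ S, (p v : ℝ≥0∞)) * ∏ v ∈ Finset.univ \ S, (1 - (p v : ℝ≥0∞))) <| by
    have h := Finset.prod_add (fun v => (p v : ℝ≥0∞)) (fun v => 1 - (p v : ℝ≥0∞)) Finset.univ
    rw [Finset.powerset_univ] at h
    rw [← h]
    refine Finset.prod_eq_one fun v _ => add_tsub_cancel_of_le ?_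
    exact_mod_cast hp v

section Execution

variable {V : Type} [Fintype V] [MetricSpace V] (M : Model) (A : Algorithm) (s : V)

/-- The probability with which `v` transmits in the round after the history `h`. -/
def transmitProb (h : History V) (v : V) : ℝ≥0 := A.prob (state M A s h v)

/-- The law of the round after the history `h`: the nodes transmit independently of one another,
then the adversary determines the outcome. -/
def roundLaw (adv : Adversary V) (h : History V) : PMF (Finset V × Outcome V) :=
  (independentSet (transmitProb M A s h) fun _ => A.prob_le_one _).bind fun S =>
    (adv h S).map fun o => (S, o)

/-- The law of the history of the first `t` rounds. -/
def law (adv : Adversary V) : ℕ → PMF (History V)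
  | 0 => PMF.pure []
  | t + 1 => (law adv t).bind fun h => (roundLaw M A s adv h).map fun x => x :: h

open Classical in
/-- The contention in a set `B` of nodes in the round after `h`. -/
def contention (h : History V) (B : Set V) : ℝ :=
  ∑ v with v ∈ B, (transmitProb M A s h v : ℝ)

end Execution

open Classical in
/-- The total interference at `u` that is caused by the nodes of `S` other than `u`. -/
def interference {V : Type} [MetricSpace V] (M : Model) (S : Finset V) (u : V) : ℝ :=
  ∑ w ∈ S.erase u, M.P / dist w u ^ M.ζ

open Classical in
/-- The interference at `v` that is caused by the nodes of `S` outside the vicinity of `v`. -/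
def outsideInterference {V : Type} [MetricSpace V] (M : Model) (S : Finset V) (v : V) : ℝ :=
  ∑ w ∈ S with w ∉ Metric.ball v (M.ρ * M.R), M.P / dist w v ^ M.ζ

/-- The transmission of `u` is received by all nodes at distance at most `(1 - ε/2) R` from `u`. -/
def MassDelivers {V : Type} [MetricSpace V] (M : Model) (o : Outcome V) (u : V) : Prop :=
  ∀ v, v ≠ u → dist u v ≤ (1 - M.ε / 2) * M.R → u ∈ o.received v

/-- The outcome `o` of a round in which exactly the nodes of `S` transmit obeys the rules of
communication and acknowledgement, at precision `ε / 2`. Everything else is up to the adversary. -/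
structure Legal {V : Type} [MetricSpace V] (M : Model) (S : Finset V) (o : Outcome V) : Prop where
  /-- only transmissions of other nodes are received -/
  received_sent : ∀ u v, u ∈ o.received v → u ∈ S ∧ u ≠ v
  /-- success on a clear channel -/
  succClear : ∀ u ∈ S, (∀ w ∈ S, w ≠ u → w ∉ Metric.ball u (M.ρc * M.R)) →
    interference M S u ≤ M.Ic → MassDelivers M o u
  /-- under low interference a transmission that reaches all neighbours is acknowledged -/
  ack_of_massDelivers : ∀ u ∈ S, MassDelivers M o u → interference M S u ≤ M.Iack → o.ack u = true
  /-- a transmission that misses a neighbour is not acknowledged -/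
  not_ack : ∀ u ∈ S, ¬ MassDelivers M o u → o.ack u = false

/-- Contention detection in the round after the history `h`. All probabilities are conditional on
`h`. -/
structure ContentionDetection {V : Type} [Fintype V] [MetricSpace V] (M : Model) (A : Algorithm)
    (s : V) (adv : Adversary V) (h : History V) : Prop where
  /-- under high contention in the close neighbourhood of `v`, all nodes there detect a busy channel
  with probability at least `1 - h₁ ^ (-φ)` -/
  busy : ∀ (v : V) (φ : ℝ), M.φ₀ < φ → φ < contention M A s h (Metric.ball v (M.R / 2)) →
    ENNReal.ofReal (1 - M.h₁ ^ (-φ)) ≤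
      (roundLaw M A s adv h).toOuterMeasure
        {x | ∀ w ∈ Metric.ball v (M.R / 2), x.2.busy w = true}
  /-- under low contention in the vicinity of `v`, given that the interference from outside the
  vicinity is low, `v` detects an idle channel with probability at least `h₂ ^ (-η)` -/
  idle : ∀ (v : V) (η : ℝ), 0 < η → contention M A s h (Metric.ball v (M.ρ * M.R)) ≤ η →
    ENNReal.ofReal (M.h₂ ^ (-η)) *
        (roundLaw M A s adv h).toOuterMeasure {x | outsideInterference M x.1 v < M.Icd} ≤
      (roundLaw M A s adv h).toOuterMeasure
        {x | outsideInterference M x.1 v < M.Icd ∧ x.2.busy v = false}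

/-- The adversary obeys the rules of the model after every history that can occur when the algorithm
`A` runs with source `s`. -/
def Admissible {V : Type} [Fintype V] [MetricSpace V] (M : Model) (A : Algorithm) (s : V)
    (adv : Adversary V) : Prop :=
  ∀ t, ∀ h ∈ (law M A s adv t).support,
    (∀ x ∈ (roundLaw M A s adv h).support, Legal M x.1 x.2) ∧ ContentionDetection M A s adv h

end WirelessBroadcast

end

noncomputable section

namespace WirelessBroadcast

/-!
After an initial round of the source, three kinds of rounds alternate.

In election rounds, the nodes contend for their vicinity with probabilities that they halve when
they sense a busy channel and double when they sense an idle one. A node whose transmission is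
acknowledged without a near reception wins; in the next notification round the winners transmit,
and the nodes near a successful winner pause for `S` elections. A potential argument bounds the
contention around each node on average over time: it shrinks by a constant factor whenever it is
high and detected, and detection fails with a probability exponentially small in the contention.
With moderate contention around a node, and little interference from afar by bounded independence,
each transmission gets through with constant probability. By a packing argument the pauses limit
the number of successful notifications in a vicinity to an `O(1/S)` fraction of the elections.
Were a node rarely notified, most elections near it would thus have little contention, it would
mostly sense an idle channel, and its transmission probability would grow beyond all bounds. Hence,
by Chernoff bounds along the random history, after `O(log n)` rounds every node is notified, that
is, has a winner within distance `ε R / 4`, in a constant fraction of all elections.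

In dissemination rounds, a node transmits with a probability proportional to the frequency of its
wins. These probabilities add up to at least a constant near every node, while the total number of
wins in a vicinity, and thus the contention, is bounded by packing. So in each such round the
message advances, with constant probability, one step along a shortest path from the source to a
given node, and a further Chernoff bound yields `O(D + log n)` rounds.
-/

/-! ### Concentration along random histories -/

section Mean

variable {α β : Type*}

/-- The expectation of `F` under `p`; with values in `ℝ≥0∞` it needs neither measurability nor
summability. -/
def mean (p : PMF α) (F : α → ℝ≥0∞) : ℝ≥0∞ := ∑' a, p a * F a

lemma mean_pure (a : α) (F : α → ℝ≥0∞) : mean (PMF.pure a) F = F a := by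
  unfold mean
  rw [tsum_eq_single a fun b hb => by simp [PMF.pure_apply, hb]]
  simp

lemma mean_bind (p : PMF α) (k : α → PMF β) (F : β → ℝ≥0∞) :
    mean (p.bind k) F = mean p fun a => mean (k a) F := by
  simp only [mean, PMF.bind_apply, ← ENNReal.tsum_mul_right, ← ENNReal.tsum_mul_left]
  rw [ENNReal.tsum_comm]
  simp only [mul_assoc]

lemma mean_map (p : PMF α) (g : α → β) (F : β → ℝ≥0∞) :
    mean (p.map g) F = mean p fun a => F (g a) := by
  simp only [← PMF.bind_pure_comp, mean_bind, Function.comp_apply, mean_pure]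

lemma mean_mono {p : PMF α} {F G : α → ℝ≥0∞} (h : ∀ a ∈ p.support, F a ≤ G a) :
    mean p F ≤ mean p G := by
  refine ENNReal.tsum_le_tsum fun a => ?_
  by_cases ha : p a = 0
  · simp [ha]
  · gcongr
    exact h a ((p.mem_support_iff a).2 ha)

lemma mean_congr {p : PMF α} {F G : α → ℝ≥0∞} (h : ∀ a ∈ p.support, F a = G a) :
    mean p F = mean p G :=
  le_antisymm (mean_mono fun a ha => (h a ha).le) (mean_mono fun a ha => (h a ha).ge)

lemma mean_const (p : PMF α) (c : ℝ≥0∞) : mean p (fun _ => c) = c := by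
  rw [mean, ENNReal.tsum_mul_right, PMF.tsum_coe, one_mul]

lemma mean_add (p : PMF α) (F G : α → ℝ≥0∞) :
    mean p (fun a => F a + G a) = mean p F + mean p G := by
  simp only [mean, mul_add, ENNReal.tsum_add]

lemma mean_sum {ι : Type*} (p : PMF α) (J : Finset ι) (F : ι → α → ℝ≥0∞) :
    mean p (fun a => ∑ i ∈ J, F i a) = ∑ i ∈ J, mean p (F i) := by
  simp only [mean, Finset.mul_sum]
  exact Summable.tsum_finsetSum fun _ _ => ENNReal.summable

lemma mean_const_mul (p : PMF α) (c : ℝ≥0∞) (F : α → ℝ≥0∞) :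
    mean p (fun a => c * F a) = c * mean p F := by
  simp only [mean, ← ENNReal.tsum_mul_left, mul_left_comm]

lemma toOuterMeasure_eq_mean (p : PMF α) (s : Set α) [DecidablePred (· ∈ s)] :
    p.toOuterMeasure s = mean p fun a => if a ∈ s then 1 else 0 := by
  simp only [PMF.toOuterMeasure_apply, mean, mul_ite, mul_one, mul_zero, Set.indicator_apply]

lemma toOuterMeasure_le_mean {p : PMF α} {s : Set α} {F : α → ℝ≥0∞}
    (h : ∀ a ∈ p.support, a ∈ s → 1 ≤ F a) : p.toOuterMeasure s ≤ mean p F := by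
  classical
  rw [toOuterMeasure_eq_mean]
  refine mean_mono fun a ha => ?_
  split_ifs with hs
  exacts [h a ha hs, zero_le]

lemma toOuterMeasure_mono_of_support {p : PMF α} {s t : Set α}
    (h : ∀ a ∈ p.support, a ∈ s → a ∈ t) : p.toOuterMeasure s ≤ p.toOuterMeasure t :=
  p.toOuterMeasure_mono fun a ha => h a ha.2 ha.1

lemma toOuterMeasure_add_compl (p : PMF α) (s : Set α) :
    p.toOuterMeasure s + p.toOuterMeasure sᶜ = 1 := by
  classical
  rw [toOuterMeasure_eq_mean, toOuterMeasure_eq_mean, ← mean_add]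
  refine (mean_congr fun a _ => ?_).trans (mean_const p 1)
  by_cases ha : a ∈ s <;> simp [ha]

lemma toOuterMeasure_le_one (p : PMF α) (s : Set α) : p.toOuterMeasure s ≤ 1 :=
  le_self_add.trans_eq (toOuterMeasure_add_compl p s)

lemma half_toOuterMeasure_le_diff {p : PMF α} {s t : Set α}
    (h : p.toOuterMeasure (s ∩ t) ≤ p.toOuterMeasure s / 2) :
    p.toOuterMeasure s / 2 ≤ p.toOuterMeasure (s \ t) := by
  have hs : p.toOuterMeasure s / 2 ≠ ⊤ := ENNReal.div_ne_top
    (ne_top_of_le_ne_top ENNReal.one_ne_top (toOuterMeasure_le_one p s)) two_ne_zero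
  refine (ENNReal.add_le_add_iff_left hs).1 ?_
  calc p.toOuterMeasure s / 2 + p.toOuterMeasure s / 2
      = p.toOuterMeasure (s ∩ t ∪ s \ t) := by rw [ENNReal.add_halves, Set.inter_union_sdiff]
    _ ≤ p.toOuterMeasure (s ∩ t) + p.toOuterMeasure (s \ t) := MeasureTheory.measure_union_le _ _
    _ ≤ p.toOuterMeasure s / 2 + p.toOuterMeasure (s \ t) := by gcongr

lemma sum_toOuterMeasure_le_of_pairwiseDisjoint {ι : Type*} {p : PMF α} {J : Finset ι}
    {E : ι → Set α} {s : Set α} (hE : (J : Set ι).PairwiseDisjoint E) (hs : ∀ i ∈ J, E i ⊆ s) :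
    ∑ i ∈ J, p.toOuterMeasure (E i) ≤ p.toOuterMeasure s := by
  classical
  simp only [toOuterMeasure_eq_mean, ← mean_sum]
  refine mean_mono fun a _ => ?_
  by_cases ha : ∃ i ∈ J, a ∈ E i
  · obtain ⟨i, hi, hai⟩ := ha
    rw [Finset.sum_eq_single_of_mem i hi fun j hj hji => if_neg fun haj =>
      Set.disjoint_left.1 (hE hj hi hji) haj hai, if_pos hai, if_pos (hs i hi hai)]
  · push Not at ha
    rw [Finset.sum_eq_zero fun i hi => if_neg (ha i hi)]
    exact zero_le

lemma toOuterMeasure_compl_le {p : PMF α} {s : Set α} {q : ℝ}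
    (h : ENNReal.ofReal (1 - q) ≤ p.toOuterMeasure s) :
    p.toOuterMeasure sᶜ ≤ ENNReal.ofReal q := by
  have hs : p.toOuterMeasure s ≠ ⊤ := ne_top_of_le_ne_top ENNReal.one_ne_top
    (toOuterMeasure_le_one p s)
  refine (ENNReal.add_le_add_iff_left hs).1 ?_
  calc p.toOuterMeasure s + p.toOuterMeasure sᶜ = ENNReal.ofReal ((1 - q) + q) := by
        simp [toOuterMeasure_add_compl]
    _ ≤ ENNReal.ofReal (1 - q) + ENNReal.ofReal q := ENNReal.ofReal_add_le
    _ ≤ p.toOuterMeasure s + ENNReal.ofReal q := by gcongr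

lemma le_toOuterMeasure_of_compl_le {p : PMF α} {s : Set α} {q : ℝ}
    (h : p.toOuterMeasure sᶜ ≤ ENNReal.ofReal q) (hq : 0 ≤ q) :
    ENNReal.ofReal (1 - q) ≤ p.toOuterMeasure s := by
  rw [ENNReal.ofReal_sub _ hq, ENNReal.ofReal_one, tsub_le_iff_right,
    ← toOuterMeasure_add_compl p s]
  gcongr

lemma toOuterMeasure_or_le {p : PMF α} (P Q : α → Prop) :
    p.toOuterMeasure {a | P a ∨ Q a} ≤ p.toOuterMeasure {a | P a} + p.toOuterMeasure {a | Q a} :=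
  MeasureTheory.measure_union_le {a | P a} {a | Q a}

lemma toOuterMeasure_exists_le {ι : Type*} [Fintype ι] {p : PMF α} {P : ι → α → Prop} {q : ℝ≥0∞}
    (h : ∀ i, p.toOuterMeasure {a | P i a} ≤ q) :
    p.toOuterMeasure {a | ∃ i, P i a} ≤ Fintype.card ι * q := by
  rw [show {a | ∃ i, P i a} = ⋃ i, {a | P i a} by ext; simp]
  refine (MeasureTheory.measure_iUnion_fintype_le _ _).trans
    ((Finset.sum_le_card_nsmul _ _ _ fun i _ => h i).trans_eq ?_)
  rw [Finset.card_univ, nsmul_eq_mul]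

end Mean

section Total

open Classical in
/-- The indicator of a proposition. -/
def ind (p : Prop) : ℝ := if p then 1 else 0

lemma ind_pos {p : Prop} (h : p) : ind p = 1 := if_pos h

lemma ind_neg {p : Prop} (h : ¬p) : ind p = 0 := if_neg h

lemma ind_nonneg (p : Prop) : 0 ≤ ind p := by
  unfold ind; split_ifs <;> norm_num

lemma ind_le_one (p : Prop) : ind p ≤ 1 := by
  unfold ind; split_ifs <;> norm_num

lemma ind_mono {p q : Prop} (h : p → q) : ind p ≤ ind q := by
  by_cases hp : p
  · rw [ind_pos hp, ind_pos (h hp)]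
  · rw [ind_neg hp]; exact ind_nonneg q

variable {α : Type*}

/-- The sum of `f` over the steps of a history, which lists the most recent step first; `f h x` is
the contribution of the step `x` that follows the history `h`. -/
def total (f : List α → α → ℝ) : List α → ℝ
  | [] => 0
  | x :: h => total f h + f h x

@[simp] lemma total_nil (f : List α → α → ℝ) : total f [] = 0 := rfl

@[simp] lemma total_cons (f : List α → α → ℝ) (x : α) (h : List α) :
    total f (x :: h) = total f h + f h x := rfl

lemma total_mono {f g : List α → α → ℝ} (hfg : ∀ h x, f h x ≤ g h x) (h : List α) :
    total f h ≤ total g h := by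
  induction h with
  | nil => rfl
  | cons x h ih => exact add_le_add ih (hfg h x)

lemma total_nonneg {f : List α → α → ℝ} (hf : ∀ h x, 0 ≤ f h x) (h : List α) :
    0 ≤ total f h := by
  induction h with
  | nil => rfl
  | cons x h ih => exact add_nonneg ih (hf h x)

lemma total_add (f g : List α → α → ℝ) (h : List α) :
    total (fun h x => f h x + g h x) h = total f h + total g h := by
  induction h with
  | nil => simp
  | cons x h ih => simp only [total_cons, ih]; ring

lemma total_sub (f g : List α → α → ℝ) (h : List α) :
    total (fun h x => f h x - g h x) h = total f h - total g h := by
  induction h with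
  | nil => simp
  | cons x h ih => simp only [total_cons, ih]; ring

lemma total_const_mul (c : ℝ) (f : List α → α → ℝ) (h : List α) :
    total (fun h x => c * f h x) h = c * total f h := by
  induction h with
  | nil => simp
  | cons x h ih => simp only [total_cons, ih, mul_add]

lemma total_sum {ι : Type*} (J : Finset ι) (f : ι → List α → α → ℝ) (h : List α) :
    total (fun h x => ∑ i ∈ J, f i h x) h = ∑ i ∈ J, total (f i) h := by
  induction h with
  | nil => simp
  | cons x h ih => simp only [total_cons, ih, Finset.sum_add_distrib]

lemma total_eq_zero_of_length_le {α : Type*} {f : List α → α → ℝ} {t₀ : ℕ}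
    (hf : ∀ h x, h.length < t₀ → f h x = 0) {h : List α} (hh : h.length ≤ t₀) :
    total f h = 0 := by
  induction h with
  | nil => rfl
  | cons x h ih =>
    rw [List.length_cons] at hh
    rw [total_cons, ih (by omega), hf h x (by omega), add_zero]

/-- The amount by which the number of steps in which `P` holds before and `B` during the step falls
short of the fraction `p` of the number of steps before which `P` holds. -/
def shortfall (p : ℝ) (P : List α → Prop) (B : List α → α → Prop) (h : List α) : ℝ :=
  p * total (fun h _ => ind (P h)) h - total (fun h x => ind (P h ∧ B h x)) h

end Total

section Trajectory

variable {α : Type*} {κ : List α → PMF α}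

/-- The law of the first `t` steps of the process whose next step has law `κ h` when `h` is the
history so far. -/
def trajectory (κ : List α → PMF α) : ℕ → PMF (List α)
  | 0 => PMF.pure []
  | t + 1 => (trajectory κ t).bind fun h => (κ h).map fun x => x :: h

lemma mean_trajectory_zero (F : List α → ℝ≥0∞) : mean (trajectory κ 0) F = F [] :=
  mean_pure [] F

lemma mean_trajectory_succ (t : ℕ) (F : List α → ℝ≥0∞) :
    mean (trajectory κ (t + 1)) F =
      mean (trajectory κ t) fun h => mean (κ h) fun x => F (x :: h) := by
  simp only [trajectory, mean_bind, mean_map]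

lemma mem_support_trajectory_zero {h : List α} : h ∈ (trajectory κ 0).support ↔ h = [] := by
  simp [trajectory]

lemma mem_support_trajectory_succ {t : ℕ} {h : List α} :
    h ∈ (trajectory κ (t + 1)).support ↔
      ∃ h' ∈ (trajectory κ t).support, ∃ x ∈ (κ h').support, x :: h' = h := by
  simp only [trajectory, PMF.mem_support_bind_iff, PMF.support_map, Set.mem_image]

lemma length_of_mem_support_trajectory {t : ℕ} {h : List α}
    (hh : h ∈ (trajectory κ t).support) : h.length = t := by
  induction t generalizing h with
  | zero => rw [mem_support_trajectory_zero.1 hh, List.length_nil]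
  | succ t ih =>
    obtain ⟨h', hh', x, -, rfl⟩ := mem_support_trajectory_succ.1 hh
    rw [List.length_cons, ih hh']

lemma mean_exp_total_le {f : List α → α → ℝ}
    (hf : ∀ t, ∀ h ∈ (trajectory κ t).support,
      mean (κ h) (fun x => ENNReal.ofReal (Real.exp (f h x))) ≤ 1) (t : ℕ) :
    mean (trajectory κ t) (fun h => ENNReal.ofReal (Real.exp (total f h))) ≤ 1 := by
  induction t with
  | zero => simp [mean_trajectory_zero]
  | succ t ih =>
    rw [mean_trajectory_succ]
    refine (mean_mono fun h hh => ?_).trans ih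
    simp only [total_cons, Real.exp_add, ENNReal.ofReal_mul (Real.exp_pos _).le, mean_const_mul]
    exact mul_le_of_le_one_right' (hf t h hh)

lemma trajectory_total_ge_le {f : List α → α → ℝ}
    (hf : ∀ t, ∀ h ∈ (trajectory κ t).support,
      mean (κ h) (fun x => ENNReal.ofReal (Real.exp (f h x))) ≤ 1) (t : ℕ) (θ : ℝ) :
    (trajectory κ t).toOuterMeasure {h | θ ≤ total f h} ≤ ENNReal.ofReal (Real.exp (-θ)) := by
  calc (trajectory κ t).toOuterMeasure {h | θ ≤ total f h}
      ≤ mean (trajectory κ t) (fun h => ENNReal.ofReal (Real.exp (-θ)) *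
          ENNReal.ofReal (Real.exp (total f h))) := by
        refine toOuterMeasure_le_mean fun h _ (hh : θ ≤ total f h) => ?_
        rw [← ENNReal.ofReal_mul (Real.exp_pos _).le, ← Real.exp_add]
        exact ENNReal.one_le_ofReal.2 (Real.one_le_exp (by linarith))
    _ = ENNReal.ofReal (Real.exp (-θ)) *
          mean (trajectory κ t) (fun h => ENNReal.ofReal (Real.exp (total f h))) :=
        mean_const_mul _ _ _
    _ ≤ ENNReal.ofReal (Real.exp (-θ)) :=
        mul_le_of_le_one_right' (mean_exp_total_le hf t)

lemma exp_neg_le_one_sub_add_sq {x : ℝ} (hx : 0 ≤ x) : Real.exp (-x) ≤ 1 - x + x ^ 2 := by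
  have hinv : Real.exp (-x) * (1 + x) ≤ 1 := by
    calc Real.exp (-x) * (1 + x) ≤ Real.exp (-x) * Real.exp x := by
          gcongr; linarith [Real.add_one_le_exp x]
      _ = 1 := by rw [← Real.exp_add, neg_add_cancel, Real.exp_zero]
  refine le_of_mul_le_mul_right (hinv.trans ?_) (by linarith : 0 < 1 + x)
  nlinarith [pow_nonneg hx 3]

lemma exp_mul_one_sub_le_one {p p' : ℝ} (hp' : 0 ≤ p') (hpp : p' ≤ p) (hp : p ≤ 1) :
    Real.exp ((p - p') * p') * (1 - p * (1 - Real.exp (-(p - p')))) ≤ 1 := by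
  set l := p - p'
  have hl0 : 0 ≤ l := sub_nonneg.2 hpp
  have hdrop : l * p' ≤ p * (1 - Real.exp (-l)) := by
    calc l * p' ≤ l * (p * (1 - l)) := by gcongr; nlinarith
      _ = p * (l - l ^ 2) := by ring
      _ ≤ p * (1 - Real.exp (-l)) := by
          have := exp_neg_le_one_sub_add_sq hl0
          exact mul_le_mul_of_nonneg_left (by linarith) (hp'.trans hpp)
  calc Real.exp (l * p') * (1 - p * (1 - Real.exp (-l)))
      ≤ Real.exp (l * p') * Real.exp (-(l * p')) := by
        gcongr; linarith [Real.add_one_le_exp (-(l * p'))]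
    _ = 1 := by rw [← Real.exp_add, add_neg_cancel, Real.exp_zero]

/-- One step of the Chernoff bound. -/
lemma mean_exp_sub_ind_le_one {q : PMF α} {B : Set α} {p p' : ℝ} (hp' : 0 ≤ p') (hpp : p' ≤ p)
    (hp : p ≤ 1) (hB : ENNReal.ofReal p ≤ q.toOuterMeasure B) :
    mean q (fun x => ENNReal.ofReal (Real.exp ((p - p') * (p' - ind (x ∈ B))))) ≤ 1 := by
  classical
  set l := p - p'
  set D := Real.exp (l * p') * (1 - Real.exp (-l)) with hD
  have hl0 : 0 ≤ l := sub_nonneg.2 hpp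
  have hD0 : 0 ≤ D := mul_nonneg (Real.exp_pos _).le
    (sub_nonneg.2 (Real.exp_le_one_iff.2 (neg_nonpos.2 hl0)))
  have hmean : mean q (fun x => ENNReal.ofReal (Real.exp (l * (p' - ind (x ∈ B))))) +
      ENNReal.ofReal D * q.toOuterMeasure B = ENNReal.ofReal (Real.exp (l * p')) := by
    rw [toOuterMeasure_eq_mean, ← mean_const_mul, ← mean_add]
    refine (mean_congr fun x _ => ?_).trans (mean_const q _)
    by_cases hx : x ∈ B
    · rw [ind_pos hx, if_pos hx, mul_one, ← ENNReal.ofReal_add (Real.exp_pos _).le hD0, hD,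
        mul_sub l, mul_one, sub_eq_add_neg, Real.exp_add]
      ring_nf
    · rw [ind_neg hx, if_neg hx, sub_zero, mul_zero, add_zero]
  have hbound : ENNReal.ofReal (Real.exp (l * p')) ≤ 1 + ENNReal.ofReal D * q.toOuterMeasure B := by
    calc ENNReal.ofReal (Real.exp (l * p')) ≤ ENNReal.ofReal (1 + D * p) :=
          ENNReal.ofReal_le_ofReal (by linarith [exp_mul_one_sub_le_one hp' hpp hp])
      _ ≤ 1 + ENNReal.ofReal D * ENNReal.ofReal p := by
          rw [← ENNReal.ofReal_mul hD0, ← ENNReal.ofReal_one]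
          exact ENNReal.ofReal_add_le
      _ ≤ 1 + ENNReal.ofReal D * q.toOuterMeasure B := by gcongr
  refine (ENNReal.add_le_add_iff_right (ne_top_of_le_ne_top ENNReal.ofReal_ne_top
    (le_add_self.trans_eq hmean))).1 (hmean.trans_le hbound)

lemma mean_exp_ind_sub_log_two_le_one {α : Type*} {q : PMF α} {F : Set α} {b : ℝ}
    (hF : q.toOuterMeasure F ≤ ENNReal.ofReal (Real.exp (-b))) :
    mean q (fun x => ENNReal.ofReal (Real.exp (b * ind (x ∈ F) - Real.log 2))) ≤ 1 := by
  classical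
  calc mean q (fun x => ENNReal.ofReal (Real.exp (b * ind (x ∈ F) - Real.log 2)))
      ≤ mean q (fun x => ENNReal.ofReal (1 / 2) +
          ENNReal.ofReal (Real.exp b / 2) * (if x ∈ F then 1 else 0)) := by
        refine mean_mono fun x _ => ?_
        rw [Real.exp_sub, Real.exp_log two_pos]
        by_cases hx : x ∈ F
        · rw [ind_pos hx, if_pos hx, mul_one, mul_one]
          exact le_add_of_nonneg_left zero_le
        · rw [ind_neg hx, if_neg hx, mul_zero, mul_zero, add_zero, Real.exp_zero]
    _ = ENNReal.ofReal (1 / 2) + ENNReal.ofReal (Real.exp b / 2) * q.toOuterMeasure F := by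
        rw [mean_add, mean_const, mean_const_mul, ← toOuterMeasure_eq_mean]
    _ ≤ ENNReal.ofReal (1 / 2) +
          ENNReal.ofReal (Real.exp b / 2) * ENNReal.ofReal (Real.exp (-b)) := by gcongr
    _ = 1 := by
        rw [← ENNReal.ofReal_mul (by positivity), ← ENNReal.ofReal_add (by norm_num)
          (by positivity), div_mul_eq_mul_div, ← Real.exp_add, add_neg_cancel, Real.exp_zero]
        norm_num

lemma trajectory_chernoff {P : List α → Prop} {B : List α → α → Prop} {p p' : ℝ}
    (hp' : 0 ≤ p') (hpp : p' ≤ p) (hp : p ≤ 1)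
    (hB : ∀ t, ∀ h ∈ (trajectory κ t).support, P h →
      ENNReal.ofReal p ≤ (κ h).toOuterMeasure {x | B h x}) (t : ℕ) (θ : ℝ) :
    (trajectory κ t).toOuterMeasure {h | θ ≤ shortfall p' P B h} ≤
      ENNReal.ofReal (Real.exp (-((p - p') * θ))) := by
  refine le_trans (toOuterMeasure_mono_of_support fun h _ hh => ?_) (trajectory_total_ge_le
    (f := fun h x => (p - p') * (p' * ind (P h) - ind (P h ∧ B h x))) ?_ t ((p - p') * θ))
  · rw [Set.mem_ofPred_eq, shortfall] at hh
    rw [Set.mem_ofPred_eq, total_const_mul, total_sub, total_const_mul]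
    exact mul_le_mul_of_nonneg_left hh (sub_nonneg.2 hpp)
  · intro t h hh
    by_cases hP : P h
    · simp only [hP, true_and, ind_pos trivial, mul_one]
      exact mean_exp_sub_ind_le_one hp' hpp hp (hB t h hh hP)
    · simp [ind_neg, hP, mean_const]

lemma trajectory_one_le_total_le (Q : List α → Prop) (T : ℕ) :
    (trajectory κ T).toOuterMeasure {h | 1 ≤ total (fun h _ => ind (Q h)) h} ≤
      ∑ t ∈ Finset.range T, (trajectory κ t).toOuterMeasure {h | Q h} := by
  classical
  refine (toOuterMeasure_le_mean (F := fun h => ENNReal.ofReal (total (fun h _ => ind (Q h)) h))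
    fun h _ hh => ENNReal.one_le_ofReal.2 hh).trans ?_
  induction T with
  | zero => simp [mean_trajectory_zero]
  | succ T ih =>
    rw [mean_trajectory_succ, Finset.sum_range_succ]
    refine le_trans ?_ (add_le_add_left ih _)
    rw [toOuterMeasure_eq_mean, ← mean_add]
    refine mean_mono fun h _ => ?_
    simp only [total_cons, mean_const]
    rw [ENNReal.ofReal_add (total_nonneg (fun _ _ => ind_nonneg _) h) (ind_nonneg _)]
    gcongr
    unfold ind
    split_ifs with hQ hQ' <;> simp_all

end Trajectory

section Law

variable {V : Type} [Fintype V] [MetricSpace V] {M : Model} {A : Algorithm} {s : V}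
  {adv : Adversary V}

lemma law_eq_trajectory (t : ℕ) : law M A s adv t = trajectory (roundLaw M A s adv) t := by
  induction t with
  | zero => rfl
  | succ t ih => rw [law, trajectory, ih]

lemma length_of_mem_support {t : ℕ} {h : History V} (hh : h ∈ (law M A s adv t).support) :
    h.length = t := by
  rw [law_eq_trajectory] at hh
  exact length_of_mem_support_trajectory hh

end Law

/-! ### Independent transmissions -/

section IndependentSet

variable {V : Type} [Fintype V] {p : V → ℝ≥0} {hp : ∀ v, p v ≤ 1}

open Classical in
lemma independentSet_apply (S : Finset V) : independentSet p hp S =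
    (∏ v ∈ S, (p v : ℝ≥0∞)) * ∏ v ∈ Finset.univ \ S, (1 - (p v : ℝ≥0∞)) := rfl

lemma prob_ne_zero_of_mem_support {S : Finset V} (hS : S ∈ (independentSet p hp).support) {v : V}
    (hv : v ∈ S) : p v ≠ 0 := by
  classical
  intro h0
  rw [PMF.mem_support_iff, independentSet_apply] at hS
  exact hS (by rw [Finset.prod_eq_zero hv (by simp [h0]), zero_mul])

lemma mem_of_prob_eq_one {S : Finset V} (hS : S ∈ (independentSet p hp).support) {v : V}
    (hv : p v = 1) : v ∈ S := by
  classical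
  by_contra h
  rw [PMF.mem_support_iff, independentSet_apply] at hS
  exact hS (by rw [Finset.prod_eq_zero (i := v) (s := Finset.univ \ S) (by simp [h]) (by simp [hv]),
    mul_zero])

/-- The event that a random set contains `X` and avoids `Y`. -/
def cylinder (X Y : Finset V) : Set (Finset V) := {S | X ⊆ S ∧ Disjoint S Y}

open Classical in
lemma indicator_cylinder_independentSet (X Y S : Finset V) :
    (cylinder X Y).indicator (independentSet p hp) S =
      (∏ v ∈ S, if v ∈ Y then 0 else (p v : ℝ≥0∞)) *
        ∏ v ∈ Finset.univ \ S, if v ∈ X then 0 else 1 - (p v : ℝ≥0∞) := by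
  by_cases hS : S ∈ cylinder X Y
  · rw [Set.indicator_of_mem hS, independentSet_apply]
    congr 1
    · exact Finset.prod_congr rfl fun v hv => (if_neg (Finset.disjoint_left.1 hS.2 hv)).symm
    · exact Finset.prod_congr rfl fun v hv =>
        (if_neg fun h => (Finset.mem_sdiff.1 hv).2 (hS.1 h)).symm
  · rw [Set.indicator_of_notMem hS]
    rcases not_and_or.1 hS with hX | hY
    · obtain ⟨v, hvX, hvS⟩ := Finset.not_subset.1 hX
      rw [Finset.prod_eq_zero (i := v) (s := Finset.univ \ S) (by simp [hvS])
        (by rw [if_pos hvX]), mul_zero]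
    · obtain ⟨v, hvS, hvY⟩ := Finset.not_disjoint_iff.1 hY
      rw [Finset.prod_eq_zero hvS (by rw [if_pos hvY]), zero_mul]

lemma independentSet_cylinder {X Y : Finset V} (hXY : Disjoint X Y) :
    (independentSet p hp).toOuterMeasure (cylinder X Y) =
      (∏ v ∈ X, (p v : ℝ≥0∞)) * ∏ v ∈ Y, (1 - (p v : ℝ≥0∞)) := by
  classical
  have hfactor : ∀ v, ((if v ∈ Y then 0 else (p v : ℝ≥0∞)) +
      if v ∈ X then 0 else 1 - (p v : ℝ≥0∞)) =
      (if v ∈ X then (p v : ℝ≥0∞) else 1) * (if v ∈ Y then 1 - (p v : ℝ≥0∞) else 1) := by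
    intro v
    have hsum : (p v : ℝ≥0∞) + (1 - p v) = 1 := add_tsub_cancel_of_le (by exact_mod_cast hp v)
    by_cases hX : v ∈ X
    · simp [hX, Finset.disjoint_left.1 hXY hX]
    · by_cases hY : v ∈ Y <;> simp [hX, hY, hsum]
  simp only [PMF.toOuterMeasure_apply_fintype, indicator_cylinder_independentSet]
  rw [← Finset.powerset_univ, ← Finset.prod_add]
  simp only [hfactor, Finset.prod_mul_distrib, Finset.prod_ite_mem, Finset.univ_inter]

lemma independentSet_cylinder_inter_mem {X Y : Finset V} (hXY : Disjoint X Y) {w : V}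
    (hwX : w ∉ X) (hwY : w ∉ Y) :
    (independentSet p hp).toOuterMeasure (cylinder X Y ∩ {S | w ∈ S}) =
      (independentSet p hp).toOuterMeasure (cylinder X Y) * p w := by
  classical
  have hset : cylinder X Y ∩ {S | w ∈ S} = cylinder (insert w X) Y := by
    ext S
    simp only [cylinder, Set.mem_inter_iff, Set.mem_ofPred_eq, Finset.insert_subset_iff]
    tauto
  rw [hset, independentSet_cylinder hXY,
    independentSet_cylinder (Finset.disjoint_insert_left.2 ⟨hwY, hXY⟩), Finset.prod_insert hwX]
  ring

open Classical in
lemma independentSet_markov {X Y W : Finset V} (hXY : Disjoint X Y) (hWX : Disjoint W X)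
    (hWY : Disjoint W Y) {g : V → ℝ} (hg : ∀ w, 0 ≤ g w) {θ : ℝ} (hθ : 0 < θ) :
    (independentSet p hp).toOuterMeasure (cylinder X Y ∩ {S | θ ≤ ∑ w ∈ W with w ∈ S, g w}) ≤
      (independentSet p hp).toOuterMeasure (cylinder X Y) *
        ENNReal.ofReal ((∑ w ∈ W, p w * g w) / θ) := by
  set E := (independentSet p hp).toOuterMeasure (cylinder X Y)
  calc (independentSet p hp).toOuterMeasure (cylinder X Y ∩ {S | θ ≤ ∑ w ∈ W with w ∈ S, g w})
      ≤ mean (independentSet p hp) (fun S => ∑ w ∈ W, ENNReal.ofReal (g w / θ) *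
          (if S ∈ cylinder X Y ∩ {S | w ∈ S} then 1 else 0)) := by
        refine toOuterMeasure_le_mean fun S _ ⟨hSXY, hSθ⟩ => ?_
        calc (1 : ℝ≥0∞) ≤ ENNReal.ofReal ((∑ w ∈ W with w ∈ S, g w) / θ) :=
              ENNReal.one_le_ofReal.2 ((one_le_div hθ).2 hSθ)
          _ = ∑ w ∈ W with w ∈ S, ENNReal.ofReal (g w / θ) := by
              rw [Finset.sum_div, ENNReal.ofReal_sum_of_nonneg]
              exact fun w _ => div_nonneg (hg w) hθ.le
          _ = _ := by simp [Finset.sum_filter, hSXY]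
    _ = ∑ w ∈ W, ENNReal.ofReal (g w / θ) * (E * p w) := by
        rw [mean_sum]
        refine Finset.sum_congr rfl fun w hw => ?_
        rw [mean_const_mul, ← toOuterMeasure_eq_mean, independentSet_cylinder_inter_mem hXY
          (Finset.disjoint_left.1 hWX hw) (Finset.disjoint_left.1 hWY hw)]
    _ = E * ENNReal.ofReal ((∑ w ∈ W, p w * g w) / θ) := by
        rw [Finset.sum_div, ENNReal.ofReal_sum_of_nonneg
          (fun w _ => div_nonneg (mul_nonneg (p w).coe_nonneg (hg w)) hθ.le), Finset.mul_sum]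
        refine Finset.sum_congr rfl fun w _ => ?_
        rw [mul_div_assoc, ENNReal.ofReal_mul (p w).coe_nonneg, ENNReal.ofReal_coe_nnreal]
        ring

open Classical in
lemma independentSet_sum_ge_le (W : Finset V) {g : V → ℝ} (hg : ∀ w, 0 ≤ g w) {θ : ℝ}
    (hθ : 0 < θ) :
    (independentSet p hp).toOuterMeasure {S | θ ≤ ∑ w ∈ W with w ∈ S, g w} ≤
      ENNReal.ofReal ((∑ w ∈ W, p w * g w) / θ) := by
  have hmarkov := independentSet_markov (p := p) (hp := hp) (X := ∅) (Y := ∅) (W := W)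
    (Finset.disjoint_empty_left _) (Finset.disjoint_empty_right _)
    (Finset.disjoint_empty_right _) hg hθ
  have huniv : cylinder (∅ : Finset V) ∅ = Set.univ := by
    ext S; simp [cylinder]
  rw [huniv, Set.univ_inter] at hmarkov
  exact hmarkov.trans (mul_le_of_le_one_left' (toOuterMeasure_le_one _ _))

lemma exp_neg_two_mul_le_one_sub {q : ℝ} (h0 : 0 ≤ q) (h1 : q ≤ 1 / 2) :
    Real.exp (-(2 * q)) ≤ 1 - q := by
  have hinv : Real.exp (-(2 * q)) * Real.exp (2 * q) = 1 := by rw [← Real.exp_add]; simp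
  nlinarith [Real.add_one_le_exp (2 * q), Real.exp_pos (-(2 * q))]

lemma exp_neg_two_mul_sum_le_prod_one_sub {ι : Type*} (B : Finset ι) {q : ι → ℝ}
    (h0 : ∀ i ∈ B, 0 ≤ q i) (h1 : ∀ i ∈ B, q i ≤ 1 / 2) :
    Real.exp (-(2 * ∑ i ∈ B, q i)) ≤ ∏ i ∈ B, (1 - q i) := by
  rw [Finset.mul_sum, ← Finset.sum_neg_distrib, Real.exp_sum]
  exact Finset.prod_le_prod (fun _ _ => (Real.exp_pos _).le)
    fun i hi => exp_neg_two_mul_le_one_sub (h0 i hi) (h1 i hi)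

open Classical in
lemma le_independentSet_singleton {B : Finset V} {u : V} (hhalf : ∀ v, (p v : ℝ) ≤ 1 / 2) {K : ℝ}
    (hK : ∑ v ∈ B, (p v : ℝ) ≤ K) :
    ENNReal.ofReal (Real.exp (-(2 * K)) * p u) ≤
      (independentSet p hp).toOuterMeasure (cylinder {u} (B.erase u)) := by
  have hprod : ∏ v ∈ B.erase u, (1 - (p v : ℝ≥0∞)) =
      ENNReal.ofReal (∏ v ∈ B.erase u, (1 - (p v : ℝ))) := by
    rw [ENNReal.ofReal_prod_of_nonneg (fun v _ => by linarith [hhalf v])]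
    refine Finset.prod_congr rfl fun v _ => ?_
    rw [ENNReal.ofReal_sub _ (p v).coe_nonneg, ENNReal.ofReal_one, ENNReal.ofReal_coe_nnreal]
  have hsum : ∑ v ∈ B.erase u, (p v : ℝ) ≤ K :=
    (Finset.sum_le_sum_of_subset_of_nonneg (Finset.erase_subset _ _)
      fun v _ _ => (p v).coe_nonneg).trans hK
  rw [independentSet_cylinder (by simp), Finset.prod_singleton, hprod, mul_comm,
    ENNReal.ofReal_mul (p u).coe_nonneg, ENNReal.ofReal_coe_nnreal]
  gcongr
  exact (Real.exp_le_exp.2 (by linarith)).trans (exp_neg_two_mul_sum_le_prod_one_sub _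
    (fun v _ => (p v).coe_nonneg) fun v _ => hhalf v)

open Classical in
lemma le_independentSet_singleton_diff {B W : Finset V} (hBW : Disjoint B W) {u : V} (hu : u ∈ B)
    {g : V → ℝ} (hg : ∀ w, 0 ≤ g w) (hhalf : ∀ v, (p v : ℝ) ≤ 1 / 2) {K θ : ℝ} (hθ : 0 < θ)
    (hK : ∑ v ∈ B, (p v : ℝ) ≤ K) (hW : ∑ w ∈ W, p w * g w ≤ θ / 2) :
    ENNReal.ofReal (Real.exp (-(2 * K)) / 2 * p u) ≤ (independentSet p hp).toOuterMeasure
      (cylinder {u} (B.erase u) \ {S | θ ≤ ∑ w ∈ W with w ∈ S, g w}) := by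
  have hmarkov := independentSet_markov (p := p) (hp := hp) (X := {u}) (Y := B.erase u) (W := W)
    (by simp) (Finset.disjoint_singleton_right.2 (Finset.disjoint_left.1 hBW hu))
    (hBW.symm.mono_right (Finset.erase_subset _ _)) hg hθ
  have hweight : ENNReal.ofReal ((∑ w ∈ W, p w * g w) / θ) ≤ 2⁻¹ := by
    rw [← ENNReal.ofReal_ofNat 2, ← ENNReal.ofReal_inv_of_pos two_pos]
    exact ENNReal.ofReal_le_ofReal ((div_le_iff₀ hθ).2 (by linarith))
  refine le_trans ?_ (half_toOuterMeasure_le_diff (hmarkov.trans (mul_le_mul_right hweight _)))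
  rw [div_mul_eq_mul_div, ENNReal.ofReal_div_of_pos two_pos, ENNReal.ofReal_ofNat]
  exact ENNReal.div_le_div_right (le_independentSet_singleton hhalf hK) _

open Classical in
lemma le_independentSet_isolated {B W U : Finset V} (hBW : Disjoint B W) (hU : U ⊆ B) {g : V → ℝ}
    (hg : ∀ w, 0 ≤ g w) (hhalf : ∀ v, (p v : ℝ) ≤ 1 / 2) {K θ : ℝ} (hθ : 0 < θ)
    (hK : ∑ v ∈ B, (p v : ℝ) ≤ K) (hW : ∑ w ∈ W, p w * g w ≤ θ / 2) :
    ENNReal.ofReal (Real.exp (-(2 * K)) / 2 * ∑ u ∈ U, (p u : ℝ)) ≤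
      (independentSet p hp).toOuterMeasure {S | ∃ u ∈ U, u ∈ S ∧ (∀ w ∈ S, w ∈ B → w = u) ∧
        ∑ w ∈ W with w ∈ S, g w < θ} := by
  have only_random {u w : V} {S : Finset V} (hS : S ∈ cylinder {u} (B.erase u)) (hw : w ∈ S)
      (hwB : w ∈ B) : w = u := by
    by_contra hne
    exact Finset.disjoint_left.1 hS.2 hw (Finset.mem_erase.2 ⟨hne, hwB⟩)
  rw [Finset.mul_sum, ENNReal.ofReal_sum_of_nonneg fun u _ => by positivity]
  refine (Finset.sum_le_sum fun u hu =>
    le_independentSet_singleton_diff hBW (hU hu) hg hhalf hθ hK hW).trans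
    (sum_toOuterMeasure_le_of_pairwiseDisjoint (fun u hu v _ hne => ?_) fun u hu S hS => ?_)
  · refine Set.disjoint_left.2 fun S hSu hSv => hne ?_
    exact only_random hSv.1 (Finset.singleton_subset_iff.1 hSu.1.1) (hU hu)
  · exact ⟨u, hu, Finset.singleton_subset_iff.1 hS.1.1, fun w hw hwB => only_random hS.1 hw hwB,
      not_le.1 hS.2⟩

end IndependentSet

section Round

variable {V : Type} [Fintype V] [MetricSpace V] {M : Model} {A : Algorithm} {s : V}
  {adv : Adversary V}

lemma mean_roundLaw (h : History V) (F : Finset V × Outcome V → ℝ≥0∞) :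
    mean (roundLaw M A s adv h) F =
      mean (independentSet (transmitProb M A s h) fun _ => A.prob_le_one _)
        fun S => mean (adv h S) fun o => F (S, o) := by
  simp only [roundLaw, mean_bind, mean_map]

lemma roundLaw_fst (h : History V) (E : Set (Finset V)) :
    (roundLaw M A s adv h).toOuterMeasure {x | x.1 ∈ E} =
      (independentSet (transmitProb M A s h) fun _ => A.prob_le_one _).toOuterMeasure E := by
  classical
  rw [toOuterMeasure_eq_mean, toOuterMeasure_eq_mean, mean_roundLaw]
  exact mean_congr fun S _ => mean_const (adv h S) (if S ∈ E then 1 else 0)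

lemma fst_mem_support {h : History V} {x : Finset V × Outcome V}
    (hx : x ∈ (roundLaw M A s adv h).support) :
    x.1 ∈ (independentSet (transmitProb M A s h) fun _ => A.prob_le_one _).support := by
  rw [roundLaw, PMF.mem_support_bind_iff] at hx
  obtain ⟨S, hS, hx⟩ := hx
  rw [PMF.support_map] at hx
  obtain ⟨o, -, rfl⟩ := hx
  exact hS

/-- The round `x` can follow the history `h`. -/
structure RoundOK {V : Type} [MetricSpace V] (M : Model) (A : Algorithm) (s : V) (h : History V)
    (x : Finset V × Outcome V) : Prop where
  legal : Legal M x.1 x.2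
  prob_ne_zero : ∀ v ∈ x.1, A.prob (state M A s h v) ≠ 0
  mem_of_prob : ∀ v, A.prob (state M A s h v) = 1 → v ∈ x.1

/-- All rounds of a history are possible ones. The deterministic invariants of the algorithm hold
along such histories. -/
def Valid {V : Type} [MetricSpace V] (M : Model) (A : Algorithm) (s : V) : History V → Prop
  | [] => True
  | x :: h => Valid M A s h ∧ RoundOK M A s h x

lemma roundOK_of_mem_support (hadm : Admissible M A s adv) {t : ℕ} {h : History V}
    (hh : h ∈ (law M A s adv t).support) {x : Finset V × Outcome V}
    (hx : x ∈ (roundLaw M A s adv h).support) : RoundOK M A s h x where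
  legal := (hadm t h hh).1 x hx
  prob_ne_zero _ hv := prob_ne_zero_of_mem_support (fst_mem_support hx) hv
  mem_of_prob _ hv := mem_of_prob_eq_one (fst_mem_support hx) hv

lemma valid_of_mem_support (hadm : Admissible M A s adv) {t : ℕ} {h : History V}
    (hh : h ∈ (law M A s adv t).support) : Valid M A s h := by
  induction t generalizing h with
  | zero =>
    rw [law_eq_trajectory, mem_support_trajectory_zero] at hh
    subst hh
    trivial
  | succ t ih =>
    rw [law_eq_trajectory, mem_support_trajectory_succ, ← law_eq_trajectory] at hh
    obtain ⟨h', hh', x, hx, rfl⟩ := hh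
    exact ⟨ih hh', roundOK_of_mem_support hadm hh' hx⟩

end Round

section Geometry

variable {V : Type} [MetricSpace V]

/-- Distinct elements of `Z` are at distance at least `d`. In contrast to `Metric.IsSeparated`, the
distance `d` itself is allowed. -/
def Separated (d : ℝ) (Z : Finset V) : Prop :=
  (Z : Set V).Pairwise fun u v => d ≤ dist u v

lemma Separated.subset {d : ℝ} {Z Z' : Finset V} (hZ : Separated d Z) (h : Z' ⊆ Z) :
    Separated d Z' :=
  hZ.mono (Finset.coe_subset.2 h)

lemma Separated.card_le {r lam C : ℝ} (hb : BoundedIndependence V r lam C) {q : ℝ} (hq : 0 ≤ q)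
    {Z : Finset V} (hZ : Separated (2 * r) Z) {x : V} (hx : ∀ z ∈ Z, dist z x ≤ q * r) :
    (Z.card : ℝ) ≤ C * (q + 1) ^ lam := by
  refine hb (q + 1) (by linarith) x Z ⟨fun u hu => ?_, fun u hu v hv huv => ?_⟩
  · exact Metric.ball_subset_ball' (by linarith [hx u hu])
  · exact Metric.ball_disjoint_ball (by linarith [hZ hu hv huv])

lemma sum_rpow_annulus_le {r lam C ζ ℓ : ℝ} (hb : BoundedIndependence V r lam C) (hr : 0 < r)
    (hC : 0 ≤ C) (hlam : 0 ≤ lam) (hζ : 0 ≤ ζ) (hℓ : r ≤ ℓ) {Z : Finset V}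
    (hZ : Separated (2 * r) Z) (x : V) :
    ∑ z ∈ Z with ℓ ≤ dist z x ∧ dist z x < 2 * ℓ, dist z x ^ (-ζ) ≤
      C * (4 / r) ^ lam * ℓ ^ (lam - ζ) := by
  have hℓ0 : 0 < ℓ := hr.trans_le hℓ
  set Z' := Z.filter fun z => ℓ ≤ dist z x ∧ dist z x < 2 * ℓ
  have hcard : (Z'.card : ℝ) ≤ C * (4 / r * ℓ) ^ lam := by
    refine ((hZ.subset (Finset.filter_subset _ _)).card_le hb (q := 2 * ℓ / r) (by positivity)
      (x := x) fun z hz => ?_).trans ?_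
    · rw [div_mul_cancel₀ _ hr.ne']
      exact (Finset.mem_filter.1 hz).2.2.le
    · gcongr
      rw [div_add_one hr.ne', div_mul_eq_mul_div, div_le_div_iff_of_pos_right hr]
      linarith
  calc ∑ z ∈ Z', dist z x ^ (-ζ) ≤ Z'.card * ℓ ^ (-ζ) := by
        rw [← nsmul_eq_mul]
        exact Finset.sum_le_card_nsmul _ _ _ fun z hz => Real.rpow_le_rpow_of_nonpos hℓ0
          (Finset.mem_filter.1 hz).2.1 (by linarith)
    _ ≤ C * (4 / r * ℓ) ^ lam * ℓ ^ (-ζ) := by gcongr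
    _ = C * (4 / r) ^ lam * ℓ ^ (lam - ζ) := by
        rw [Real.mul_rpow (by positivity) hℓ0.le, sub_eq_add_neg, Real.rpow_add hℓ0]
        ring

lemma sum_rpow_dyadic_le {r lam C ζ ℓ : ℝ} (hb : BoundedIndependence V r lam C) (hr : 0 < r)
    (hC : 0 ≤ C) (hlam : 0 ≤ lam) (hζ : 0 ≤ ζ) (hℓ : r ≤ ℓ) {Z : Finset V}
    (hZ : Separated (2 * r) Z) (x : V) (J : ℕ) :
    ∑ z ∈ Z with ℓ ≤ dist z x ∧ dist z x < 2 ^ J * ℓ, dist z x ^ (-ζ) ≤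
      C * (4 / r) ^ lam * ℓ ^ (lam - ζ) * ∑ j ∈ Finset.range J, ((2 : ℝ) ^ (lam - ζ)) ^ j := by
  have hℓ0 : 0 < ℓ := hr.trans_le hℓ
  induction J with
  | zero =>
    rw [Finset.filter_eq_empty_iff.2 fun z _ h => by linarith [h.1, h.2], Finset.range_zero]
    simp
  | succ J ih =>
    have hone : (1 : ℝ) ≤ 2 ^ J := one_le_pow₀ one_le_two
    have hscale : (2 ^ J * ℓ) ^ (lam - ζ) = ℓ ^ (lam - ζ) * ((2 : ℝ) ^ (lam - ζ)) ^ J := by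
      rw [Real.mul_rpow (by positivity) hℓ0.le, mul_comm, ← Real.rpow_natCast_mul two_pos.le,
        ← Real.rpow_mul_natCast two_pos.le, mul_comm (J : ℝ)]
    have hannulus := sum_rpow_annulus_le hb hr hC hlam hζ (ℓ := 2 ^ J * ℓ) (by nlinarith) hZ x
    rw [hscale] at hannulus
    rw [← Finset.sum_filter_add_sum_filter_not _ fun z => dist z x < 2 ^ J * ℓ,
      Finset.filter_filter, Finset.filter_filter, Finset.sum_range_succ, mul_add]
    refine add_le_add (le_of_eq_of_le ?_ ih) (le_of_eq_of_le ?_ (hannulus.trans_eq (by ring)))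
    · refine congrArg (Finset.sum · _) (Finset.filter_congr fun z _ =>
        ⟨fun h => ⟨h.1.1, h.2⟩, fun h => ⟨⟨h.1, ?_⟩, h.2⟩⟩)
      rw [pow_succ]
      nlinarith
    · refine congrArg (Finset.sum · _) (Finset.filter_congr fun z _ => ?_)
      rw [pow_succ', mul_assoc, not_lt]
      exact ⟨fun h => ⟨h.2, h.1.2⟩, fun h => ⟨⟨by nlinarith, h.2⟩, h.1⟩⟩

lemma sum_rpow_tail_le {r lam C ζ ℓ : ℝ} (hb : BoundedIndependence V r lam C) (hr : 0 < r)
    (hC : 0 ≤ C) (hlam : 0 ≤ lam) (hζ : lam < ζ) (hℓ : r ≤ ℓ) {Z : Finset V}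
    (hZ : Separated (2 * r) Z) (x : V) :
    ∑ z ∈ Z with ℓ ≤ dist z x, dist z x ^ (-ζ) ≤
      C * (4 / r) ^ lam * (1 - (2 : ℝ) ^ (lam - ζ))⁻¹ * ℓ ^ (lam - ζ) := by
  have hℓ0 : 0 < ℓ := hr.trans_le hℓ
  have hratio : (2 : ℝ) ^ (lam - ζ) < 1 :=
    Real.rpow_lt_one_of_one_lt_of_neg one_lt_two (by linarith)
  obtain ⟨J, hJ⟩ : ∃ J : ℕ, ∀ z ∈ Z, dist z x < 2 ^ J * ℓ := by
    obtain ⟨B, hB⟩ := (Z.image fun z => dist z x).exists_le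
    obtain ⟨J, hJ⟩ := pow_unbounded_of_one_lt (B / ℓ) (one_lt_two (α := ℝ))
    exact ⟨J, fun z hz => (hB _ (Finset.mem_image_of_mem _ hz)).trans_lt ((div_lt_iff₀ hℓ0).1 hJ)⟩
  have hfilter : (Z.filter fun z => ℓ ≤ dist z x) =
      Z.filter fun z => ℓ ≤ dist z x ∧ dist z x < 2 ^ J * ℓ :=
    Finset.filter_congr fun z hz => by simp [hJ z hz]
  have hgeom : ∑ j ∈ Finset.range J, ((2 : ℝ) ^ (lam - ζ)) ^ j ≤ (1 - (2 : ℝ) ^ (lam - ζ))⁻¹ := by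
    rw [← tsum_geometric_of_lt_one (by positivity) hratio]
    exact (summable_geometric_of_lt_one (by positivity) hratio).sum_le_tsum _
      fun _ _ => by positivity
  calc ∑ z ∈ Z with ℓ ≤ dist z x, dist z x ^ (-ζ)
      ≤ C * (4 / r) ^ lam * ℓ ^ (lam - ζ) *
          ∑ j ∈ Finset.range J, ((2 : ℝ) ^ (lam - ζ)) ^ j := by
        rw [hfilter]
        exact sum_rpow_dyadic_le hb hr hC hlam (by linarith) hℓ hZ x J
    _ ≤ C * (4 / r) ^ lam * ℓ ^ (lam - ζ) * (1 - (2 : ℝ) ^ (lam - ζ))⁻¹ := by gcongr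
    _ = _ := by ring

end Geometry

lemma exists_tail_le {r lam C ζ : ℝ} (hr : 0 < r) (hC : 0 ≤ C) (hlam : 0 ≤ lam) (hζ : lam < ζ)
    {δ : ℝ} (hδ : 0 < δ) : ∃ L : ℝ, ∀ (V : Type) [MetricSpace V], BoundedIndependence V r lam C →
      ∀ Z : Finset V, Separated (2 * r) Z → ∀ (x : V) (ℓ : ℝ), L ≤ ℓ →
        ∑ z ∈ Z with ℓ ≤ dist z x, dist z x ^ (-ζ) ≤ δ := by
  have htend : Filter.Tendsto (fun ℓ : ℝ => C * (4 / r) ^ lam * (1 - (2 : ℝ) ^ (lam - ζ))⁻¹ *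
      ℓ ^ (lam - ζ)) Filter.atTop (nhds 0) := by
    simpa using (tendsto_rpow_neg_atTop (sub_pos.2 hζ)).const_mul
      (C * (4 / r) ^ lam * (1 - (2 : ℝ) ^ (lam - ζ))⁻¹)
  obtain ⟨L, hL⟩ := Filter.eventually_atTop.1 ((htend.eventually_le_const hδ).and
    (Filter.eventually_ge_atTop r))
  exact ⟨L, fun V _ hb Z hZ x ℓ hℓ =>
    (sum_rpow_tail_le hb hr hC hlam hζ (hL ℓ hℓ).2 hZ x).trans (hL ℓ hℓ).1⟩

section Net

variable {V : Type} [MetricSpace V]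

lemma exists_net [Finite V] {d : ℝ} (hd : 0 < d) :
    ∃ Y : Finset V, Separated d Y ∧ ∀ w, ∃ y ∈ Y, dist w y < d := by
  classical
  obtain ⟨Y, hY⟩ := (Set.toFinite {Y : Finset V | Separated d Y}).exists_maximal
    ⟨∅, by simp [Separated]⟩
  refine ⟨Y, hY.prop, fun w => ?_⟩
  by_contra! hfar
  have hinsert : Separated d (insert w Y) := by
    rw [Separated, Finset.coe_insert]
    exact Set.Pairwise.insert hY.prop fun y hy _ =>
      ⟨hfar y hy, by rw [dist_comm]; exact hfar y hy⟩
  have hw := hfar w (hY.le_of_ge hinsert (Finset.subset_insert w Y) (Finset.mem_insert_self w Y))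
  rw [dist_self] at hw
  exact hd.not_ge hw

open Classical in
lemma sum_mul_le_net [Fintype V] {d : ℝ} {Y : Finset V} (hY : ∀ w, ∃ y ∈ Y, dist w y < d)
    {p g G : V → ℝ} (hp : ∀ w, 0 ≤ p w) (hG : ∀ y, 0 ≤ G y) (W : Finset V)
    (hgG : ∀ w ∈ W, ∀ y ∈ Y, dist w y < d → g w ≤ G y) :
    ∑ w ∈ W, p w * g w ≤ ∑ y ∈ Y, G y * ∑ w with w ∈ Metric.ball y d, p w := by
  choose c hcY hcd using hY
  calc ∑ w ∈ W, p w * g w ≤ ∑ w ∈ W, p w * G (c w) :=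
        Finset.sum_le_sum fun w hw =>
          mul_le_mul_of_nonneg_left (hgG w hw _ (hcY w) (hcd w)) (hp w)
    _ ≤ ∑ w, p w * G (c w) :=
        Finset.sum_le_sum_of_subset_of_nonneg (Finset.subset_univ _)
          fun w _ _ => mul_nonneg (hp w) (hG _)
    _ = ∑ y ∈ Y, ∑ w with c w = y, p w * G (c w) :=
        (Finset.sum_fiberwise_of_maps_to (fun w _ => hcY w) _).symm
    _ = ∑ y ∈ Y, G y * ∑ w with c w = y, p w := by
        refine Finset.sum_congr rfl fun y _ => ?_
        rw [Finset.mul_sum]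
        refine Finset.sum_congr rfl fun w hw => ?_
        rw [(Finset.mem_filter.1 hw).2, mul_comm]
    _ ≤ ∑ y ∈ Y, G y * ∑ w with w ∈ Metric.ball y d, p w := by
        refine Finset.sum_le_sum fun y _ => mul_le_mul_of_nonneg_left
          (Finset.sum_le_sum_of_subset_of_nonneg (Finset.monotone_filter_right _ ?_)
            fun w _ _ => hp w) (hG y)
        rintro w _ rfl
        exact hcd w

end Net

/-! ### The broadcast algorithm -/

/-- The local state of a node. -/
structure NodeState where
  /-- the number of the rounds that have passed -/
  clock : ℕ
  /-- whether the node is the source -/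
  src : Bool
  /-- a contending node transmits with probability `2 ^ (-(level + 1))` -/
  level : ℕ
  /-- the number of election rounds for which the node does not contend -/
  pause : ℕ
  /-- whether the node has won the last election round -/
  fresh : Bool
  /-- the number of election rounds that the node has won -/
  wins : ℕ

/-- The transmission probability in a given state. Round `0` belongs to the source. Afterwards,
rounds of three kinds alternate: election rounds (`clock % 3 = 1`), in which the nodes that are not
paused contend with a probability that is adapted to the contention; notification rounds
(`clock % 3 = 2`), in which the winners of the preceding election round transmit; and dissemination
rounds (`clock % 3 = 0`), in which a node transmits with a probability proportional to the frequency
of its wins so far. -/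
def NodeState.prob (q : NodeState) : ℝ≥0 :=
  if q.clock % 3 = 1 then (if q.pause = 0 then (1 / 2) ^ (q.level + 1) else 0)
  else if q.clock % 3 = 2 then (if q.fresh then 1 / 2 else 0)
  else if q.clock = 0 then (if q.src then 1 else 0)
  else min (1 / 2) (q.wins / (2 * ((q.clock / 3 : ℕ) : ℝ≥0)))

/-- A node wins an election round if its transmission is acknowledged and it receives no near
transmission. -/
def Observation.won (o : Observation Unit) : Bool := o.sent && o.ack && !o.ntd

/-- The state update; a node that has won or is notified by a near winner pauses for `S` election
rounds and halves its probability. -/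
def NodeState.next (S : ℕ) (q : NodeState) (o : Observation Unit) : NodeState :=
  if q.clock % 3 = 1 then
    { clock := q.clock + 1
      src := q.src
      level := if q.pause = 0 then (if o.busy then q.level + 1 else q.level - 1) else q.level
      pause := q.pause - 1
      fresh := o.won
      wins := q.wins + if o.won then 1 else 0 }
  else if q.clock % 3 = 2 then
    { clock := q.clock + 1
      src := q.src
      level := q.level + if q.fresh || o.ntd then 1 else 0
      pause := if q.fresh || o.ntd then S else q.pause
      fresh := false
      wins := q.wins }
  else { q with clock := q.clock + 1 }

lemma NodeState.prob_le_one (q : NodeState) : q.prob ≤ 1 := by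
  have hhalf : (1 / 2 : ℝ≥0) ≤ 1 := NNReal.half_le_self 1
  unfold NodeState.prob
  split_ifs
  exacts [pow_le_one₀ zero_le hhalf, zero_le, hhalf, zero_le, le_rfl, zero_le,
    (min_le_left _ _).trans hhalf]

/-- The broadcast algorithm with pauses of length `S`. -/
def broadcast (S : ℕ) : Algorithm where
  State := NodeState
  Msg := Unit
  finite_msg := inferInstance
  init b := ⟨0, b, 0, 0, false, 0⟩
  prob := NodeState.prob
  prob_le_one := NodeState.prob_le_one
  msg _ := ()
  next := NodeState.next S

section Steps

variable {V : Type} [MetricSpace V] {M : Model} {S : ℕ} {s : V}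

/-- The state of a node that runs the broadcast algorithm. -/
def node (M : Model) (S : ℕ) (s : V) (h : History V) (v : V) : NodeState :=
  state M (broadcast S) s h v

/-- `v` receives a transmission from a node at distance less than `ε R / 4`. -/
def NearReception (M : Model) (x : Finset V × Outcome V) (v : V) : Prop :=
  ∃ u ∈ x.2.received v, dist u v < M.ε / 4 * M.R

/-- `v` wins the election round `x`. -/
def Wins (M : Model) (x : Finset V × Outcome V) (v : V) : Prop :=
  v ∈ x.1 ∧ x.2.ack v = true ∧ ¬ NearReception M x v

open Classical in
lemma node_nil (v : V) : node M S s [] v = ⟨0, decide (v = s), 0, 0, false, 0⟩ := by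
  unfold node state broadcast
  rfl

open Classical in
/-- The observation of `v` in a round. -/
def observe (M : Model) (s : V) (h : History V) (x : Finset V × Outcome V) (v : V) :
    Observation Unit where
  sent := decide (v ∈ x.1)
  received := {y | ∃ u ∈ x.2.received v, y = ((), decide (u ∈ informed s h))}
  busy := x.2.busy v
  ack := x.2.ack v
  ntd := decide (NearReception M x v)

lemma node_cons (h : History V) (x : Finset V × Outcome V) (v : V) :
    node M S s (x :: h) v = (node M S s h v).next S (observe M s h x v) := by
  obtain ⟨T, o⟩ := x
  unfold node
  rw [state]
  refine congrArg (NodeState.next S (node M S s h v)) ?_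
  unfold observe
  congr 1
  exact decide_eq_decide.2 Iff.rfl

lemma won_observe (h : History V) (x : Finset V × Outcome V) (v : V) :
    (observe M s h x v).won = true ↔ Wins M x v := by
  simp [observe, Observation.won, Wins, and_assoc]

lemma node_clock (h : History V) (v : V) : (node M S s h v).clock = h.length := by
  induction h with
  | nil => rw [node_nil]; rfl
  | cons x h ih =>
    rw [node_cons, NodeState.next]
    split_ifs <;> simp [ih]

lemma node_src (h : History V) (v : V) : (node M S s h v).src = true ↔ v = s := by
  induction h with
  | nil => rw [node_nil]; simp
  | cons x h ih =>
    rw [node_cons, NodeState.next]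
    split_ifs <;> simpa using ih

section Election

variable {h : History V}

lemma next_election (hh : h.length % 3 = 1) (x : Finset V × Outcome V) (v : V) :
    (node M S s h v).next S (observe M s h x v) =
    { clock := (node M S s h v).clock + 1
      src := (node M S s h v).src
      level := if (node M S s h v).pause = 0 then
        (if x.2.busy v then (node M S s h v).level + 1 else (node M S s h v).level - 1)
        else (node M S s h v).level
      pause := (node M S s h v).pause - 1
      fresh := (observe M s h x v).won
      wins := (node M S s h v).wins + if (observe M s h x v).won then 1 else 0 } := by
  rw [NodeState.next, if_pos (by rw [node_clock]; exact hh)]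
  rfl

lemma pause_election (hh : h.length % 3 = 1) (x : Finset V × Outcome V) (v : V) :
    (node M S s (x :: h) v).pause = (node M S s h v).pause - 1 := by
  rw [node_cons, next_election hh]

lemma fresh_election (hh : h.length % 3 = 1) (x : Finset V × Outcome V) (v : V) :
    (node M S s (x :: h) v).fresh = true ↔ Wins M x v := by
  rw [node_cons, next_election hh, won_observe]

open Classical in
lemma wins_election (hh : h.length % 3 = 1) (x : Finset V × Outcome V) (v : V) :
    (node M S s (x :: h) v).wins = (node M S s h v).wins + if Wins M x v then 1 else 0 := by
  rw [node_cons, next_election hh]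
  simp only [won_observe]

lemma level_election_paused (hh : h.length % 3 = 1) (x : Finset V × Outcome V) (v : V)
    (hp : (node M S s h v).pause ≠ 0) :
    (node M S s (x :: h) v).level = (node M S s h v).level := by
  rw [node_cons, next_election hh]
  simp only [if_neg hp]

lemma level_election_busy (hh : h.length % 3 = 1) (x : Finset V × Outcome V) (v : V)
    (hp : (node M S s h v).pause = 0) (hb : x.2.busy v = true) :
    (node M S s (x :: h) v).level = (node M S s h v).level + 1 := by
  rw [node_cons, next_election hh]
  simp only [if_pos hp, hb, if_true]

lemma level_election_idle (hh : h.length % 3 = 1) (x : Finset V × Outcome V) (v : V)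
    (hp : (node M S s h v).pause = 0) (hb : x.2.busy v = false) :
    (node M S s (x :: h) v).level = (node M S s h v).level - 1 := by
  rw [node_cons, next_election hh]
  simp [if_pos hp, hb]

end Election

section Notification

variable {h : History V}

/-- `v` has won the last election round or is notified of a near winner. -/
def Hit (M : Model) (S : ℕ) (s : V) (h : History V) (x : Finset V × Outcome V) (v : V) : Prop :=
  (node M S s h v).fresh = true ∨ NearReception M x v

lemma next_notification (hh : h.length % 3 = 2) (x : Finset V × Outcome V) (v : V) :
    (node M S s h v).next S (observe M s h x v) =
    { clock := (node M S s h v).clock + 1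
      src := (node M S s h v).src
      level := (node M S s h v).level +
        if (node M S s h v).fresh || (observe M s h x v).ntd then 1 else 0
      pause := if (node M S s h v).fresh || (observe M s h x v).ntd then S
        else (node M S s h v).pause
      fresh := false
      wins := (node M S s h v).wins } := by
  rw [NodeState.next, if_neg (by rw [node_clock]; omega), if_pos (by rw [node_clock]; exact hh)]

lemma hit_iff (h : History V) (x : Finset V × Outcome V) (v : V) :
    ((node M S s h v).fresh || (observe M s h x v).ntd) = true ↔
    Hit M S s h x v := by
  simp [Hit, observe]

open Classical in
lemma pause_notification (hh : h.length % 3 = 2) (x : Finset V × Outcome V) (v : V) :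
    (node M S s (x :: h) v).pause =
    if Hit M S s h x v then S else (node M S s h v).pause := by
  rw [node_cons, next_notification hh]
  simp only [hit_iff]

open Classical in
lemma level_notification (hh : h.length % 3 = 2) (x : Finset V × Outcome V) (v : V) :
    (node M S s (x :: h) v).level =
    (node M S s h v).level + if Hit M S s h x v then 1 else 0 := by
  rw [node_cons, next_notification hh]
  simp only [hit_iff]

lemma fresh_notification (hh : h.length % 3 = 2) (x : Finset V × Outcome V) (v : V) :
    (node M S s (x :: h) v).fresh = false := by
  rw [node_cons, next_notification hh]

lemma wins_notification (hh : h.length % 3 = 2) (x : Finset V × Outcome V) (v : V) :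
    (node M S s (x :: h) v).wins = (node M S s h v).wins := by
  rw [node_cons, next_notification hh]

end Notification

lemma node_dissemination {h : History V} (hh : h.length % 3 = 0) (x : Finset V × Outcome V)
    (v : V) : node M S s (x :: h) v =
      { node M S s h v with clock := (node M S s h v).clock + 1 } := by
  rw [node_cons, NodeState.next, if_neg (by rw [node_clock]; omega),
    if_neg (by rw [node_clock]; omega)]

end Steps

section Elections

variable {V : Type}

/-- The number of election rounds of a history. -/
def elections (h : History V) : ℝ := total (fun h _ => ind (h.length % 3 = 1)) h

lemma elections_cons (x : Finset V × Outcome V) (h : History V) :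
    elections (x :: h) = elections h + ind (h.length % 3 = 1) := rfl

lemma elections_eq (h : History V) : elections h = ((h.length + 1) / 3 : ℕ) := by
  induction h with
  | nil => simp [elections]
  | cons x h ih =>
    rw [elections_cons, ih, List.length_cons]
    by_cases hh : h.length % 3 = 1
    · rw [ind_pos hh, show (h.length + 1 + 1) / 3 = (h.length + 1) / 3 + 1 by omega]
      push_cast
      rfl
    · rw [ind_neg hh, show (h.length + 1 + 1) / 3 = (h.length + 1) / 3 by omega, add_zero]

lemma elections_nonneg (h : History V) : 0 ≤ elections h :=
  total_nonneg (fun _ _ => ind_nonneg _) h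

end Elections

lemma near_pos (M : Model) : 0 < M.ε / 4 * M.R :=
  mul_pos (div_pos M.ε_pos four_pos) M.R_pos

lemma near_le_reach (M : Model) : M.ε / 4 * M.R ≤ (1 - M.ε / 2) * M.R :=
  mul_le_mul_of_nonneg_right (by linarith [M.ε_lt_one]) M.R_pos.le

section Invariants

variable {V : Type} [MetricSpace V] {M : Model} {S : ℕ} {s : V}

lemma transmitProb_eq (h : History V) (v : V) :
    transmitProb M (broadcast S) s h v = (node M S s h v).prob := rfl

lemma prob_election {h : History V} (hh : h.length % 3 = 1) (v : V) :
    (node M S s h v).prob =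
      if (node M S s h v).pause = 0 then (1 / 2) ^ ((node M S s h v).level + 1) else 0 := by
  rw [NodeState.prob, if_pos (by rw [node_clock]; exact hh)]

lemma prob_notification {h : History V} (hh : h.length % 3 = 2) (v : V) :
    (node M S s h v).prob = if (node M S s h v).fresh then 1 / 2 else 0 := by
  rw [NodeState.prob, if_neg (by rw [node_clock]; omega), if_pos (by rw [node_clock]; exact hh)]

lemma prob_start (v : V) :
    (node M S s [] v).prob = if (node M S s [] v).src then 1 else 0 := by
  simp [NodeState.prob, node_clock]

lemma prob_dissemination {h : History V} (hh : h.length % 3 = 0) (h0 : h.length ≠ 0) (v : V) :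
    (node M S s h v).prob =
      min (1 / 2) ((node M S s h v).wins / (2 * ((h.length / 3 : ℕ) : ℝ≥0))) := by
  rw [NodeState.prob, node_clock, if_neg (by omega), if_neg (by omega), if_neg h0]

lemma prob_le_half {h : History V} (h0 : h.length ≠ 0) (v : V) :
    (node M S s h v).prob ≤ 1 / 2 := by
  have hlt : h.length % 3 < 3 := Nat.mod_lt _ three_pos
  interval_cases hh : h.length % 3
  · rw [prob_dissemination hh h0]
    exact min_le_left _ _
  · rw [prob_election hh, pow_succ]
    split_ifs
    exacts [mul_le_of_le_one_left zero_le (pow_le_one₀ zero_le (NNReal.half_le_self 1)), zero_le]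
  · rw [prob_notification hh]
    split_ifs
    exacts [le_rfl, zero_le]

lemma massDelivers_of_ack {A : Algorithm} {h : History V} {x : Finset V × Outcome V}
    (hx : RoundOK M A s h x) {u : V} (hu : u ∈ x.1) (hack : x.2.ack u = true) :
    MassDelivers M x.2 u := by
  by_contra hmiss
  exact absurd hack (by simp [hx.legal.not_ack u hu hmiss])

lemma le_dist_of_wins {A : Algorithm} {h : History V} {x : Finset V × Outcome V}
    (hx : RoundOK M A s h x) {u v : V} (hu : Wins M x u) (hv : Wins M x v) (huv : u ≠ v) :
    M.ε / 4 * M.R ≤ dist u v := by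
  by_contra! hnear
  exact hv.2.2 ⟨u, massDelivers_of_ack hx hu.1 hu.2.1 v huv.symm
    (hnear.le.trans (near_le_reach M)), hnear⟩

lemma pause_eq_zero_of_wins {h : History V} (hh : h.length % 3 = 1) {x : Finset V × Outcome V}
    (hx : RoundOK M (broadcast S) s h x) {v : V} (hv : Wins M x v) :
    (node M S s h v).pause = 0 := by
  have hprob : (node M S s h v).prob ≠ 0 := hx.prob_ne_zero v hv.1
  rw [prob_election hh] at hprob
  by_contra hpause
  exact hprob (if_neg hpause)

lemma fresh_of_mem {h : History V} (hh : h.length % 3 = 2) {x : Finset V × Outcome V}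
    (hx : RoundOK M (broadcast S) s h x) {v : V} (hv : v ∈ x.1) :
    (node M S s h v).fresh = true := by
  have hprob : (node M S s h v).prob ≠ 0 := hx.prob_ne_zero v hv
  rw [prob_notification hh] at hprob
  by_contra hfresh
  exact hprob (if_neg hfresh)

lemma exists_fresh_of_hit {h : History V} (hh : h.length % 3 = 2) {x : Finset V × Outcome V}
    (hx : RoundOK M (broadcast S) s h x) {v : V} (hv : Hit M S s h x v) :
    ∃ u, (node M S s h u).fresh = true ∧ dist u v < M.ε / 4 * M.R := by
  rcases hv with hfresh | ⟨u, hu, huv⟩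
  · exact ⟨v, hfresh, by rw [dist_self]; exact near_pos M⟩
  · exact ⟨u, fresh_of_mem hh hx (hx.legal.received_sent u v hu).1, huv⟩

lemma length_mod_of_fresh {h : History V} {v : V} (hv : (node M S s h v).fresh = true) :
    h.length % 3 = 2 := by
  induction h with
  | nil => simp [node_nil] at hv
  | cons x h ih =>
    have hlt : h.length % 3 < 3 := Nat.mod_lt _ three_pos
    rw [List.length_cons]
    interval_cases hh : h.length % 3
    · rw [node_dissemination hh] at hv
      exact absurd (ih hv) (by omega)
    · omega
    · simp [fresh_notification hh] at hv

lemma pause_eq_zero_of_fresh {h : History V} (hh : Valid M (broadcast S) s h) {v : V}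
    (hv : (node M S s h v).fresh = true) : (node M S s h v).pause = 0 := by
  have hmod := length_mod_of_fresh hv
  cases h with
  | nil => simp at hmod
  | cons x h =>
    have hmod : h.length % 3 = 1 := by rw [List.length_cons] at hmod; omega
    rw [pause_election hmod, pause_eq_zero_of_wins hmod hh.2 ((fresh_election hmod x v).1 hv)]

lemma le_dist_of_fresh {h : History V} (hh : Valid M (broadcast S) s h) {u v : V}
    (hu : (node M S s h u).fresh = true) (hv : (node M S s h v).fresh = true) (huv : u ≠ v) :
    M.ε / 4 * M.R ≤ dist u v := by
  have hmod := length_mod_of_fresh hu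
  cases h with
  | nil => simp at hmod
  | cons x h =>
    have hmod : h.length % 3 = 1 := by rw [List.length_cons] at hmod; omega
    exact le_dist_of_wins hh.2 ((fresh_election hmod x u).1 hu) ((fresh_election hmod x v).1 hv) huv

lemma wins_cons_of_not_election {h : History V} (hh : h.length % 3 ≠ 1)
    (x : Finset V × Outcome V) (v : V) :
    (node M S s (x :: h) v).wins = (node M S s h v).wins := by
  by_cases hh2 : h.length % 3 = 2
  · rw [wins_notification hh2]
  · rw [node_dissemination (by omega)]

lemma wins_le (h : History V) (v : V) : 3 * (node M S s h v).wins ≤ h.length + 1 := by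
  classical
  suffices hstrong : 3 * (node M S s h v).wins ≤ h.length + 1 ∧
    (h.length % 3 = 1 → 3 * (node M S s h v).wins ≤ h.length) from hstrong.1
  induction h with
  | nil => simp [node_nil]
  | cons x h ih =>
    by_cases hh : h.length % 3 = 1
    · rw [wins_election hh, List.length_cons]
      split_ifs <;> omega
    · rw [wins_cons_of_not_election hh, List.length_cons]
      omega

/-- The number of rounds in which `v` is notified. -/
def hits (M : Model) (S : ℕ) (s : V) (v : V) (h : History V) : ℝ :=
  total (fun h x => ind (h.length % 3 = 2 ∧ Hit M S s h x v)) h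

lemma hits_cons (v : V) (x : Finset V × Outcome V) (h : History V) :
    hits M S s v (x :: h) = hits M S s v h + ind (h.length % 3 = 2 ∧ Hit M S s h x v) := rfl

lemma paused_add_pause_le (v : V) (h : History V) :
    total (fun h _ => ind (h.length % 3 = 1 ∧ (node M S s h v).pause ≠ 0)) h +
      (node M S s h v).pause ≤ S * hits M S s v h := by
  induction h with
  | nil => simp [node_nil, hits]
  | cons x h ih =>
    rw [total_cons, hits_cons]
    have hlt : h.length % 3 < 3 := Nat.mod_lt _ three_pos
    interval_cases hh : h.length % 3
    · rw [node_dissemination hh, ind_neg (by simp), ind_neg (by simp), add_zero, add_zero]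
      exact ih
    · rw [pause_election hh, ind_neg (p := _ ∧ Hit M S s h x v) (by simp), add_zero]
      by_cases hp : (node M S s h v).pause = 0
      · rw [ind_neg (by simp [hp]), hp]
        simpa [hp] using ih
      · rw [ind_pos ⟨rfl, hp⟩, Nat.cast_sub (Nat.one_le_iff_ne_zero.2 hp)]
        push_cast
        linarith
    · rw [pause_notification hh, ind_neg (p := _ ∧ (node M S s h v).pause ≠ 0) (by simp),
        add_zero, mul_add]
      by_cases hhit : Hit M S s h x v
      · rw [ind_pos ⟨rfl, hhit⟩, if_pos hhit, mul_one]
        linarith [Nat.cast_nonneg (α := ℝ) (node M S s h v).pause]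
      · rw [ind_neg (by tauto), if_neg hhit, mul_zero, add_zero]
        exact ih

lemma level_election_add_le {h : History V} (hh : h.length % 3 = 1) {v : V}
    (hp : (node M S s h v).pause = 0) (x : Finset V × Outcome V) {Low : Prop}
    (hLow : Low → 1 ≤ (node M S s h v).level) :
    ((node M S s (x :: h) v).level : ℝ) + 2 * ind (Low ∧ x.2.busy v = false) ≤
      (node M S s h v).level + 1 := by
  cases hb : x.2.busy v with
  | true =>
    rw [level_election_busy hh x v hp hb, ind_neg (by simp)]
    simp
  | false =>
    rw [level_election_idle hh x v hp hb]
    by_cases hl : Low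
    · rw [ind_pos ⟨hl, rfl⟩, Nat.cast_sub (hLow hl)]
      push_cast
      linarith
    · rw [ind_neg (by tauto)]
      have hpred : (((node M S s h v).level - 1 : ℕ) : ℝ) ≤ (node M S s h v).level := by
        exact_mod_cast Nat.sub_le _ _
      linarith

lemma level_cons_add_le {h : History V} {v : V} (x : Finset V × Outcome V) {Low : Prop}
    (hLow : h.length % 3 = 1 → (node M S s h v).pause = 0 → Low → 1 ≤ (node M S s h v).level) :
    ((node M S s (x :: h) v).level : ℝ) +
        2 * ind ((h.length % 3 = 1 ∧ (node M S s h v).pause = 0 ∧ Low) ∧ x.2.busy v = false) ≤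
      (node M S s h v).level + ind (h.length % 3 = 1 ∧ (node M S s h v).pause = 0) +
        ind (h.length % 3 = 2 ∧ Hit M S s h x v) := by
  have hlt : h.length % 3 < 3 := Nat.mod_lt _ three_pos
  interval_cases hh : h.length % 3
  · rw [node_dissemination hh, ind_neg (by simp), ind_neg (by simp), ind_neg (by simp)]
    simp
  · rw [ind_neg (p := _ ∧ Hit M S s h x v) (by simp), add_zero]
    by_cases hp : (node M S s h v).pause = 0
    · rw [ind_pos (p := _ ∧ (node M S s h v).pause = 0) ⟨rfl, hp⟩]
      exact (level_election_add_le hh hp x (Low := _ ∧ _ ∧ Low)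
        fun hl => hLow rfl hp hl.2.2)
    · rw [level_election_paused hh x v hp, ind_neg (by tauto), ind_neg (by tauto)]
      simp
  · rw [level_notification hh, ind_neg (p := _ ∧ x.2.busy v = false) (by simp),
      ind_neg (p := _ ∧ (node M S s h v).pause = 0) (by simp)]
    by_cases hhit : Hit M S s h x v
    · simp [hhit, ind_pos]
    · simp [hhit, ind_neg]

lemma level_add_le (v : V) {Low : History V → Prop}
    (hLow : ∀ h : History V, h.length % 3 = 1 → (node M S s h v).pause = 0 → Low h →
      1 ≤ (node M S s h v).level) (h : History V) :
    (node M S s h v).level + 2 * total (fun h x => ind ((h.length % 3 = 1 ∧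
        (node M S s h v).pause = 0 ∧ Low h) ∧ x.2.busy v = false)) h ≤
      total (fun h _ => ind (h.length % 3 = 1 ∧ (node M S s h v).pause = 0)) h +
        hits M S s v h := by
  induction h with
  | nil => simp [node_nil, hits]
  | cons x h ih =>
    simp only [total_cons, hits_cons]
    linarith [level_cons_add_le x (hLow h)]

/-- `u` has won the last election round and notifies all neighbours. -/
def Notifies (M : Model) (S : ℕ) (s : V) (h : History V) (x : Finset V × Outcome V) (u : V) :
    Prop :=
  h.length % 3 = 2 ∧ (node M S s h u).fresh = true ∧ MassDelivers M x.2 u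

lemma hit_of_notifies {h : History V} {x : Finset V × Outcome V} {u v : V}
    (hu : Notifies M S s h x u) (huv : dist u v < M.ε / 4 * M.R) : Hit M S s h x v := by
  by_cases heq : v = u
  · exact Or.inl (heq ▸ hu.2.1)
  · exact Or.inr ⟨u, hu.2.2 v heq (huv.le.trans (near_le_reach M)), huv⟩

open Classical in
/-- The remaining time of the pause that `u` has imposed on its vicinity by its last successful
notification. -/
def timer (M : Model) (S : ℕ) (s : V) (u : V) : History V → ℕ
  | [] => 0
  | x :: h => if Notifies M S s h x u then S else
      if h.length % 3 = 1 then timer M S s u h - 1 else timer M S s u h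

lemma timer_le (u : V) (h : History V) : timer M S s u h ≤ S := by
  induction h with
  | nil => exact Nat.zero_le _
  | cons x h ih =>
    rw [timer]
    split_ifs <;> omega

lemma timer_le_pause {u v : V} (huv : dist u v < M.ε / 4 * M.R) (h : History V) :
    timer M S s u h ≤ (node M S s h v).pause := by
  induction h with
  | nil => exact Nat.zero_le _
  | cons x h ih =>
    have hle := timer_le (M := M) (S := S) (s := s) u h
    have hlt : h.length % 3 < 3 := Nat.mod_lt _ three_pos
    rw [timer]
    by_cases hn : Notifies M S s h x u
    · rw [if_pos hn, pause_notification hn.1, if_pos (hit_of_notifies hn huv)]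
    · rw [if_neg hn]
      interval_cases hh : h.length % 3
      · rw [if_neg (by simp), node_dissemination hh]
        exact ih
      · rw [if_pos rfl, pause_election hh]
        omega
      · rw [if_neg (by simp), pause_notification hh]
        split_ifs <;> omega

lemma timer_eq_zero_of_fresh {h : History V} (hh : Valid M (broadcast S) s h) {u v : V}
    (hu : (node M S s h u).fresh = true) (huv : dist u v < M.ε / 4 * M.R) :
    timer M S s v h = 0 := by
  rw [dist_comm] at huv
  exact Nat.le_zero.1 ((timer_le_pause huv h).trans_eq (pause_eq_zero_of_fresh hh hu))

lemma le_dist_of_timer {h : History V} (hh : Valid M (broadcast S) s h) {u v : V}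
    (hu : timer M S s u h ≠ 0) (hv : timer M S s v h ≠ 0) (huv : u ≠ v) :
    M.ε / 4 * M.R ≤ dist u v := by
  induction h with
  | nil => exact absurd rfl hu
  | cons x h ih =>
    have hold : ∀ w, ¬ Notifies M S s h x w → timer M S s w (x :: h) ≠ 0 →
        timer M S s w h ≠ 0 := by
      intro w hw
      rw [timer, if_neg hw]
      split_ifs <;> omega
    by_contra! hnear
    by_cases hnu : Notifies M S s h x u
    · by_cases hnv : Notifies M S s h x v
      · exact hnear.not_ge (le_dist_of_fresh hh.1 hnu.2.1 hnv.2.1 huv)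
      · exact hold v hnv hv (timer_eq_zero_of_fresh hh.1 hnu.2.1 hnear)
    · by_cases hnv : Notifies M S s h x v
      · exact hold u hnu hu (timer_eq_zero_of_fresh hh.1 hnv.2.1 (by rwa [dist_comm]))
      · exact hnear.not_ge (ih hh.1 (hold u hnu hu) (hold v hnv hv))

lemma timer_le_timer_cons {h : History V} (hh : h.length % 3 ≠ 1) (x : Finset V × Outcome V)
    (u : V) : timer M S s u h ≤ timer M S s u (x :: h) := by
  rw [timer, if_neg hh]
  split_ifs
  exacts [timer_le u h, le_rfl]

lemma timer_le_timer_election_add {h : History V} (hh : h.length % 3 = 1)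
    (x : Finset V × Outcome V) (u : V) :
    timer M S s u h ≤ timer M S s u (x :: h) + if timer M S s u h ≠ 0 then 1 else 0 := by
  have hno : ¬ Notifies M S s h x u := fun hu => by
    have hmod := hu.1
    omega
  rw [timer, if_neg hno, if_pos hh]
  split_ifs <;> omega

lemma card_timer_le {U : Finset V} {N : ℝ}
    (hN : ∀ Z ⊆ U, Separated (M.ε / 4 * M.R) Z → (Z.card : ℝ) ≤ N) {h : History V}
    (hh : Valid M (broadcast S) s h) : ((U.filter fun u => timer M S s u h ≠ 0).card : ℝ) ≤ N :=
  hN _ (Finset.filter_subset _ _) fun _ hu _ hv huv =>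
    le_dist_of_timer hh (Finset.mem_filter.1 hu).2 (Finset.mem_filter.1 hv).2 huv

lemma sum_timer_le {U : Finset V} {N : ℝ}
    (hN : ∀ Z ⊆ U, Separated (M.ε / 4 * M.R) Z → (Z.card : ℝ) ≤ N) {h : History V}
    (hh : Valid M (broadcast S) s h) : ∑ u ∈ U, (timer M S s u h : ℝ) ≤ N * S := by
  rw [← Finset.sum_filter_ne_zero]
  simp only [Nat.cast_ne_zero]
  refine (Finset.sum_le_card_nsmul _ _ (S : ℝ) fun u _ => by exact_mod_cast timer_le u h).trans ?_
  rw [nsmul_eq_mul]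
  exact mul_le_mul_of_nonneg_right (card_timer_le hN hh) (Nat.cast_nonneg S)

lemma add_sum_timer_le_of_notifies {U : Finset V} {h : History V} {x : Finset V × Outcome V}
    (hh : Valid M (broadcast S) s h) {u : V} (huU : u ∈ U) (hu : Notifies M S s h x u) :
    (S : ℝ) + ∑ w ∈ U, (timer M S s w h : ℝ) ≤ ∑ w ∈ U, (timer M S s w (x :: h) : ℝ) := by
  classical
  have hbefore : timer M S s u h = 0 :=
    timer_eq_zero_of_fresh hh hu.2.1 (by rw [dist_self]; exact near_pos M)
  have hafter : timer M S s u (x :: h) = S := by rw [timer, if_pos hu]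
  have hmod : h.length % 3 ≠ 1 := by
    have hmod := hu.1
    omega
  rw [← Finset.add_sum_erase _ _ huU, ← Finset.add_sum_erase _ _ huU, hbefore, hafter,
    Nat.cast_zero, zero_add]
  refine add_le_add_right (Finset.sum_le_sum fun w _ => ?_) _
  exact_mod_cast timer_le_timer_cons hmod x w

lemma mul_notifications_le_add_sum_timer {U : Finset V} {N : ℝ}
    (hN : ∀ Z ⊆ U, Separated (M.ε / 4 * M.R) Z → (Z.card : ℝ) ≤ N) {h : History V}
    (hh : Valid M (broadcast S) s h) :
    S * total (fun h x => ind (∃ u ∈ U, Notifies M S s h x u)) h ≤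
      N * elections h + ∑ u ∈ U, (timer M S s u h : ℝ) := by
  induction h with
  | nil => simp [elections, timer]
  | cons x h ih =>
    have ih := ih hh.1
    rw [total_cons, elections_cons]
    by_cases hmod : h.length % 3 = 1
    · rw [ind_neg (by rintro ⟨u, -, hu⟩; have hmod := hu.1; omega), ind_pos hmod, add_zero]
      have hstep : ∑ u ∈ U, (timer M S s u h : ℝ) ≤ ∑ u ∈ U, (timer M S s u (x :: h) : ℝ) +
          (U.filter fun u => timer M S s u h ≠ 0).card := by
        rw [Finset.card_filter, Nat.cast_sum, ← Finset.sum_add_distrib]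
        exact Finset.sum_le_sum fun u _ => by
          exact_mod_cast timer_le_timer_election_add hmod x u
      linarith [card_timer_le hN hh.1]
    · rw [ind_neg hmod, add_zero]
      by_cases hex : ∃ u ∈ U, Notifies M S s h x u
      · obtain ⟨u, huU, hu⟩ := hex
        rw [ind_pos ⟨u, huU, hu⟩]
        linarith [add_sum_timer_le_of_notifies hh.1 huU hu]
      · rw [ind_neg hex, add_zero]
        refine ih.trans (add_le_add_right (Finset.sum_le_sum fun u _ => ?_) _)
        exact_mod_cast timer_le_timer_cons hmod x u

/-- Each successful notification silences its vicinity for `S` election rounds. -/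
lemma mul_notifications_le {U : Finset V} {N : ℝ}
    (hN : ∀ Z ⊆ U, Separated (M.ε / 4 * M.R) Z → (Z.card : ℝ) ≤ N) {h : History V}
    (hh : Valid M (broadcast S) s h) :
    S * total (fun h x => ind (∃ u ∈ U, Notifies M S s h x u)) h ≤ N * elections h + N * S :=
  (mul_notifications_le_add_sum_timer hN hh).trans
    (add_le_add_right (sum_timer_le hN hh) _)

end Invariants

section Winners

variable {V : Type} [Fintype V] [MetricSpace V] {M : Model} {S : ℕ} {s : V}

open Classical in
/-- The winners of the last election round. -/
def freshSet (M : Model) (S : ℕ) (s : V) (h : History V) : Finset V :=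
  Finset.univ.filter fun v => (node M S s h v).fresh = true

lemma mem_freshSet {h : History V} {v : V} :
    v ∈ freshSet M S s h ↔ (node M S s h v).fresh = true := by
  simp [freshSet]

lemma freshSet_separated {h : History V} (hh : Valid M (broadcast S) s h) :
    Separated (M.ε / 4 * M.R) (freshSet M S s h) :=
  fun _ hu _ hv huv => le_dist_of_fresh hh (mem_freshSet.1 hu) (mem_freshSet.1 hv) huv

lemma freshSet_notification {h : History V} (hh : h.length % 3 = 2) (x : Finset V × Outcome V) :
    freshSet M S s (x :: h) = ∅ := by
  simp [freshSet, fresh_notification hh]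

lemma freshSet_dissemination {h : History V} (hh : h.length % 3 = 0) (x : Finset V × Outcome V) :
    freshSet M S s (x :: h) = freshSet M S s h := by
  simp [freshSet, node_dissemination hh]

open Classical in
lemma wins_cons_of_election {h : History V} (hh : h.length % 3 = 1) (x : Finset V × Outcome V)
    (v : V) : ((node M S s (x :: h) v).wins : ℝ) =
      (node M S s h v).wins + if v ∈ freshSet M S s (x :: h) then 1 else 0 := by
  rw [wins_election hh]
  simp only [mem_freshSet, fresh_election hh]
  push_cast
  rfl

open Classical in
lemma hits_add_card_freshSet_le {h : History V} (hh : Valid M (broadcast S) s h) (v : V) :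
    hits M S s v h + ((freshSet M S s h).filter fun u => dist u v < M.ε / 4 * M.R).card ≤
      ∑ u with dist u v < M.ε / 4 * M.R, ((node M S s h u).wins : ℝ) := by
  induction h with
  | nil => simp [node_nil, freshSet, hits]
  | cons x h ih =>
    have ih := ih hh.1
    rw [hits_cons]
    have hlt : h.length % 3 < 3 := Nat.mod_lt _ three_pos
    interval_cases hmod : h.length % 3
    · rw [freshSet_dissemination hmod, ind_neg (by simp), add_zero]
      simpa only [node_dissemination hmod] using ih
    · rw [ind_neg (by simp), add_zero]
      have hcard : (∑ u with dist u v < M.ε / 4 * M.R,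
            if u ∈ freshSet M S s (x :: h) then (1 : ℝ) else 0) =
          (((freshSet M S s (x :: h)).filter fun u => dist u v < M.ε / 4 * M.R).card : ℝ) := by
        rw [Finset.sum_boole, Finset.filter_filter]
        congr 2
        ext u
        simp [and_comm]
      simp only [wins_cons_of_election hmod, Finset.sum_add_distrib, hcard]
      gcongr
      exact (le_add_of_nonneg_right (Nat.cast_nonneg _)).trans ih
    · rw [freshSet_notification hmod]
      simp only [wins_cons_of_not_election (by omega : h.length % 3 ≠ 1), Finset.filter_empty,
        Finset.card_empty, Nat.cast_zero, add_zero]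
      refine le_trans (add_le_add_right ?_ _) ih
      by_cases hhit : Hit M S s h x v
      · obtain ⟨u, hu, huv⟩ := exists_fresh_of_hit hmod hh.2 hhit
        refine (ind_le_one _).trans (Nat.one_le_cast.2 (Finset.card_pos.2 ⟨u, ?_⟩))
        exact Finset.mem_filter.2 ⟨mem_freshSet.2 hu, huv⟩
      · rw [ind_neg (by tauto)]
        exact Nat.cast_nonneg _

lemma hits_le_sum_wins {h : History V} (hh : Valid M (broadcast S) s h) (v : V) :
    hits M S s v h ≤ ∑ u with dist u v < M.ε / 4 * M.R, ((node M S s h u).wins : ℝ) :=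
  (le_add_of_nonneg_right (Nat.cast_nonneg _)).trans (hits_add_card_freshSet_le hh v)

lemma sum_wins_mul_le {h : History V} (hh : Valid M (broadcast S) s h) {g : V → ℝ} {G : ℝ}
    (hG : ∀ Z : Finset V, Separated (M.ε / 4 * M.R) Z → ∑ z ∈ Z, g z ≤ G) :
    ∑ w, ((node M S s h w).wins : ℝ) * g w ≤ G * elections h := by
  classical
  induction h with
  | nil => simp [node_nil, elections]
  | cons x h ih =>
    have ih := ih hh.1
    rw [elections_cons]
    by_cases hmod : h.length % 3 = 1
    · rw [ind_pos hmod]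
      have hfresh := hG _ (freshSet_separated hh)
      simp only [wins_cons_of_election hmod, add_mul, Finset.sum_add_distrib, ite_mul, one_mul,
        zero_mul, Finset.sum_ite_mem, Finset.univ_inter]
      linarith
    · rw [ind_neg hmod, add_zero]
      simpa only [wins_cons_of_not_election hmod] using ih

end Winners

/-! ### Contention -/

section Potential

variable {V : Type} [MetricSpace V] {M : Model} {S : ℕ} {s : V} {γ : ℝ}

/-- The potential of a node: its probability when it contends, increased by a factor `γ` for each
election round for which it is still paused. -/
def potential (M : Model) (S : ℕ) (s : V) (γ : ℝ) (h : History V) (v : V) : ℝ :=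
  (1 / 2) ^ ((node M S s h v).level + 1) * γ ^ (node M S s h v).pause

lemma potential_nonneg (hγ : 1 ≤ γ) (h : History V) (v : V) : 0 ≤ potential M S s γ h v := by
  unfold potential
  positivity

lemma coe_transmitProb_election {h : History V} (hh : h.length % 3 = 1) (v : V) :
    (transmitProb M (broadcast S) s h v : ℝ) =
      if (node M S s h v).pause = 0 then (1 / 2) ^ ((node M S s h v).level + 1) else 0 := by
  rw [transmitProb_eq, prob_election hh]
  split_ifs <;> simp

lemma three_quarters_le_inv (hγ : 1 ≤ γ) (hγ' : γ ≤ 4 / 3) : 3 / 4 ≤ γ⁻¹ := by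
  rw [le_inv_comm₀ (by norm_num) (by linarith)]
  linarith

lemma potential_election_paused {h : History V} (hh : h.length % 3 = 1) (hγ : 1 ≤ γ)
    (x : Finset V × Outcome V) {v : V} (hp : (node M S s h v).pause ≠ 0) :
    potential M S s γ (x :: h) v =
      γ⁻¹ * potential M S s γ h v - transmitProb M (broadcast S) s h v / 4 := by
  unfold potential
  rw [coe_transmitProb_election hh, if_neg hp, level_election_paused hh x v hp, pause_election hh]
  obtain ⟨m, hm⟩ := Nat.exists_eq_succ_of_ne_zero hp
  rw [hm, Nat.succ_sub_one, pow_succ γ]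
  field_simp
  ring

lemma potential_election_busy {h : History V} (hh : h.length % 3 = 1) (hγ : 1 ≤ γ)
    (hγ' : γ ≤ 4 / 3) (x : Finset V × Outcome V) {v : V} (hb : x.2.busy v = true) :
    potential M S s γ (x :: h) v ≤
      γ⁻¹ * potential M S s γ h v - transmitProb M (broadcast S) s h v / 4 := by
  by_cases hp : (node M S s h v).pause = 0
  · unfold potential
    rw [coe_transmitProb_election hh, if_pos hp, level_election_busy hh x v hp hb,
      pause_election hh, hp, pow_zero, mul_one, mul_one, pow_succ _ (_ + 1)]
    have hpow : (0 : ℝ) ≤ (1 / 2) ^ ((node M S s h v).level + 1) := by positivity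
    linarith [mul_le_mul_of_nonneg_right (three_quarters_le_inv hγ hγ') hpow]
  · exact (potential_election_paused hh hγ x hp).le

lemma potential_election_idle {h : History V} (hh : h.length % 3 = 1) (hγ : 1 ≤ γ)
    (hγ' : γ ≤ 4 / 3) (x : Finset V × Outcome V) {v : V} (hp : (node M S s h v).pause = 0)
    (hb : x.2.busy v = false) :
    potential M S s γ (x :: h) v ≤
      γ⁻¹ * potential M S s γ h v + 5 / 4 * transmitProb M (broadcast S) s h v := by
  unfold potential
  rw [coe_transmitProb_election hh, if_pos hp, level_election_idle hh x v hp hb,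
    pause_election hh, hp, pow_zero, mul_one, mul_one]
  have hpow : (0 : ℝ) ≤ (1 / 2) ^ ((node M S s h v).level + 1) := by positivity
  have hdouble : ((1 : ℝ) / 2) ^ ((node M S s h v).level - 1 + 1) ≤
      2 * (1 / 2) ^ ((node M S s h v).level + 1) := by
    calc ((1 : ℝ) / 2) ^ ((node M S s h v).level - 1 + 1)
        ≤ (1 / 2) ^ (node M S s h v).level :=
          pow_le_pow_of_le_one (by norm_num) (by norm_num) (by omega)
      _ = 2 * (1 / 2) ^ ((node M S s h v).level + 1) := by ring
  linarith [mul_le_mul_of_nonneg_right (three_quarters_le_inv hγ hγ') hpow]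

lemma potential_election_le {h : History V} (hh : h.length % 3 = 1) (hγ : 1 ≤ γ)
    (hγ' : γ ≤ 4 / 3) (x : Finset V × Outcome V) (v : V) :
    potential M S s γ (x :: h) v ≤
      γ⁻¹ * potential M S s γ h v + 5 / 4 * transmitProb M (broadcast S) s h v := by
  by_cases hp : (node M S s h v).pause = 0
  · cases hb : x.2.busy v with
    | true => linarith [potential_election_busy (M := M) (S := S) (s := s) hh hγ hγ' x hb,
        (transmitProb M (broadcast S) s h v).coe_nonneg]
    | false => exact potential_election_idle hh hγ hγ' x hp hb
  · linarith [potential_election_paused (M := M) (S := S) (s := s) hh hγ x hp,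
      (transmitProb M (broadcast S) s h v).coe_nonneg]

end Potential

section Contention

variable {V : Type} [Fintype V] [MetricSpace V] {M : Model} {S : ℕ} {s : V}

lemma contention_nonneg {A : Algorithm} (h : History V) (B : Set V) :
    0 ≤ contention M A s h B :=
  Finset.sum_nonneg fun _ _ => NNReal.coe_nonneg _

open Classical in
/-- The total potential of a set of nodes. -/
def mass (M : Model) (S : ℕ) (s : V) (γ : ℝ) (B : Set V) (h : History V) : ℝ :=
  ∑ v with v ∈ B, potential M S s γ h v

/-- Contention detection fails to report a high contention in `B` to all nodes of `B`. -/
def BusyFails (M : Model) (S : ℕ) (s : V) (B : Set V) (h : History V)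
    (x : Finset V × Outcome V) : Prop :=
  h.length % 3 = 1 ∧ M.φ₀ < contention M (broadcast S) s h B ∧ ¬ ∀ w ∈ B, x.2.busy w = true

section MassStep

variable {γ : ℝ}

lemma mass_nonneg (hγ : 1 ≤ γ) (B : Set V) (h : History V) : 0 ≤ mass M S s γ B h :=
  Finset.sum_nonneg fun v _ => potential_nonneg hγ h v

lemma mass_election_le_of_busy {h : History V} (hh : h.length % 3 = 1) (hγ : 1 ≤ γ)
    (hγ' : γ ≤ 4 / 3) {x : Finset V × Outcome V} {B : Set V} (hb : ∀ w ∈ B, x.2.busy w = true) :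
    mass M S s γ B (x :: h) ≤
      γ⁻¹ * mass M S s γ B h - contention M (broadcast S) s h B / 4 := by
  classical
  unfold mass contention
  rw [Finset.mul_sum, Finset.sum_div, ← Finset.sum_sub_distrib]
  exact Finset.sum_le_sum fun v hv =>
    potential_election_busy hh hγ hγ' x (hb v (Finset.mem_filter.1 hv).2)

lemma mass_election_le_add {h : History V} (hh : h.length % 3 = 1) (hγ : 1 ≤ γ)
    (hγ' : γ ≤ 4 / 3) (x : Finset V × Outcome V) (B : Set V) :
    mass M S s γ B (x :: h) ≤
      γ⁻¹ * mass M S s γ B h + 5 / 4 * contention M (broadcast S) s h B := by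
  unfold mass contention
  rw [Finset.mul_sum, Finset.mul_sum, ← Finset.sum_add_distrib]
  exact Finset.sum_le_sum fun v _ => potential_election_le hh hγ hγ' x v

lemma mass_election_le {h : History V} (hh : h.length % 3 = 1) (hγ : 1 ≤ γ)
    (hγ' : γ ≤ 4 / 3) (x : Finset V × Outcome V) (B : Set V) :
    mass M S s γ B (x :: h) ≤ γ⁻¹ * mass M S s γ B h - contention M (broadcast S) s h B / 4 +
      3 / 2 * M.φ₀ +
      3 / 2 * (contention M (broadcast S) s h B * ind (BusyFails M S s B h x)) := by
  have hφ := M.one_le_φ₀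
  by_cases hf : BusyFails M S s B h x
  · rw [ind_pos hf]
    linarith [mass_election_le_add (M := M) (S := S) (s := s) hh hγ hγ' x B]
  rw [ind_neg hf]
  by_cases hφc : M.φ₀ < contention M (broadcast S) s h B
  · have hb : ∀ w ∈ B, x.2.busy w = true := by
      by_contra hb
      exact hf ⟨hh, hφc, hb⟩
    linarith [mass_election_le_of_busy (M := M) (S := S) (s := s) hh hγ hγ' hb]
  · linarith [mass_election_le_add (M := M) (S := S) (s := s) hh hγ hγ' x B]

lemma mass_le_of_not_election {h : History V} (hh : h.length % 3 ≠ 1) (hγ : 1 ≤ γ)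
    (hS : γ ^ S ≤ 2) (x : Finset V × Outcome V) (B : Set V) :
    mass M S s γ B (x :: h) ≤ mass M S s γ B h := by
  refine Finset.sum_le_sum fun v _ => ?_
  unfold potential
  by_cases hnotification : h.length % 3 = 2
  · rw [level_notification hnotification, pause_notification hnotification]
    split_ifs with hit
    · rw [pow_succ _ (_ + 1), mul_assoc]
      have hpause : (1 : ℝ) ≤ γ ^ (node M S s h v).pause := one_le_pow₀ hγ
      gcongr
      linarith
    · simp
  · rw [node_dissemination (by omega)]

lemma mass_nil_le (B : Set V) : mass M S s γ B [] ≤ Fintype.card V := by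
  classical
  calc mass M S s γ B []
      ≤ ∑ v with v ∈ B, (1 : ℝ) := by
        refine Finset.sum_le_sum fun v _ => ?_
        simp only [potential, node_nil]
        norm_num
    _ = (Finset.univ.filter fun v => v ∈ B).card := by simp
    _ ≤ Fintype.card V := by exact_mod_cast Finset.card_le_univ _

end MassStep

/-- The sum of the contention in `B` over the election rounds from round `t₀` on. -/
def lateContention (M : Model) (S : ℕ) (s : V) (t₀ : ℕ) (B : Set V) (h : History V) : ℝ :=
  total (fun h _ => ind (h.length % 3 = 1 ∧ t₀ ≤ h.length) * contention M (broadcast S) s h B) h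

/-- The sum of the contention in `B` over the rounds in which its detection fails. -/
def failedContention (M : Model) (S : ℕ) (s : V) (B : Set V) (h : History V) : ℝ :=
  total (fun h x => contention M (broadcast S) s h B * ind (BusyFails M S s B h x)) h

lemma lateContention_cons (t₀ : ℕ) (B : Set V) (x : Finset V × Outcome V) (h : History V) :
    lateContention M S s t₀ B (x :: h) = lateContention M S s t₀ B h +
      ind (h.length % 3 = 1 ∧ t₀ ≤ h.length) * contention M (broadcast S) s h B := rfl

lemma failedContention_cons (B : Set V) (x : Finset V × Outcome V) (h : History V) :
    failedContention M S s B (x :: h) = failedContention M S s B h +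
      contention M (broadcast S) s h B * ind (BusyFails M S s B h x) := rfl

lemma lateContention_eq_zero {t₀ : ℕ} (B : Set V) {h : History V} (hh : h.length ≤ t₀) :
    lateContention M S s t₀ B h = 0 :=
  total_eq_zero_of_length_le (fun h _ hlt => by rw [ind_neg (by omega), zero_mul]) hh

lemma failedContention_nonneg (B : Set V) (h : History V) :
    0 ≤ failedContention M S s B h :=
  total_nonneg (fun h _ => mul_nonneg (contention_nonneg h B) (ind_nonneg _)) h

section Mass

variable {γ : ℝ}

/-- Up to the contributions of low and of undetected contention, the mass decreases by a constant
factor in every election round. -/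
lemma mass_le (hγ : 1 ≤ γ) (hγ' : γ ≤ 4 / 3) (hS : γ ^ S ≤ 2) (B : Set V)
    (h : History V) :
    mass M S s γ B h ≤ γ⁻¹ ^ ((h.length + 1) / 3) * Fintype.card V +
      (3 / 2 * M.φ₀ * elections h + 3 / 2 * failedContention M S s B h) := by
  induction h with
  | nil => simpa [elections, failedContention] using mass_nil_le (M := M) (S := S) (s := s) B
  | cons x h ih =>
    rw [elections_cons, failedContention_cons, List.length_cons]
    by_cases hh : h.length % 3 = 1
    · rw [ind_pos hh, show (h.length + 1 + 1) / 3 = (h.length + 1) / 3 + 1 by omega, pow_succ']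
      have hcost : 0 ≤ 3 / 2 * M.φ₀ * elections h + 3 / 2 * failedContention M S s B h := by
        have hφ := M.one_le_φ₀
        have helections := elections_nonneg h
        have hfailed := failedContention_nonneg (M := M) (S := S) (s := s) B h
        positivity
      calc mass M S s γ B (x :: h) ≤ γ⁻¹ * mass M S s γ B h + 3 / 2 * M.φ₀ +
            3 / 2 * (contention M (broadcast S) s h B * ind (BusyFails M S s B h x)) := by
            linarith [mass_election_le (M := M) (S := S) (s := s) hh hγ hγ' x B,
              contention_nonneg (M := M) (A := broadcast S) (s := s) h B]
        _ ≤ γ⁻¹ * (γ⁻¹ ^ ((h.length + 1) / 3) * Fintype.card V +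
              (3 / 2 * M.φ₀ * elections h + 3 / 2 * failedContention M S s B h)) +
            3 / 2 * M.φ₀ +
            3 / 2 * (contention M (broadcast S) s h B * ind (BusyFails M S s B h x)) := by gcongr
        _ ≤ _ := by linarith [mul_le_of_le_one_left hcost (inv_le_one_of_one_le₀ hγ)]
    · rw [ind_neg hh, ind_neg fun hf : BusyFails M S s B h x => hh hf.1, mul_zero, add_zero,
        add_zero, show (h.length + 1 + 1) / 3 = (h.length + 1) / 3 by omega]
      exact (mass_le_of_not_election hh hγ hS x B).trans ih

lemma lateContention_add_mass_le (hγ : 1 ≤ γ) (hγ' : γ ≤ 4 / 3) (hS : γ ^ S ≤ 2)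
    (t₀ : ℕ) (B : Set V) (h : History V) :
    lateContention M S s t₀ B h / 4 + mass M S s γ B h ≤
      γ⁻¹ ^ ((min h.length t₀ + 1) / 3) * Fintype.card V +
        (3 / 2 * M.φ₀ * elections h + 3 / 2 * failedContention M S s B h) := by
  have mass_bound := mass_le (M := M) (s := s) hγ hγ' hS B
  induction h with
  | nil => simpa [lateContention_eq_zero] using mass_bound []
  | cons x h ih =>
    rcases Nat.lt_or_ge h.length t₀ with hearly | hlate
    · have hlen : (x :: h).length ≤ t₀ := hearly
      rw [lateContention_eq_zero B hlen, min_eq_left hlen, zero_div, zero_add]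
      exact mass_bound (x :: h)
    rw [List.length_cons, min_eq_right (hlate.trans (Nat.le_succ _)), lateContention_cons,
      elections_cons, failedContention_cons]
    rw [min_eq_right hlate] at ih
    by_cases hh : h.length % 3 = 1
    · rw [ind_pos ⟨hh, hlate⟩, ind_pos hh]
      linarith [mass_election_le (M := M) (S := S) (s := s) hh hγ hγ' x B,
        mul_le_of_le_one_left (mass_nonneg (M := M) (S := S) (s := s) hγ B h)
          (inv_le_one_of_one_le₀ hγ)]
    · rw [ind_neg (fun hlate => hh hlate.1), ind_neg hh,
        ind_neg fun hf : BusyFails M S s B h x => hh hf.1]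
      linarith [mass_le_of_not_election (M := M) (s := s) hh hγ hS x B]

end Mass

section FailedContention

variable {adv : Adversary V}

lemma roundLaw_busyFails_le (hadm : Admissible M (broadcast S) s adv) {t : ℕ} {h : History V}
    (hh : h ∈ (law M (broadcast S) s adv t).support) (y : V) :
    (roundLaw M (broadcast S) s adv h).toOuterMeasure
        {x | BusyFails M S s (Metric.ball y (M.R / 2)) h x} ≤
      ENNReal.ofReal (Real.exp (-(Real.log M.h₁ / 2 *
        contention M (broadcast S) s h (Metric.ball y (M.R / 2))))) := by
  set c := contention M (broadcast S) s h (Metric.ball y (M.R / 2))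
  by_cases hφ : M.φ₀ < c
  · have hdetect := toOuterMeasure_compl_le ((hadm t h hh).2.busy y ((M.φ₀ + c) / 2)
      (by linarith) (by change _ < c; linarith))
    refine (PMF.toOuterMeasure_mono _ fun x hx => hx.1.2.2).trans (hdetect.trans ?_)
    rw [Real.rpow_def_of_pos (by linarith [M.one_lt_h₁])]
    refine ENNReal.ofReal_le_ofReal (Real.exp_le_exp.2 ?_)
    linarith [mul_nonneg (Real.log_pos M.one_lt_h₁).le (by linarith [M.one_le_φ₀] : 0 ≤ M.φ₀)]
  · have hempty : {x | BusyFails M S s (Metric.ball y (M.R / 2)) h x} = ∅ :=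
      Set.eq_empty_of_forall_notMem fun x hx => hφ hx.2.1
    simp [hempty]

lemma law_failedContention_le (hadm : Admissible M (broadcast S) s adv) (y : V) (t : ℕ) :
    (law M (broadcast S) s adv t).toOuterMeasure
      {h | 4 / Real.log M.h₁ * ((t + 1) / 3 : ℕ) ≤
        failedContention M S s (Metric.ball y (M.R / 2)) h} ≤
      ENNReal.ofReal (Real.exp (-((t + 1) / 3 : ℕ))) := by
  set B := Metric.ball y (M.R / 2)
  set a := Real.log M.h₁ / 2 with ha
  have hlog : 0 < Real.log M.h₁ := Real.log_pos M.one_lt_h₁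
  have hmoment : ∀ t, ∀ h ∈ (trajectory (roundLaw M (broadcast S) s adv) t).support,
      mean (roundLaw M (broadcast S) s adv h) (fun x => ENNReal.ofReal (Real.exp
        (a * (contention M (broadcast S) s h B * ind (BusyFails M S s B h x)) -
          Real.log 2 * ind (h.length % 3 = 1)))) ≤ 1 := by
    intro t h hh
    rw [← law_eq_trajectory] at hh
    by_cases hel : h.length % 3 = 1
    · simp only [ind_pos hel, mul_one, ← mul_assoc]
      exact mean_exp_ind_sub_log_two_le_one (roundLaw_busyFails_le hadm hh y)
    · simp [ind_neg fun hf : BusyFails M S s B h _ => hel hf.1, ind_neg hel, mean_const]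
  refine le_trans ?_ (trajectory_total_ge_le hmoment t ((t + 1) / 3 : ℕ))
  rw [law_eq_trajectory]
  refine toOuterMeasure_mono_of_support fun h hh hf => ?_
  rw [Set.mem_ofPred_eq] at hf ⊢
  rw [total_sub, total_const_mul, total_const_mul]
  change _ ≤ a * failedContention M S s B h - Real.log 2 * elections h
  rw [elections_eq, length_of_mem_support_trajectory hh]
  have hscaled : (2 * ((t + 1) / 3 : ℕ) : ℝ) ≤ a * failedContention M S s B h := by
    calc (2 * ((t + 1) / 3 : ℕ) : ℝ) = a * (4 / Real.log M.h₁ * ((t + 1) / 3 : ℕ)) := by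
          rw [ha]; field_simp; ring
      _ ≤ _ := mul_le_mul_of_nonneg_left hf (by positivity)
  have hlog_two : Real.log 2 * ((t + 1) / 3 : ℕ) ≤ ((t + 1) / 3 : ℕ) :=
    mul_le_of_le_one_left (Nat.cast_nonneg _) (by linarith [Real.log_two_lt_d9])
  linarith

end FailedContention

end Contention

/-- A bound on the average contention in election rounds. -/
def avgContention (M : Model) : ℝ := 4 + 6 * M.φ₀ + 24 / Real.log M.h₁

lemma one_le_avgContention (M : Model) : 1 ≤ avgContention M := by
  have := M.one_le_φ₀
  have : 0 ≤ 24 / Real.log M.h₁ := div_nonneg (by norm_num) (Real.log_pos M.one_lt_h₁).le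
  unfold avgContention
  linarith

/-- The interference that a node at distance `d` causes. -/
def signal (M : Model) (d : ℝ) : ℝ := M.P / d ^ M.ζ

lemma ζ_pos (M : Model) : 0 < M.ζ := by linarith [M.one_le_lam, M.lam_lt_ζ]

lemma signal_nonneg (M : Model) {d : ℝ} (hd : 0 ≤ d) : 0 ≤ signal M d :=
  div_nonneg M.P_pos.le (Real.rpow_nonneg hd _)

lemma signal_le_of_half_le (M : Model) {d d' : ℝ} (hd : 0 < d) (h : d / 2 ≤ d') :
    signal M d' ≤ 2 ^ M.ζ * signal M d := by
  have hP := M.P_pos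
  have hζ := ζ_pos M
  unfold signal
  have h1 : (d / 2) ^ M.ζ ≤ d' ^ M.ζ := Real.rpow_le_rpow (by positivity) h hζ.le
  rw [Real.div_rpow hd.le (by norm_num)] at h1
  calc M.P / d' ^ M.ζ ≤ M.P / (d ^ M.ζ / 2 ^ M.ζ) :=
        div_le_div_of_nonneg_left hP.le (by positivity) h1
    _ = _ := by field_simp

/-- The network satisfies the bounded independence property of the model. -/
def Bounded (M : Model) (V : Type) [MetricSpace V] : Prop :=
  BoundedIndependence V (M.ε * M.R / 8) M.lam M.Cind

lemma exists_interference_threshold (M : Model) :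
    ∃ ξ : ℝ, 0 < ξ ∧ ξ * (2 * 2 ^ M.ζ) ≤ M.Ic ∧ ξ * (2 * 2 ^ M.ζ) ≤ M.Iack ∧ ξ ≤ M.Icd / 50 := by
  have h2ζ : (0 : ℝ) < 2 * 2 ^ M.ζ := by positivity
  refine ⟨min (min (M.Ic / (2 * 2 ^ M.ζ)) (M.Iack / (2 * 2 ^ M.ζ))) (M.Icd / 50),
    lt_min (lt_min (div_pos M.Ic_pos h2ζ) (div_pos M.Iack_pos h2ζ))
      (div_pos M.Icd_pos (by norm_num)), ?_, ?_, min_le_right _ _⟩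
  · exact (le_div_iff₀ h2ζ).1 ((min_le_left _ _).trans (min_le_left _ _))
  · exact (le_div_iff₀ h2ζ).1 ((min_le_left _ _).trans (min_le_right _ _))

lemma exists_idle_threshold (M : Model) :
    ∃ η : ℝ, 0 < η ∧ η ≤ 1 / 2 ∧ η * signal M (M.ρ * M.R) ≤ M.Icd / 50 ∧
      0.96 ≤ M.h₂ ^ (-η) := by
  have hlog : 0 < Real.log M.h₂ := Real.log_pos M.one_lt_h₂
  have hsig : 0 < signal M (M.ρ * M.R) :=
    div_pos M.P_pos (Real.rpow_pos_of_pos (mul_pos (by linarith [M.one_lt_ρ]) M.R_pos) _)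
  have hIcd : 0 < M.Icd / 50 := div_pos M.Icd_pos (by norm_num)
  have hpow {η : ℝ} (hη : η ≤ 0.04 / Real.log M.h₂) : 0.96 ≤ M.h₂ ^ (-η) := by
    rw [Real.rpow_def_of_pos (by linarith [M.one_lt_h₂])]
    linarith [(le_div_iff₀ hlog).1 hη, Real.add_one_le_exp (Real.log M.h₂ * -η)]
  refine ⟨min (min (1 / 2) (M.Icd / 50 / signal M (M.ρ * M.R))) (0.04 / Real.log M.h₂),
    lt_min (lt_min (by norm_num) (div_pos hIcd hsig)) (div_pos (by norm_num) hlog),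
    (min_le_left _ _).trans (min_le_left _ _), ?_, hpow (min_le_right _ _)⟩
  exact (le_div_iff₀ hsig).1 ((min_le_left _ _).trans (min_le_right _ _))

lemma exists_card_le (M : Model) {d : ℝ} (hd : 0 ≤ d) :
    ∃ N : ℝ, 0 ≤ N ∧ ∀ (V : Type) [MetricSpace V], Bounded M V → ∀ (x : V) (Z : Finset V),
      Separated (M.ε / 4 * M.R) Z → (∀ z ∈ Z, dist z x ≤ d) → (Z.card : ℝ) ≤ N := by
  have hr : 0 < M.ε * M.R / 8 := div_pos (mul_pos M.ε_pos M.R_pos) (by norm_num)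
  have hq : 0 ≤ d / (M.ε * M.R / 8) := div_nonneg hd hr.le
  refine ⟨M.Cind * (d / (M.ε * M.R / 8) + 1) ^ M.lam,
    mul_nonneg M.Cind_pos.le (Real.rpow_nonneg (by linarith) _), fun V _ hV x Z hZ hx => ?_⟩
  have h2r : 2 * (M.ε * M.R / 8) = M.ε / 4 * M.R := by ring
  refine Separated.card_le hV hq (by rwa [h2r]) (x := x) fun z hz => ?_
  rw [div_mul_cancel₀ _ hr.ne']
  exact hx z hz

lemma exists_signal_tail_le (M : Model) {δ : ℝ} (hδ : 0 < δ) :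
    ∃ L : ℝ, ∀ (V : Type) [MetricSpace V], Bounded M V → ∀ Z : Finset V,
      Separated (M.ε / 4 * M.R) Z → ∀ (x : V) (ℓ : ℝ), L ≤ ℓ →
        ∑ z ∈ Z with ℓ ≤ dist z x, signal M (dist z x) ≤ δ := by
  obtain ⟨L, hL⟩ := exists_tail_le (r := M.ε * M.R / 8)
    (div_pos (mul_pos M.ε_pos M.R_pos) (by norm_num))
    M.Cind_pos.le (by linarith [M.one_le_lam]) M.lam_lt_ζ (div_pos hδ M.P_pos)
  refine ⟨L, fun V _ hV Z hZ x ℓ hℓ => ?_⟩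
  have h2r : 2 * (M.ε * M.R / 8) = M.ε / 4 * M.R := by ring
  have htail := hL V hV Z (by rwa [h2r]) x ℓ hℓ
  rw [le_div_iff₀' M.P_pos, Finset.mul_sum] at htail
  simpa only [signal, div_eq_mul_inv, Real.rpow_neg dist_nonneg] using htail

/-- The constants of the analysis: contention is observed within distance `ℓ` of a node, the
transmitters beyond cause an expected interference of order `ξ`, a contention of at most `η` goes
unnoticed by contention detection, `N` bounds the size of separated sets of radius about `2 * ℓ`,
and `K` bounds the contention that is regarded as moderate. -/
structure Scale (M : Model) where
  ℓ : ℝ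
  K : ℝ
  N : ℝ
  ξ : ℝ
  η : ℝ
  near_le : 4 * (M.ε / 4 * M.R) ≤ ℓ
  vicinity_le : M.ρ * M.R ≤ ℓ
  clear_le : M.ρc * M.R ≤ ℓ
  ξ_pos : 0 < ξ
  ξ_le_clear : ξ * (2 * 2 ^ M.ζ) ≤ M.Ic
  ξ_le_ack : ξ * (2 * 2 ^ M.ζ) ≤ M.Iack
  ξ_le_idle : ξ ≤ M.Icd / 50
  η_pos : 0 < η
  η_le_half : η ≤ 1 / 2
  η_le_idle : η * signal M (M.ρ * M.R) ≤ M.Icd / 50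
  le_idle : 0.96 ≤ M.h₂ ^ (-η)
  N_nonneg : 0 ≤ N
  card_le : ∀ (V : Type) [MetricSpace V], Bounded M V → ∀ (x : V) (Z : Finset V),
    Separated (M.ε / 4 * M.R) Z → (∀ z ∈ Z, dist z x ≤ 2 * ℓ + M.ε / 4 * M.R) → (Z.card : ℝ) ≤ N
  tail_le : ∀ (V : Type) [MetricSpace V], Bounded M V → ∀ (x : V) (Z : Finset V),
    Separated (M.ε / 4 * M.R) Z →
      ∑ z ∈ Z with ℓ / 2 ≤ dist z x, 2 ^ M.ζ * signal M (dist z x) ≤ ξ / (50 * avgContention M)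
  K_pos : 0 < K
  le_K : 50 * N * avgContention M ≤ K

lemma exists_scale (M : Model) : Nonempty (Scale M) := by
  have hnear := near_pos M
  have havg := one_le_avgContention M
  obtain ⟨ξ, hξ, hclear, hack, hidle⟩ := exists_interference_threshold M
  obtain ⟨η, hη, hhalf, hηidle, hpow⟩ := exists_idle_threshold M
  obtain ⟨L, hL⟩ := exists_signal_tail_le M
    (δ := ξ / (50 * avgContention M) / 2 ^ M.ζ) (by positivity)
  obtain ⟨ℓ, hnear_le, hvicinity, hclear_le, htail⟩ : ∃ ℓ : ℝ, 4 * (M.ε / 4 * M.R) ≤ ℓ ∧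
      M.ρ * M.R ≤ ℓ ∧ M.ρc * M.R ≤ ℓ ∧ 2 * L ≤ ℓ :=
    ⟨max (max (4 * (M.ε / 4 * M.R)) (M.ρ * M.R)) (max (M.ρc * M.R) (2 * L)), by simp, by simp,
      by simp, by simp⟩
  obtain ⟨N, hN, hcard⟩ := exists_card_le M (d := 2 * ℓ + M.ε / 4 * M.R) (by linarith)
  refine ⟨⟨ℓ, 50 * N * avgContention M + 1, N, ξ, η, hnear_le, hvicinity, hclear_le, hξ, hclear,
    hack, hidle, hη, hhalf, hηidle, hpow, hN, hcard, fun V _ hV x Z hZ => ?_, by positivity,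
    by linarith⟩⟩
  rw [← Finset.mul_sum, ← le_div_iff₀' (by positivity)]
  exact hL V hV Z hZ x (ℓ / 2) (by linarith)

section Moderate

variable {V : Type} [MetricSpace V] {M : Model} (c : Scale M)

lemma Scale.ℓ_pos : 0 < c.ℓ := by
  have := near_pos M
  linarith [c.near_le]

lemma Scale.N_le_K : c.N ≤ c.K := by
  have := one_le_avgContention M
  have := c.N_nonneg
  nlinarith [c.le_K]

lemma Scale.sum_signal_le (hV : Bounded M V) (x : V) (Z : Finset V)
    (hZ : Separated (M.ε / 4 * M.R) Z) :
    ∑ z ∈ Z with ¬ dist z x < c.ℓ, signal M (dist z x) ≤ c.ξ := by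
  have h1 := c.tail_le V hV x Z hZ
  have hK := one_le_avgContention M
  have hℓ := c.ℓ_pos
  have h2 : c.ξ / (50 * avgContention M) ≤ c.ξ := div_le_self c.ξ_pos.le (by linarith)
  refine le_trans ?_ (h1.trans h2)
  have h3 : (1 : ℝ) ≤ 2 ^ M.ζ := Real.one_le_rpow (by norm_num) (ζ_pos M).le
  calc ∑ z ∈ Z with ¬ dist z x < c.ℓ, signal M (dist z x)
      ≤ ∑ z ∈ Z with ¬ dist z x < c.ℓ, 2 ^ M.ζ * signal M (dist z x) :=
        Finset.sum_le_sum fun z _ => le_mul_of_one_le_left (signal_nonneg M dist_nonneg) h3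
    _ ≤ _ := by
        refine Finset.sum_le_sum_of_subset_of_nonneg (fun z hz => ?_)
          fun z _ _ => mul_nonneg (by positivity) (signal_nonneg M dist_nonneg)
        rw [Finset.mem_filter] at hz ⊢
        exact ⟨hz.1, by linarith [hz.2]⟩

/-- Around `x`, the transmission probabilities are small in total, and little interference has to be
expected from far away. -/
def Moderate [Fintype V] (p : V → ℝ≥0) (x : V) : Prop :=
  ∑ v with dist v x < 2 * c.ℓ, (p v : ℝ) ≤ c.K ∧
    ∑ v with ¬ dist v x < c.ℓ, p v * signal M (dist v x) ≤ c.ξ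

lemma moderate_of_le [Fintype V] {p : V → ℝ≥0} (hV : Bounded M V)
    (hp : ∀ (g : V → ℝ) (G : ℝ), (∀ v, 0 ≤ g v) →
      (∀ Z : Finset V, Separated (M.ε / 4 * M.R) Z → ∑ z ∈ Z, g z ≤ G) → ∑ v, p v * g v ≤ G)
    (x : V) : Moderate c p x := by
  constructor
  · refine le_trans ?_ c.N_le_K
    have := hp (fun v => if dist v x < 2 * c.ℓ then 1 else 0) c.N
      (fun v => by split_ifs <;> norm_num) fun Z hZ => by
        rw [← Finset.sum_filter, Finset.sum_const, nsmul_eq_mul, mul_one]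
        refine c.card_le V hV x _ (hZ.subset (Finset.filter_subset _ _)) fun z hz => ?_
        have := near_pos M
        linarith [(Finset.mem_filter.1 hz).2]
    simpa only [mul_ite, mul_one, mul_zero, ← Finset.sum_filter] using this
  · have := hp (fun v => if ¬ dist v x < c.ℓ then signal M (dist v x) else 0) c.ξ
      (fun v => by
        split_ifs
        · exact le_rfl
        · exact signal_nonneg M dist_nonneg) fun Z hZ => by
        rw [← Finset.sum_filter]
        exact c.sum_signal_le hV x Z hZ
    simpa only [mul_ite, mul_zero, ← Finset.sum_filter] using this

lemma far_of_isolated {T : Finset V} {x u : V} (hu : dist u x < c.ℓ)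
    (hiso : ∀ w ∈ T, dist w x < 2 * c.ℓ → w = u) {w : V} (hw : w ∈ T) (hwu : w ≠ u) :
    2 * c.ℓ ≤ dist w x ∧ dist w x / 2 ≤ dist w u ∧ c.ℓ < dist w u := by
  have hfar : 2 * c.ℓ ≤ dist w x := not_lt.1 fun hnear => hwu (hiso w hw hnear)
  have htri := dist_triangle w u x
  exact ⟨hfar, by linarith, by linarith⟩

lemma interference_le_of_isolated {T : Finset V} {x u : V} (hu : dist u x < c.ℓ)
    (hiso : ∀ w ∈ T, dist w x < 2 * c.ℓ → w = u)
    (hext : ∑ w ∈ T with ¬ dist w x < 2 * c.ℓ, signal M (dist w x) < 2 * c.ξ) :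
    interference M T u ≤ c.ξ * (2 * 2 ^ M.ζ) := by
  classical
  have hℓ := c.ℓ_pos
  unfold interference
  calc ∑ w ∈ T.erase u, M.P / dist w u ^ M.ζ
      ≤ ∑ w ∈ T.erase u, 2 ^ M.ζ * signal M (dist w x) := by
        refine Finset.sum_le_sum fun w hw => ?_
        obtain ⟨hwu, hw⟩ := Finset.mem_erase.1 hw
        obtain ⟨hfar, hhalf, -⟩ := far_of_isolated c hu hiso hw hwu
        exact signal_le_of_half_le M (by linarith) hhalf
    _ ≤ 2 ^ M.ζ * ∑ w ∈ T with ¬ dist w x < 2 * c.ℓ, signal M (dist w x) := by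
        rw [← Finset.mul_sum]
        refine mul_le_mul_of_nonneg_left (Finset.sum_le_sum_of_subset_of_nonneg
          (fun w hw => ?_) fun w _ _ => signal_nonneg M dist_nonneg) (by positivity)
        obtain ⟨hwu, hw⟩ := Finset.mem_erase.1 hw
        exact Finset.mem_filter.2 ⟨hw, not_lt.2 (far_of_isolated c hu hiso hw hwu).1⟩
    _ ≤ 2 ^ M.ζ * (2 * c.ξ) := by gcongr
    _ = c.ξ * (2 * 2 ^ M.ζ) := by ring

lemma clear_of_isolated {A : Algorithm} {s : V} {h : History V} {y : Finset V × Outcome V}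
    (hy : RoundOK M A s h y) {x u : V} (hu : dist u x < c.ℓ) (huS : u ∈ y.1)
    (hiso : ∀ w ∈ y.1, dist w x < 2 * c.ℓ → w = u)
    (hext : ∑ w ∈ y.1 with ¬ dist w x < 2 * c.ℓ, signal M (dist w x) < 2 * c.ξ) :
    MassDelivers M y.2 u ∧ Wins M y u := by
  have hlow := interference_le_of_isolated c hu hiso hext
  have hmass : MassDelivers M y.2 u := by
    refine hy.legal.succClear u huS (fun w hw hwu hball => ?_) (hlow.trans c.ξ_le_clear)
    rw [Metric.mem_ball] at hball
    linarith [(far_of_isolated c hu hiso hw hwu).2.2, c.clear_le]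
  refine ⟨hmass, huS, hy.legal.ack_of_massDelivers u huS hmass (hlow.trans c.ξ_le_ack), ?_⟩
  rintro ⟨w, hw, hwu⟩
  obtain ⟨hwS, hne⟩ := hy.legal.received_sent w u hw
  linarith [(far_of_isolated c hu hiso hwS hne).2.2, c.near_le, near_pos M]

/-- The rate at which transmissions succeed. -/
def Scale.rate : ℝ := Real.exp (-(2 * c.K)) / 2

lemma Scale.rate_pos : 0 < c.rate := by unfold Scale.rate; positivity

lemma Scale.rate_le_one : c.rate ≤ 1 := by
  unfold Scale.rate
  have : Real.exp (-(2 * c.K)) ≤ 1 := Real.exp_le_one_iff.2 (by linarith [c.K_pos])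
  linarith

lemma le_roundLaw_clear [Fintype V] {A : Algorithm} {s : V} {adv : Adversary V}
    (hadm : Admissible M A s adv) {t : ℕ} {h : History V} (hh : h ∈ (law M A s adv t).support)
    (hhalf : ∀ v, transmitProb M A s h v ≤ 1 / 2) {x : V}
    (hmod : Moderate c (transmitProb M A s h) x) {U : Finset V} (hU : ∀ u ∈ U, dist u x < c.ℓ) :
    ENNReal.ofReal (c.rate * ∑ u ∈ U, (transmitProb M A s h u : ℝ)) ≤
      (roundLaw M A s adv h).toOuterMeasure
        {y | ∃ u ∈ U, MassDelivers M y.2 u ∧ Wins M y u} := by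
  classical
  have hℓ := c.ℓ_pos
  have hfar : ∑ w with ¬ dist w x < 2 * c.ℓ, transmitProb M A s h w * signal M (dist w x) ≤
      2 * c.ξ / 2 := by
    rw [mul_div_cancel_left₀ _ (two_ne_zero)]
    refine (Finset.sum_le_sum_of_subset_of_nonneg (fun w hw => ?_)
      fun w _ _ => mul_nonneg (NNReal.coe_nonneg _) (signal_nonneg M dist_nonneg)).trans hmod.2
    rw [Finset.mem_filter] at hw ⊢
    exact ⟨hw.1, fun h => hw.2 (by linarith)⟩
  have hisolated := le_independentSet_isolated (p := transmitProb M A s h)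
    (hp := fun _ => A.prob_le_one _) (U := U)
    (Finset.disjoint_filter_filter_not Finset.univ Finset.univ fun w => dist w x < 2 * c.ℓ)
    (fun u hu => Finset.mem_filter.2 ⟨Finset.mem_univ u, by linarith [hU u hu]⟩)
    (fun w => signal_nonneg M dist_nonneg) (fun v => by exact_mod_cast hhalf v)
    (by linarith [c.ξ_pos]) hmod.1 hfar
  rw [← roundLaw_fst (adv := adv)] at hisolated
  refine hisolated.trans (toOuterMeasure_mono_of_support fun y hy hyE => ?_)
  obtain ⟨u, huU, huS, hiso, hext⟩ := hyE
  refine ⟨u, huU, clear_of_isolated c (roundOK_of_mem_support hadm hh hy) (hU u huU) huS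
    (fun w hw hwx => hiso w hw (Finset.mem_filter.2 ⟨Finset.mem_univ _, hwx⟩)) ?_⟩
  convert hext using 2
  ext w
  simp [and_comm]

end Moderate

/-! ### Moderate contention and winners close by -/

section NetContention

variable {V : Type} [Fintype V] [MetricSpace V] {M : Model} (c : Scale M) {A : Algorithm} {s : V}

lemma near_le_half (M : Model) : M.ε / 4 * M.R ≤ M.R / 2 := by
  nlinarith [M.ε_lt_one, M.R_pos]

lemma sum_transmitProb_mul_le_net {Y : Finset V} (hY : ∀ w, ∃ y ∈ Y, dist w y < M.ε / 4 * M.R)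
    {g G : V → ℝ} (hG : ∀ y, 0 ≤ G y) (W : Finset V)
    (hgG : ∀ w ∈ W, ∀ y ∈ Y, dist w y < M.ε / 4 * M.R → g w ≤ G y) (h : History V) :
    ∑ w ∈ W, transmitProb M A s h w * g w ≤
      ∑ y ∈ Y, G y * contention M A s h (Metric.ball y (M.R / 2)) := by
  classical
  refine (sum_mul_le_net hY (fun w => NNReal.coe_nonneg _) hG W hgG).trans
    (Finset.sum_le_sum fun y _ => mul_le_mul_of_nonneg_left ?_ (hG y))
  refine Finset.sum_le_sum_of_subset_of_nonneg (fun w hw => ?_) fun w _ _ => NNReal.coe_nonneg _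
  rw [Finset.mem_filter] at hw ⊢
  exact ⟨hw.1, Metric.ball_subset_ball (near_le_half M) hw.2⟩

lemma sum_near_transmitProb_le {Y : Finset V} (hY : ∀ w, ∃ y ∈ Y, dist w y < M.ε / 4 * M.R)
    (x : V) (h : History V) :
    ∑ v with dist v x < 2 * c.ℓ, (transmitProb M A s h v : ℝ) ≤
      ∑ y ∈ Y with dist y x ≤ 2 * c.ℓ + M.ε / 4 * M.R,
        1 * contention M A s h (Metric.ball y (M.R / 2)) := by
  have hnet := sum_transmitProb_mul_le_net (A := A) (s := s) hY (g := fun _ => 1)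
    (G := fun y => if dist y x ≤ 2 * c.ℓ + M.ε / 4 * M.R then 1 else 0)
    (fun y => by split_ifs <;> norm_num) {v | dist v x < 2 * c.ℓ} (fun w hw y _ hwy => by
      have htri := dist_triangle_left y x w
      rw [if_pos (by linarith [(Finset.mem_filter.1 hw).2])]) h
  simpa only [mul_one, ite_mul, zero_mul, ← Finset.sum_filter] using hnet

lemma sum_far_transmitProb_mul_le {Y : Finset V} (hY : ∀ w, ∃ y ∈ Y, dist w y < M.ε / 4 * M.R)
    (x : V) (h : History V) :
    ∑ v with ¬ dist v x < c.ℓ, transmitProb M A s h v * signal M (dist v x) ≤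
      ∑ y ∈ Y with c.ℓ / 2 ≤ dist y x,
        2 ^ M.ζ * signal M (dist y x) * contention M A s h (Metric.ball y (M.R / 2)) := by
  have hnear := near_pos M
  have hnet := sum_transmitProb_mul_le_net (A := A) (s := s) hY
    (g := fun w => signal M (dist w x))
    (G := fun y => if c.ℓ / 2 ≤ dist y x then 2 ^ M.ζ * signal M (dist y x) else 0)
    (fun y => by
      split_ifs
      · exact mul_nonneg (by positivity) (signal_nonneg M dist_nonneg)
      · exact le_rfl) {v | ¬ dist v x < c.ℓ} (fun w hw y _ hwy => by
      have hfar := (Finset.mem_filter.1 hw).2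
      rw [if_pos (by linarith [c.near_le, dist_triangle w y x])]
      exact signal_le_of_half_le M (by linarith [c.near_le, dist_triangle w y x])
        (by linarith [c.near_le, dist_triangle_left y x w, dist_triangle w y x])) h
  simpa only [ite_mul, zero_mul, ← Finset.sum_filter] using hnet

end NetContention

section Immoderate

variable {V : Type} [Fintype V] [MetricSpace V] {M : Model} (c : Scale M) {S : ℕ} {s : V}

/-- `h` is followed by an election round that is not before round `t₀`. -/
def LateElection {V : Type} (t₀ : ℕ) (h : History V) : Prop :=
  h.length % 3 = 1 ∧ t₀ ≤ h.length

lemma mul_total_ind_lt_le {t₀ : ℕ} {F : History V → ℝ} {Z : Finset V} {g : V → ℝ}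
    (hg : ∀ y, 0 ≤ g y)
    (hF : ∀ h, F h ≤
      ∑ y ∈ Z, g y * contention M (broadcast S) s h (Metric.ball y (M.R / 2)))
    {h : History V} {L : ℝ}
    (hL : ∀ y, lateContention M S s t₀ (Metric.ball y (M.R / 2)) h ≤ L) (b : ℝ) :
    b * total (fun h _ => ind (LateElection t₀ h ∧ b < F h)) h ≤ (∑ y ∈ Z, g y) * L := by
  calc b * total (fun h _ => ind (LateElection t₀ h ∧ b < F h)) h
      = total (fun h _ => b * ind (LateElection t₀ h ∧ b < F h)) h :=
        (total_const_mul _ _ _).symm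
    _ ≤ total (fun h _ => ∑ y ∈ Z, g y * (ind (LateElection t₀ h) *
          contention M (broadcast S) s h (Metric.ball y (M.R / 2)))) h := by
        refine total_mono (fun h _ => ?_) h
        by_cases hb : LateElection t₀ h ∧ b < F h
        · simp only [ind_pos hb, ind_pos hb.1, mul_one, one_mul]
          exact hb.2.le.trans (hF h)
        · rw [ind_neg hb, mul_zero]
          exact Finset.sum_nonneg fun y _ => mul_nonneg (hg y)
            (mul_nonneg (ind_nonneg _) (contention_nonneg h _))
    _ = ∑ y ∈ Z, g y * lateContention M S s t₀ (Metric.ball y (M.R / 2)) h := by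
        rw [total_sum]
        exact Finset.sum_congr rfl fun y _ => total_const_mul _ _ _
    _ ≤ (∑ y ∈ Z, g y) * L := by
        rw [Finset.sum_mul]
        exact Finset.sum_le_sum fun y _ => mul_le_mul_of_nonneg_left (hL y) (hg y)

lemma total_crowded_le (hV : Bounded M V) {t₀ : ℕ} {h : History V} {a : ℝ} (ha : 0 ≤ a)
    (hlate : ∀ y, lateContention M S s t₀ (Metric.ball y (M.R / 2)) h ≤ avgContention M * a)
    (x : V) :
    total (fun h _ => ind (LateElection t₀ h ∧
      c.K < ∑ v with dist v x < 2 * c.ℓ, (transmitProb M (broadcast S) s h v : ℝ))) h ≤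
        a / 50 := by
  obtain ⟨Y, hYsep, hYnet⟩ := exists_net (V := V) (near_pos M)
  refine le_of_mul_le_mul_left ?_ c.K_pos
  refine (mul_total_ind_lt_le (fun _ => zero_le_one) (sum_near_transmitProb_le c hYnet x) hlate
    c.K).trans ?_
  have havg := one_le_avgContention M
  have hcard := c.card_le V hV x _
    (hYsep.subset (Finset.filter_subset (fun y => dist y x ≤ 2 * c.ℓ + M.ε / 4 * M.R) Y))
    fun z hz => (Finset.mem_filter.1 hz).2
  rw [Finset.sum_const, nsmul_eq_mul, mul_one]
  calc _ ≤ c.N * (avgContention M * a) := by gcongr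
    _ = 50 * c.N * avgContention M * (a / 50) := by ring
    _ ≤ c.K * (a / 50) := by gcongr; exact c.le_K

lemma total_loud_le (hV : Bounded M V) {t₀ : ℕ} {h : History V} {a : ℝ} (ha : 0 ≤ a)
    (hlate : ∀ y, lateContention M S s t₀ (Metric.ball y (M.R / 2)) h ≤ avgContention M * a)
    (x : V) :
    total (fun h _ => ind (LateElection t₀ h ∧ c.ξ < ∑ v with ¬ dist v x < c.ℓ,
      transmitProb M (broadcast S) s h v * signal M (dist v x))) h ≤ a / 50 := by
  obtain ⟨Y, hYsep, hYnet⟩ := exists_net (V := V) (near_pos M)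
  refine le_of_mul_le_mul_left ?_ c.ξ_pos
  refine (mul_total_ind_lt_le (fun y => mul_nonneg (by positivity) (signal_nonneg M dist_nonneg))
    (sum_far_transmitProb_mul_le c hYnet x) hlate c.ξ).trans ?_
  have havg := one_le_avgContention M
  calc _ ≤ c.ξ / (50 * avgContention M) * (avgContention M * a) := by
        gcongr
        exact c.tail_le V hV x Y hYsep
    _ = c.ξ * (a / 50) := by field_simp

lemma total_immoderate_le (hV : Bounded M V) {t₀ : ℕ} {h : History V} {a : ℝ} (ha : 0 ≤ a)
    (hlate : ∀ y, lateContention M S s t₀ (Metric.ball y (M.R / 2)) h ≤ avgContention M * a)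
    (x : V) :
    total (fun h _ => ind (LateElection t₀ h ∧
      ¬ Moderate c (transmitProb M (broadcast S) s h) x)) h ≤ a / 25 := by
  have hcrowded := total_crowded_le c hV ha hlate x
  have hloud := total_loud_le c hV ha hlate x
  refine le_trans ?_ ((add_le_add hcrowded hloud).trans_eq (by ring))
  rw [← total_add]
  refine total_mono (fun h _ => ?_) h
  by_cases hbad : LateElection t₀ h ∧ ¬ Moderate c (transmitProb M (broadcast S) s h) x
  · rw [ind_pos hbad]
    obtain ⟨hl, hmod⟩ := hbad
    rw [Moderate, not_and_or, not_le, not_le] at hmod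
    rcases hmod with hmod | hmod
    · exact (ind_pos ⟨hl, hmod⟩).ge.trans (le_add_of_nonneg_right (ind_nonneg _))
    · exact (ind_pos ⟨hl, hmod⟩).ge.trans (le_add_of_nonneg_left (ind_nonneg _))
  · rw [ind_neg hbad]
    exact add_nonneg (ind_nonneg _) (ind_nonneg _)

end Immoderate

section Idle

variable {V : Type} [Fintype V] [MetricSpace V] {M : Model} (c : Scale M)

/-- The contention within distance `ℓ` of `x` if `v` transmits with probability `p v`. -/
def localContention (c : Scale M) (p : V → ℝ≥0) (x : V) : ℝ :=
  ∑ v with dist v x < c.ℓ, (p v : ℝ)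

lemma sum_outside_signal_le {p : V → ℝ≥0} {x : V} (hmod : Moderate c p x)
    (hlow : localContention c p x < c.η) :
    ∑ w with ¬ dist w x < M.ρ * M.R, p w * signal M (dist w x) ≤ M.Icd / 25 := by
  have hρR : 0 < M.ρ * M.R := mul_pos (by linarith [M.one_lt_ρ]) M.R_pos
  have hsignal (d : ℝ) (hd : ¬ d < M.ρ * M.R) : signal M d ≤ signal M (M.ρ * M.R) :=
    div_le_div_of_nonneg_left M.P_pos.le (Real.rpow_pos_of_pos hρR _)
      (Real.rpow_le_rpow hρR.le (not_lt.1 hd) (ζ_pos M).le)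
  have hterm (w : V) :
      (if ¬ dist w x < M.ρ * M.R then p w * signal M (dist w x) else 0) ≤
        (if dist w x < c.ℓ then p w * signal M (M.ρ * M.R) else 0) +
          (if ¬ dist w x < c.ℓ then p w * signal M (dist w x) else 0) := by
    have hnonneg (d : ℝ) (hd : 0 ≤ d) : 0 ≤ p w * signal M d :=
      mul_nonneg (NNReal.coe_nonneg _) (signal_nonneg M hd)
    by_cases hw : dist w x < c.ℓ
    · rw [if_pos hw, if_neg (not_not.2 hw), add_zero]
      split_ifs with hwb
      · exact hnonneg _ hρR.le
      · exact mul_le_mul_of_nonneg_left (hsignal _ hwb) (NNReal.coe_nonneg _)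
    · rw [if_neg hw, if_pos hw, zero_add]
      split_ifs
      · exact hnonneg _ dist_nonneg
      · exact le_rfl
  have hsum := Finset.sum_le_sum fun w (_ : w ∈ Finset.univ) => hterm w
  rw [Finset.sum_add_distrib, ← Finset.sum_filter, ← Finset.sum_filter, ← Finset.sum_filter,
    ← Finset.sum_mul] at hsum
  have hclose := mul_le_mul_of_nonneg_right hlow.le (signal_nonneg M hρR.le)
  unfold localContention at hclose
  linarith [c.η_le_idle, c.ξ_le_idle, hmod.2]

variable {A : Algorithm} {s : V} {adv : Adversary V}

lemma le_roundLaw_outsideInterference_lt {h : History V} {x : V}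
    (hmod : Moderate c (transmitProb M A s h) x)
    (hlow : localContention c (transmitProb M A s h) x < c.η) :
    ENNReal.ofReal (1 - 0.04) ≤ (roundLaw M A s adv h).toOuterMeasure
      {y | outsideInterference M y.1 x < M.Icd} := by
  classical
  refine le_toOuterMeasure_of_compl_le ?_ (by norm_num)
  have hmarkov := independentSet_sum_ge_le (p := transmitProb M A s h)
    (hp := fun _ => A.prob_le_one _) {w | ¬ dist w x < M.ρ * M.R}
    (g := fun w => signal M (dist w x)) (fun w => signal_nonneg M dist_nonneg) M.Icd_pos
  rw [← roundLaw_fst (adv := adv)] at hmarkov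
  refine (toOuterMeasure_mono_of_support fun y _ hy => ?_).trans
    (hmarkov.trans (ENNReal.ofReal_le_ofReal ?_))
  · refine (not_lt.1 hy : M.Icd ≤ outsideInterference M y.1 x).trans_eq ?_
    refine Finset.sum_congr ?_ fun _ _ => rfl
    ext w
    simp [and_comm]
  · rw [div_le_iff₀ M.Icd_pos]
    linarith [sum_outside_signal_le c hmod hlow]

lemma le_roundLaw_idle (hadm : Admissible M A s adv) {t : ℕ} {h : History V}
    (hh : h ∈ (law M A s adv t).support) {x : V} (hmod : Moderate c (transmitProb M A s h) x)
    (hlow : localContention c (transmitProb M A s h) x < c.η) :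
    ENNReal.ofReal 0.9 ≤ (roundLaw M A s adv h).toOuterMeasure {y | y.2.busy x = false} := by
  have hcont : contention M A s h (Metric.ball x (M.ρ * M.R)) ≤ c.η := by
    classical
    refine le_trans ?_ hlow.le
    refine Finset.sum_le_sum_of_subset_of_nonneg (fun w hw => ?_) fun w _ _ => NNReal.coe_nonneg _
    rw [Finset.mem_filter, Metric.mem_ball] at hw
    exact Finset.mem_filter.2 ⟨hw.1, hw.2.trans_le c.vicinity_le⟩
  calc ENNReal.ofReal 0.9 ≤ ENNReal.ofReal (0.96 * (1 - 0.04)) :=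
        ENNReal.ofReal_le_ofReal (by norm_num)
    _ = ENNReal.ofReal 0.96 * ENNReal.ofReal (1 - 0.04) := ENNReal.ofReal_mul (by norm_num)
    _ ≤ ENNReal.ofReal (M.h₂ ^ (-c.η)) * (roundLaw M A s adv h).toOuterMeasure
          {y | outsideInterference M y.1 x < M.Icd} :=
        mul_le_mul' (ENNReal.ofReal_le_ofReal c.le_idle)
          (le_roundLaw_outsideInterference_lt c hmod hlow)
    _ ≤ _ := (hadm t h hh).2.idle x c.η c.η_pos hcont
    _ ≤ _ := toOuterMeasure_mono_of_support fun y _ hy => hy.2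

end Idle

section LocalWins

variable {V : Type} [Fintype V] [MetricSpace V] {M : Model} (c : Scale M) {S : ℕ} {s : V}
  {adv : Adversary V}

/-- Some winner of the current election round is within distance `ℓ` of `x`. -/
def LocalWin {V : Type} [MetricSpace V] {M : Model} (c : Scale M) (x : V)
    (y : Finset V × Outcome V) : Prop :=
  ∃ u, dist u x < c.ℓ ∧ Wins M y u

lemma le_roundLaw_localWin {A : Algorithm} (hadm : Admissible M A s adv) {t : ℕ} {h : History V}
    (hh : h ∈ (law M A s adv t).support) (hhalf : ∀ v, transmitProb M A s h v ≤ 1 / 2) {x : V}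
    (hmod : Moderate c (transmitProb M A s h) x)
    (hhigh : c.η ≤ localContention c (transmitProb M A s h) x) :
    ENNReal.ofReal (c.rate * c.η) ≤
      (roundLaw M A s adv h).toOuterMeasure {y | LocalWin c x y} := by
  have hclear := le_roundLaw_clear c hadm hh hhalf hmod (U := {u | dist u x < c.ℓ})
    fun u hu => (Finset.mem_filter.1 hu).2
  refine (ENNReal.ofReal_le_ofReal (mul_le_mul_of_nonneg_left hhigh c.rate_pos.le)).trans
    (hclear.trans (toOuterMeasure_mono_of_support fun y _ hy => ?_))
  obtain ⟨u, hu, -, hw⟩ := hy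
  exact ⟨u, (Finset.mem_filter.1 hu).2, hw⟩

/-- Some winner of the last election round is within distance `ℓ` of `x`. -/
def LocalFresh {V : Type} [MetricSpace V] {M : Model} (c : Scale M) (S : ℕ) (s : V) (x : V)
    (h : History V) : Prop :=
  ∃ u, dist u x < c.ℓ ∧ (node M S s h u).fresh = true

open Classical in
lemma transmitProb_notification {h : History V} (hno : h.length % 3 = 2) (v : V) :
    (transmitProb M (broadcast S) s h v : ℝ) = if v ∈ freshSet M S s h then 1 / 2 else 0 := by
  rw [transmitProb_eq, prob_notification hno]
  simp only [mem_freshSet]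
  split_ifs <;> simp

lemma moderate_notification (hV : Bounded M V) {h : History V}
    (hval : Valid M (broadcast S) s h) (hno : h.length % 3 = 2) (x : V) :
    Moderate c (transmitProb M (broadcast S) s h) x := by
  refine moderate_of_le c hV (fun g G hg hG => ?_) x
  simp only [transmitProb_notification hno, ite_mul, zero_mul, Finset.sum_ite_mem,
    Finset.univ_inter, ← Finset.mul_sum]
  linarith [hG _ (freshSet_separated hval),
    Finset.sum_nonneg fun v (_ : v ∈ freshSet M S s h) => hg v]

lemma le_roundLaw_notifies (hV : Bounded M V) (hadm : Admissible M (broadcast S) s adv) {t : ℕ}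
    {h : History V} (hh : h ∈ (law M (broadcast S) s adv t).support) (hno : h.length % 3 = 2)
    {x : V} (hfresh : LocalFresh c S s x h) :
    ENNReal.ofReal (c.rate / 2) ≤ (roundLaw M (broadcast S) s adv h).toOuterMeasure
      {y | ∃ u, dist u x < c.ℓ ∧ Notifies M S s h y u} := by
  have hmod := moderate_notification c hV (valid_of_mem_support hadm hh) hno x
  have hne : h.length ≠ 0 := fun h0 => by simp [h0] at hno
  have hclear := le_roundLaw_clear c hadm hh (fun v => prob_le_half hne v) hmod
    (U := {u | dist u x < c.ℓ}) fun u hu => (Finset.mem_filter.1 hu).2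
  refine le_trans (ENNReal.ofReal_le_ofReal ?_)
    (hclear.trans (toOuterMeasure_mono_of_support fun y hy hyE => ?_))
  · obtain ⟨u, hu, huf⟩ := hfresh
    rw [div_eq_mul_one_div]
    refine mul_le_mul_of_nonneg_left ?_ c.rate_pos.le
    refine le_trans (le_of_eq ?_) (Finset.single_le_sum
      (f := fun u => (transmitProb M (broadcast S) s h u : ℝ)) (fun v _ => NNReal.coe_nonneg _)
      (Finset.mem_filter.2 ⟨Finset.mem_univ u, hu⟩))
    rw [transmitProb_notification hno, if_pos (mem_freshSet.2 huf)]
  · obtain ⟨u, hu, hm, hw⟩ := hyE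
    exact ⟨u, (Finset.mem_filter.1 hu).2, hno,
      fresh_of_mem hno (roundOK_of_mem_support hadm hh hy) hw.1, hm⟩

end LocalWins

section LocalFresh

variable {V : Type} [MetricSpace V] {M : Model} (c : Scale M) {S : ℕ} {s : V}

lemma total_localWin_le (x : V) (P : History V → Prop) (h : History V) :
    total (fun h y => ind ((h.length % 3 = 1 ∧ P h) ∧ LocalWin c x y)) h ≤
      total (fun h _ => ind (h.length % 3 = 2 ∧ LocalFresh c S s x h)) h +
        ind (h.length % 3 = 2 ∧ LocalFresh c S s x h) := by
  induction h with
  | nil => simpa using ind_nonneg _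
  | cons y h ih =>
    rw [total_cons, total_cons]
    by_cases hh : h.length % 3 = 1
    · rw [ind_neg (p := h.length % 3 = 2 ∧ _) (by omega)] at ih ⊢
      have hstep : ind ((h.length % 3 = 1 ∧ P h) ∧ LocalWin c x y) ≤
          ind ((y :: h).length % 3 = 2 ∧ LocalFresh c S s x (y :: h)) := by
        refine ind_mono fun hw => ⟨by rw [List.length_cons]; omega, ?_⟩
        obtain ⟨u, hu, hwin⟩ := hw.2
        exact ⟨u, hu, (fresh_election hh y u).2 hwin⟩
      linarith
    · rw [ind_neg (p := (h.length % 3 = 1 ∧ P h) ∧ _) (by tauto)]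
      linarith [ind_nonneg ((y :: h).length % 3 = 2 ∧ LocalFresh c S s x (y :: h))]

end LocalFresh

lemma total_early_le {α : Type*} (t₀ : ℕ) (h : List α) :
    total (fun h _ => ind (h.length % 3 = 1 ∧ h.length < t₀)) h ≤
      ((min h.length t₀ + 1) / 3 : ℕ) := by
  induction h with
  | nil => simp
  | cons y h ih =>
    rw [total_cons, List.length_cons]
    by_cases hh : h.length % 3 = 1 ∧ h.length < t₀
    · rw [ind_pos hh]
      rw [min_eq_left (by omega)] at ih ⊢
      rw [show (h.length + 1 + 1) / 3 = (h.length + 1) / 3 + 1 by omega]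
      push_cast
      linarith
    · rw [ind_neg hh, add_zero]
      refine ih.trans ?_
      norm_cast
      omega

/-! ### Notifications reach every node often -/

section Rates

variable {M : Model} (c : Scale M)

/-- The rate of wins in the vicinity of a node with high local contention. -/
def Scale.winRate : ℝ := c.rate * c.η

/-- The rate of successful notifications. -/
def Scale.notifyRate : ℝ := c.rate / 2

/-- The rate at which the probability that some node is rarely notified decays. -/
def Scale.deviationRate : ℝ := c.winRate ^ 2 * c.notifyRate ^ 2 / 10000

lemma Scale.winRate_pos : 0 < c.winRate := mul_pos c.rate_pos c.η_pos

lemma Scale.notifyRate_pos : 0 < c.notifyRate := half_pos c.rate_pos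

lemma Scale.deviationRate_pos : 0 < c.deviationRate := by
  have := c.winRate_pos
  have := c.notifyRate_pos
  unfold Scale.deviationRate
  positivity

lemma Scale.winRate_le_one : c.winRate ≤ 1 :=
  mul_le_one₀ c.rate_le_one c.η_pos.le (by linarith [c.η_le_half])

lemma Scale.notifyRate_le_one : c.notifyRate ≤ 1 := by
  unfold Scale.notifyRate
  linarith [c.rate_le_one]

lemma Scale.deviationRate_le_win : c.deviationRate ≤ (c.winRate - c.winRate / 2) *
    (c.winRate / 1000) := by
  have hn := pow_le_one₀ c.notifyRate_pos.le c.notifyRate_le_one (n := 2)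
  have := mul_le_mul_of_nonneg_left hn (sq_nonneg c.winRate)
  unfold Scale.deviationRate
  nlinarith [sq_nonneg c.winRate]

lemma Scale.deviationRate_le_notify : c.deviationRate ≤ (c.notifyRate - c.notifyRate / 2) *
    (c.winRate * c.notifyRate / 2000) := by
  have hw := mul_le_mul_of_nonneg_left c.winRate_le_one c.winRate_pos.le
  have := mul_le_mul_of_nonneg_right hw (sq_nonneg c.notifyRate)
  have := mul_nonneg c.winRate_pos.le (sq_nonneg c.notifyRate)
  unfold Scale.deviationRate
  nlinarith

lemma Scale.deviationRate_le : c.deviationRate ≤ 1 / 1000 := by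
  have := mul_le_one₀ (pow_le_one₀ c.winRate_pos.le c.winRate_le_one (n := 2)) (sq_nonneg _)
    (pow_le_one₀ c.notifyRate_pos.le c.notifyRate_le_one (n := 2))
  unfold Scale.deviationRate
  linarith

/-- The number `a` is large compared to the constants of the scale `c`. -/
structure Scale.IsLarge (a : ℝ) : Prop where
  le_win : 1000 ≤ c.winRate * a
  le_notify : 2000 * c.N ≤ c.winRate * c.notifyRate * a

variable {c}

lemma Scale.IsLarge.mono {a b : ℝ} (ha : c.IsLarge a) (hab : a ≤ b) : c.IsLarge b where
  le_win := ha.le_win.trans (mul_le_mul_of_nonneg_left hab c.winRate_pos.le)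
  le_notify := ha.le_notify.trans
    (mul_le_mul_of_nonneg_left hab (mul_pos c.winRate_pos c.notifyRate_pos).le)

lemma Scale.IsLarge.one_le {a : ℝ} (ha : c.IsLarge a) : 1 ≤ a := by
  nlinarith [ha.le_win, c.winRate_pos, c.winRate_le_one]

variable (c) in
lemma Scale.exists_isLarge : ∃ n : ℕ, c.IsLarge n := by
  obtain ⟨n, hn⟩ := exists_nat_ge
    (max (1000 / c.winRate) (2000 * c.N / (c.winRate * c.notifyRate)))
  obtain ⟨hwin, hnotify⟩ := max_le_iff.1 hn
  exact ⟨n, (div_le_iff₀' c.winRate_pos).1 hwin,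
    (div_le_iff₀' (mul_pos c.winRate_pos c.notifyRate_pos)).1 hnotify⟩

end Rates

section Notifications

variable {V : Type} [MetricSpace V] {M : Model} {c : Scale M} {S : ℕ} {s : V}

/-- `h` is followed by a notification round after an election that was won near `x`. -/
def FreshNotification (c : Scale M) (S : ℕ) (s x : V)
    (h : History V) : Prop :=
  h.length % 3 = 2 ∧ LocalFresh c S s x h

/-- Some node near `x` notifies all its neighbours. -/
def LocalNotification {V : Type} [MetricSpace V] {M : Model} (c : Scale M) (S : ℕ) (s x : V)
    (h : History V) (y : Finset V × Outcome V) : Prop :=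
  ∃ u, dist u x < c.ℓ ∧ Notifies M S s h y u

/-- Each notification near `x` silences part of the vicinity for `S` election rounds. -/
lemma total_localNotification_le [Finite V] (hV : Bounded M V) (hS : c.IsLarge S) {h : History V}
    (hval : Valid M (broadcast S) s h) (ha : c.IsLarge (elections h)) (x : V) :
    total (fun h y => ind (LocalNotification c S s x h y)) h ≤
      c.winRate * c.notifyRate / 1000 * elections h := by
  have := Fintype.ofFinite V
  have hSpos : (0 : ℝ) < S := one_pos.trans_le hS.one_le
  have hbound := mul_notifications_le (M := M) (S := S) (s := s) (U := {u | dist u x < c.ℓ})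
    (N := c.N) (fun Z hZU hZ => c.card_le V hV x Z hZ fun z hz => by
      linarith [near_pos M, c.ℓ_pos, (Finset.mem_filter.1 (hZU hz)).2]) hval
  simp only [Finset.mem_filter_univ] at hbound
  refine le_of_mul_le_mul_left (hbound.trans ?_) hSpos
  have hNa := mul_le_mul_of_nonneg_right hS.le_notify (elections_nonneg h)
  have hNS := mul_le_mul_of_nonneg_right ha.le_notify hSpos.le
  linarith

lemma elections_eq_participating_add_paused (x : V) (h : History V) :
    elections h = total (fun h _ => ind (h.length % 3 = 1 ∧ (node M S s h x).pause = 0)) h +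
      total (fun h _ => ind (h.length % 3 = 1 ∧ (node M S s h x).pause ≠ 0)) h := by
  rw [← total_add, elections]
  congr 1
  funext h _
  by_cases hel : h.length % 3 = 1 <;> by_cases hp : (node M S s h x).pause = 0 <;>
    simp [ind, hel, hp]

end Notifications

section Typical

variable {V : Type} [Fintype V] [MetricSpace V] {M : Model} {S : ℕ} {s : V}

/-- `h` is followed by an election round in which a node near `x` is likely to win. -/
def ContestedElection (c : Scale M) (S : ℕ) (s x : V) (h : History V) : Prop :=
  h.length % 3 = 1 ∧ Moderate c (transmitProb M (broadcast S) s h) x ∧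
    c.η ≤ localContention c (transmitProb M (broadcast S) s h) x

/-- From round `t₀` on, the environment of `x` is one in which `x` is likely to sense an idle
channel. -/
def Quiet (c : Scale M) (S : ℕ) (s : V) (t₀ : ℕ) (x : V) (h : History V) : Prop :=
  t₀ ≤ h.length ∧ Moderate c (transmitProb M (broadcast S) s h) x ∧
    localContention c (transmitProb M (broadcast S) s h) x < c.η

/-- `h` is followed by an election round in which `x` participates in a quiet environment. -/
def QuietElection (c : Scale M) (S : ℕ) (s : V) (t₀ : ℕ) (x : V) (h : History V) : Prop :=
  h.length % 3 = 1 ∧ (node M S s h x).pause = 0 ∧ Quiet c S s t₀ x h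

/-- Around `x`, wins, notifications, and idle detections occur in `h` nearly as often as
expected. -/
structure Typical (c : Scale M) (S : ℕ) (s : V) (t₀ : ℕ) (x : V) (h : History V) : Prop where
  win : shortfall (c.winRate / 2) (ContestedElection c S s x) (fun _ => LocalWin c x) h <
    c.winRate / 1000 * elections h
  notify : shortfall (c.notifyRate / 2) (FreshNotification c S s x) (LocalNotification c S s x) h <
    c.winRate * c.notifyRate / 2000 * elections h
  idle : shortfall 0.8 (QuietElection c S s t₀ x) (fun _ y => y.2.busy x = false) h <
    1 / 100 * elections h

section Law

variable (c : Scale M) {adv : Adversary V}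

lemma law_win_shortfall_le (hadm : Admissible M (broadcast S) s adv) (x : V) (t : ℕ) (a : ℝ)
    (ha : 0 ≤ a) :
    (law M (broadcast S) s adv t).toOuterMeasure {h | c.winRate / 1000 * a ≤
        shortfall (c.winRate / 2) (ContestedElection c S s x) (fun _ => LocalWin c x) h} ≤
      ENNReal.ofReal (Real.exp (-(c.deviationRate * a))) := by
  have hw := c.winRate_pos
  rw [law_eq_trajectory]
  refine (trajectory_chernoff (p := c.winRate) (by linarith) (by linarith) c.winRate_le_one
    (fun t h hh hP => ?_) t _).trans (ENNReal.ofReal_le_ofReal (Real.exp_le_exp.2 (neg_le_neg ?_)))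
  · rw [← law_eq_trajectory] at hh
    have hne : h.length ≠ 0 := fun h0 => by simp [h0, ContestedElection] at hP
    exact le_roundLaw_localWin c hadm hh (fun v => prob_le_half hne v) hP.2.1 hP.2.2
  · rw [← mul_assoc]
    exact mul_le_mul_of_nonneg_right c.deviationRate_le_win ha

lemma law_notify_shortfall_le (hV : Bounded M V) (hadm : Admissible M (broadcast S) s adv) (x : V)
    (t : ℕ) (a : ℝ) (ha : 0 ≤ a) :
    (law M (broadcast S) s adv t).toOuterMeasure {h | c.winRate * c.notifyRate / 2000 * a ≤
        shortfall (c.notifyRate / 2) (FreshNotification c S s x) (LocalNotification c S s x) h} ≤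
      ENNReal.ofReal (Real.exp (-(c.deviationRate * a))) := by
  have hn := c.notifyRate_pos
  rw [law_eq_trajectory]
  refine (trajectory_chernoff (p := c.notifyRate) (by linarith) (by linarith) c.notifyRate_le_one
    (fun t h hh hP => ?_) t _).trans (ENNReal.ofReal_le_ofReal (Real.exp_le_exp.2 (neg_le_neg ?_)))
  · rw [← law_eq_trajectory] at hh
    exact le_roundLaw_notifies c hV hadm hh hP.1 hP.2
  · rw [← mul_assoc]
    exact mul_le_mul_of_nonneg_right c.deviationRate_le_notify ha

lemma law_idle_shortfall_le (hadm : Admissible M (broadcast S) s adv) (t₀ : ℕ) (x : V) (t : ℕ)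
    (a : ℝ) (ha : 0 ≤ a) :
    (law M (broadcast S) s adv t).toOuterMeasure {h | 1 / 100 * a ≤
        shortfall 0.8 (QuietElection c S s t₀ x) (fun _ y => y.2.busy x = false) h} ≤
      ENNReal.ofReal (Real.exp (-(c.deviationRate * a))) := by
  rw [law_eq_trajectory]
  refine (trajectory_chernoff (p := 0.9) (by norm_num) (by norm_num) (by norm_num)
    (fun t h hh hP => ?_) t _).trans (ENNReal.ofReal_le_ofReal (Real.exp_le_exp.2 (neg_le_neg ?_)))
  · rw [← law_eq_trajectory] at hh
    exact le_roundLaw_idle c hadm hh hP.2.2.2.1 hP.2.2.2.2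
  · rw [← mul_assoc]
    exact mul_le_mul_of_nonneg_right (c.deviationRate_le.trans_eq (by norm_num)) ha

lemma elections_of_mem_support {t : ℕ} {h : History V}
    (hh : h ∈ (law M (broadcast S) s adv t).support) : elections h = ((t + 1) / 3 : ℕ) := by
  rw [elections_eq, length_of_mem_support hh]

lemma law_not_typical_le (hV : Bounded M V) (hadm : Admissible M (broadcast S) s adv) (t₀ : ℕ)
    (x : V) (t : ℕ) :
    (law M (broadcast S) s adv t).toOuterMeasure {h | ¬ Typical c S s t₀ x h} ≤
      3 * ENNReal.ofReal (Real.exp (-(c.deviationRate * ((t + 1) / 3 : ℕ)))) := by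
  have ha : (0 : ℝ) ≤ ((t + 1) / 3 : ℕ) := Nat.cast_nonneg _
  have hsum := add_le_add (law_win_shortfall_le c hadm x t _ ha)
    (add_le_add (law_notify_shortfall_le c hV hadm x t _ ha)
      (law_idle_shortfall_le c hadm t₀ x t _ ha))
  refine le_trans (toOuterMeasure_mono_of_support fun h hh htyp => ?_)
    (((toOuterMeasure_or_le _ _).trans (add_le_add le_rfl (toOuterMeasure_or_le _ _))).trans
      (hsum.trans_eq (by ring)))
  rw [Set.mem_ofPred_eq, ← elections_of_mem_support hh]
  by_contra! hcon
  exact htyp ⟨hcon.1, hcon.2.1, hcon.2.2⟩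

end Law

end Typical

section Coverage

variable {V : Type} [Fintype V] [MetricSpace V] {M : Model} {c : Scale M} {S : ℕ} {s : V}

lemma total_freshNotification_le (hV : Bounded M V) (hS : c.IsLarge S) {t₀ : ℕ} {h : History V}
    (hval : Valid M (broadcast S) s h) (ha : c.IsLarge (elections h)) {x : V}
    (htyp : Typical c S s t₀ x h) :
    total (fun h _ => ind (FreshNotification c S s x h)) h ≤
      3 * c.winRate / 1000 * elections h := by
  have hnotified := (total_mono (f := fun h y => ind (FreshNotification c S s x h ∧
    LocalNotification c S s x h y)) (fun h y => ind_mono fun hh => hh.2) h).trans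
      (total_localNotification_le hV hS hval ha x)
  have hshort := htyp.notify
  unfold shortfall at hshort
  exact le_of_mul_le_mul_left (by linarith) c.notifyRate_pos

lemma total_contestedElection_le (hV : Bounded M V) (hS : c.IsLarge S) {t₀ : ℕ} {h : History V}
    (hval : Valid M (broadcast S) s h) (ha : c.IsLarge (elections h)) {x : V}
    (htyp : Typical c S s t₀ x h) :
    total (fun h _ => ind (ContestedElection c S s x h)) h ≤ elections h / 50 := by
  have hwins : total (fun h y => ind (ContestedElection c S s x h ∧ LocalWin c x y)) h ≤
      total (fun h _ => ind (FreshNotification c S s x h)) h + 1 :=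
    (total_localWin_le c x _ h).trans (add_le_add le_rfl (ind_le_one _))
  have hfresh := total_freshNotification_le hV hS hval ha htyp
  have hshort := htyp.win
  unfold shortfall at hshort
  exact le_of_mul_le_mul_left (by linarith [ha.le_win]) c.winRate_pos

lemma one_le_level_of_quiet {x : V} {t₀ : ℕ} {h : History V} (hel : h.length % 3 = 1)
    (hp : (node M S s h x).pause = 0) (hq : Quiet c S s t₀ x h) :
    1 ≤ (node M S s h x).level := by
  by_contra! hlevel
  have hself : (transmitProb M (broadcast S) s h x : ℝ) ≤
      localContention c (transmitProb M (broadcast S) s h) x :=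
    Finset.single_le_sum (f := fun v => (transmitProb M (broadcast S) s h v : ℝ))
      (fun v _ => NNReal.coe_nonneg _)
      (Finset.mem_filter.2 ⟨Finset.mem_univ x, by rw [dist_self]; exact c.ℓ_pos⟩)
  rw [transmitProb_eq, prob_election hel, if_pos hp, Nat.lt_one_iff.1 hlevel] at hself
  norm_num at hself
  linarith [hq.2.2, c.η_le_half]

lemma total_participating_le (t₀ : ℕ) (x : V) (h : History V) :
    total (fun h _ => ind (h.length % 3 = 1 ∧ (node M S s h x).pause = 0)) h ≤
      total (fun h _ => ind (QuietElection c S s t₀ x h)) h +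
        (total (fun h _ => ind (h.length % 3 = 1 ∧ h.length < t₀)) h +
          (total (fun h _ => ind (LateElection t₀ h ∧
            ¬ Moderate c (transmitProb M (broadcast S) s h) x)) h +
              total (fun h _ => ind (ContestedElection c S s x h)) h)) := by
  rw [← total_add, ← total_add, ← total_add]
  refine total_mono (fun h _ => ?_) h
  have hquiet := ind_nonneg (QuietElection c S s t₀ x h)
  have hearly := ind_nonneg (h.length % 3 = 1 ∧ h.length < t₀)
  have himmoderate := ind_nonneg (LateElection t₀ h ∧
    ¬ Moderate c (transmitProb M (broadcast S) s h) x)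
  have hcontested := ind_nonneg (ContestedElection c S s x h)
  by_cases hpart : h.length % 3 = 1 ∧ (node M S s h x).pause = 0
  · rw [ind_pos hpart]
    obtain ⟨hel, hpause⟩ := hpart
    rcases lt_or_ge h.length t₀ with hlt | hge
    · linarith [ind_pos (p := _ ∧ _) ⟨hel, hlt⟩]
    by_cases hmod : Moderate c (transmitProb M (broadcast S) s h) x
    · rcases lt_or_ge (localContention c (transmitProb M (broadcast S) s h) x) c.η with hlow | hhigh
      · linarith [ind_pos (p := QuietElection c S s t₀ x h) ⟨hel, hpause, hge, hmod, hlow⟩]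
      · linarith [ind_pos (p := ContestedElection c S s x h) ⟨hel, hmod, hhigh⟩]
    · linarith [ind_pos (p := LateElection t₀ h ∧ _) ⟨⟨hel, hge⟩, hmod⟩]
  · rw [ind_neg hpart]
    linarith

/-- A node that is rarely notified would sense an idle channel in most election rounds, which is
impossible because its transmission probability cannot keep growing. -/
lemma le_hits (hV : Bounded M V) (hS : c.IsLarge S) {t₀ : ℕ} {h : History V}
    (hval : Valid M (broadcast S) s h) (ha : c.IsLarge (elections h))
    (ht₀ : ((t₀ + 1) / 3 : ℕ) ≤ elections h / 50)
    (hlate : ∀ y, lateContention M S s t₀ (Metric.ball y (M.R / 2)) h ≤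
      avgContention M * elections h) {x : V} (htyp : Typical c S s t₀ x h) :
    elections h / (4 * S) ≤ hits M S s x h := by
  have hS1 := hS.one_le
  have hhits : 0 ≤ hits M S s x h := total_nonneg (fun _ _ => ind_nonneg _) h
  have hearly := (total_early_le t₀ h).trans
    ((Nat.cast_le.2 (Nat.div_le_div_right (by omega))).trans ht₀)
  have himmoderate := total_immoderate_le c hV (elections_nonneg h) hlate x
  have hcontested := total_contestedElection_le hV hS hval ha htyp
  have hparticipating := total_participating_le (c := c) (S := S) (s := s) t₀ x h
  have hsplit := elections_eq_participating_add_paused (M := M) (S := S) (s := s) x h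
  have hpaused := paused_add_pause_le (M := M) (S := S) (s := s) x h
  have hlevel := level_add_le (M := M) (S := S) (s := s) x (Low := Quiet c S s t₀ x)
    (fun h hel hp hq => one_le_level_of_quiet hel hp hq) h
  have hidle := htyp.idle
  unfold shortfall QuietElection at hidle
  unfold QuietElection at hparticipating
  by_contra! hfew
  rw [lt_div_iff₀ (by linarith)] at hfew
  have hmul := mul_le_mul_of_nonneg_left hS1 hhits
  linarith [ha.one_le, (node M S s h x).pause.cast_nonneg (α := ℝ),
    (node M S s h x).level.cast_nonneg (α := ℝ)]

end Coverage

section Growth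

lemma exists_growth (S : ℕ) : ∃ γ : ℝ, 1 < γ ∧ γ ≤ 4 / 3 ∧ γ ^ S ≤ 2 := by
  have hle : 1 / (3 * ((S : ℝ) + 1)) ≤ 1 / 3 :=
    one_div_le_one_div_of_le (by norm_num) (by linarith [S.cast_nonneg (α := ℝ)])
  refine ⟨1 + 1 / (3 * (S + 1)), lt_add_of_pos_right _ (by positivity), by linarith, ?_⟩
  calc (1 + 1 / (3 * ((S : ℝ) + 1))) ^ S ≤ Real.exp (1 / (3 * (S + 1))) ^ S := by
        gcongr
        linarith [Real.add_one_le_exp (1 / (3 * ((S : ℝ) + 1)))]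
    _ = Real.exp (S * (1 / (3 * (S + 1)))) := by rw [← Real.exp_nat_mul]
    _ ≤ Real.exp (Real.log 2) := by
        refine Real.exp_le_exp.2 (le_trans ?_ (show 1 / 3 ≤ Real.log 2 by
          linarith [Real.log_two_gt_d9]))
        rw [mul_one_div, div_le_div_iff₀ (by positivity) (by norm_num)]
        linarith
    _ = 2 := Real.exp_log (by norm_num)

variable {V : Type} [Fintype V] [MetricSpace V] {M : Model} {S : ℕ} {s : V} {γ : ℝ}

lemma lateContention_le (hγ : 1 ≤ γ) (hγ' : γ ≤ 4 / 3) (hS : γ ^ S ≤ 2) {t₀ : ℕ}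
    {h : History V} (hn : (Fintype.card V : ℝ) ≤ γ ^ ((t₀ + 1) / 3)) (ht₀ : t₀ ≤ h.length)
    (ha : 1 ≤ elections h) {B : Set V}
    (hF : failedContention M S s B h ≤ 4 / Real.log M.h₁ * elections h) :
    lateContention M S s t₀ B h ≤ avgContention M * elections h := by
  have hlate := lateContention_add_mass_le (M := M) (s := s) hγ hγ' hS t₀ B h
  rw [min_eq_right ht₀, inv_pow] at hlate
  have hmass := mass_nonneg (M := M) (S := S) (s := s) hγ B h
  have hinitial : (γ ^ ((t₀ + 1) / 3))⁻¹ * Fintype.card V ≤ 1 := by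
    rw [inv_mul_le_iff₀ (by positivity)]
    linarith
  rw [avgContention, show (24 : ℝ) / Real.log M.h₁ = 6 * (4 / Real.log M.h₁) by ring]
  linarith

end Growth

section Coverage

variable {V : Type} [Fintype V] [MetricSpace V] {M : Model} (c : Scale M) {S : ℕ} {s : V}
  {adv : Adversary V} {γ : ℝ}

lemma law_hits_lt_le (hV : Bounded M V) (hS : c.IsLarge S) (hγ : 1 ≤ γ) (hγ' : γ ≤ 4 / 3)
    (hγS : γ ^ S ≤ 2) (hadm : Admissible M (broadcast S) s adv) {t : ℕ}
    (ha : c.IsLarge ((t + 1) / 3 : ℕ)) {m : ℕ} (hm : m ≤ (t + 1) / 3 / 50)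
    (hcard : (Fintype.card V : ℝ) ≤ γ ^ m) :
    (law M (broadcast S) s adv t).toOuterMeasure
        {h | ∃ x, hits M S s x h < elections h / (4 * S)} ≤
      4 * Fintype.card V *
        ENNReal.ofReal (Real.exp (-(c.deviationRate * ((t + 1) / 3 : ℕ)))) := by
  set a : ℝ := (((t + 1) / 3 : ℕ) : ℝ)
  have hfailed (y : V) : (law M (broadcast S) s adv t).toOuterMeasure
      {h | 4 / Real.log M.h₁ * a ≤ failedContention M S s (Metric.ball y (M.R / 2)) h} ≤
      ENNReal.ofReal (Real.exp (-(c.deviationRate * a))) := by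
    refine (law_failedContention_le hadm y t).trans
      (ENNReal.ofReal_le_ofReal (Real.exp_le_exp.2 (neg_le_neg ?_)))
    exact mul_le_of_le_one_left (Nat.cast_nonneg _) (by linarith [c.deviationRate_le])
  have hatypical := law_not_typical_le c (S := S) hV hadm (3 * m)
  refine le_trans (toOuterMeasure_mono_of_support fun h hh hfew => ?_)
    ((toOuterMeasure_or_le _ _).trans ((add_le_add (toOuterMeasure_exists_le hfailed)
      (toOuterMeasure_exists_le fun x => hatypical x t)).trans_eq (by ring)))
  rw [Set.mem_ofPred_eq]
  by_contra! hcon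
  obtain ⟨hfailed, htyp⟩ := hcon
  obtain ⟨x, hx⟩ := hfew
  have hae : elections h = a := elections_of_mem_support hh
  have hm' : (3 * m + 1) / 3 = m := by omega
  refine hx.not_ge (le_hits hV hS (t₀ := 3 * m) (valid_of_mem_support hadm hh)
    (by rwa [hae]) ?_ (fun y => ?_) (htyp x))
  · rw [hm', hae, le_div_iff₀ (by norm_num)]
    change (m : ℝ) * 50 ≤ ((t + 1) / 3 : ℕ)
    exact_mod_cast (Nat.le_div_iff_mul_le (by norm_num)).1 hm
  · refine lateContention_le hγ hγ' hγS (by rwa [hm']) ?_ (by rw [hae]; exact ha.one_le) ?_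
    · rw [length_of_mem_support hh]
      omega
    · rw [hae]
      exact (hfailed y).le

end Coverage

/-! ### Dissemination -/

section Informed

lemma informed_subset_cons {V : Type} {s : V} (h : History V) (y : Finset V × Outcome V) :
    informed s h ⊆ informed s (y :: h) :=
  fun _ hv => Or.inl hv

variable {V : Type} [MetricSpace V] {M : Model} {S : ℕ} {s : V}

lemma mem_informed_of_massDelivers {h : History V} {y : Finset V × Outcome V} {u v : V}
    (hu : u ∈ informed s h) (hy : MassDelivers M y.2 u)
    (huv : dist u v ≤ (1 - M.ε / 2) * M.R) : v ∈ informed s (y :: h) := by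
  by_cases hvu : v = u
  · exact Or.inl (hvu ▸ hu)
  · exact Or.inr ⟨u, hy v hvu huv, hu⟩

lemma massDelivers_start {y : Finset V × Outcome V} (hy : RoundOK M (broadcast S) s [] y) :
    MassDelivers M y.2 s := by
  classical
  have hsource : s ∈ y.1 := hy.mem_of_prob s ((prob_start s).trans (if_pos ((node_src _ _).2 rfl)))
  have honly : ∀ w ∈ y.1, w = s := fun w hw => by
    by_contra hne
    exact hy.prob_ne_zero w hw
      ((prob_start w).trans (if_neg fun hsrc => hne ((node_src _ _).1 hsrc)))
  refine hy.legal.succClear s hsource (fun w hw hne => absurd (honly w hw) hne) ?_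
  rw [interference, Finset.sum_eq_zero fun w hw =>
    absurd (honly w (Finset.mem_of_mem_erase hw)) (Finset.ne_of_mem_erase hw)]
  exact M.Ic_pos.le

lemma mem_informed_of_near_source {h : History V} (hval : Valid M (broadcast S) s h)
    (hne : h.length ≠ 0) {v : V} (hsv : dist s v ≤ (1 - M.ε / 2) * M.R) : v ∈ informed s h := by
  induction h with
  | nil => exact absurd rfl hne
  | cons y h ih =>
    by_cases hh : h.length = 0
    · obtain rfl := List.length_eq_zero_iff.1 hh
      exact mem_informed_of_massDelivers (u := s) rfl (massDelivers_start hval.2) hsv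
    · exact informed_subset_cons h y (ih hval.1 hh)

end Informed

section Frontier

variable {V : Type} [MetricSpace V] {M : Model} {S : ℕ} {s : V}

/-- All nodes near `x` are informed. -/
def NearInformed (M : Model) (s : V) (h : History V) (x : V) : Prop :=
  ∀ u, dist u x < M.ε / 4 * M.R → u ∈ informed s h

open Classical in
/-- The progress of the broadcast along the path `x 0, …, x d`: the last index whose vicinity is
completely informed, or `0` if there is none. -/
def frontier (M : Model) (s : V) (x : ℕ → V) (d : ℕ) (h : History V) : ℕ :=
  Nat.findGreatest (fun i => NearInformed M s h (x i)) d

/-- Some node near the frontier of the path `x 0, …, x d` reaches all its neighbours. -/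
def Advances (M : Model) (s : V) (x : ℕ → V) (d : ℕ) (h : History V)
    (y : Finset V × Outcome V) : Prop :=
  ∃ u, dist u (x (frontier M s x d h)) < M.ε / 4 * M.R ∧ MassDelivers M y.2 u

variable {x : ℕ → V} {d : ℕ} {h : History V}

lemma frontier_le : frontier M s x d h ≤ d := by
  classical
  exact Nat.findGreatest_le d

lemma nearInformed_frontier (hval : Valid M (broadcast S) s h) (hne : h.length ≠ 0)
    (hx0 : x 0 = s) : NearInformed M s h (x (frontier M s x d h)) := by
  classical
  refine Nat.findGreatest_spec (P := fun i => NearInformed M s h (x i)) (Nat.zero_le d) ?_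
  intro u hu
  refine mem_informed_of_near_source hval hne ?_
  rw [dist_comm, ← hx0]
  exact hu.le.trans (near_le_reach M)

lemma frontier_le_cons (hval : Valid M (broadcast S) s h) (hne : h.length ≠ 0) (hx0 : x 0 = s)
    (y : Finset V × Outcome V) : frontier M s x d h ≤ frontier M s x d (y :: h) := by
  classical
  exact Nat.le_findGreatest frontier_le
    fun u hu => informed_subset_cons h y (nearInformed_frontier hval hne hx0 u hu)

lemma frontier_lt (hval : Valid M (broadcast S) s h) (hne : h.length ≠ 0) (hx0 : x 0 = s)
    (hd : x d ∉ informed s h) : frontier M s x d h < d := by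
  refine lt_of_le_of_ne frontier_le fun heq => hd ?_
  have hnear := nearInformed_frontier (d := d) hval hne hx0
  rw [heq] at hnear
  exact hnear _ (by rw [dist_self]; exact near_pos M)

lemma frontier_lt_cons (hval : Valid M (broadcast S) s h) (hne : h.length ≠ 0) (hx0 : x 0 = s)
    (hx : ∀ i < d, dist (x i) (x (i + 1)) ≤ (1 - M.ε) * M.R) (hd : x d ∉ informed s h)
    {y : Finset V × Outcome V} (hy : Advances M s x d h y) :
    frontier M s x d h < frontier M s x d (y :: h) := by
  classical
  obtain ⟨u, hu, hy⟩ := hy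
  have hlt := frontier_lt hval hne hx0 hd
  refine Nat.succ_le_iff.1 (Nat.le_findGreatest hlt fun w hw => ?_)
  refine mem_informed_of_massDelivers (nearInformed_frontier hval hne hx0 u hu) hy ?_
  rw [dist_comm] at hw
  calc dist u w ≤ dist u (x (frontier M s x d h)) +
        dist (x (frontier M s x d h)) (x (frontier M s x d h + 1)) +
          dist (x (frontier M s x d h + 1)) w := dist_triangle4 _ _ _ _
    _ ≤ M.ε / 4 * M.R + (1 - M.ε) * M.R + M.ε / 4 * M.R :=
        add_le_add (add_le_add hu.le (hx _ hlt)) hw.le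
    _ = (1 - M.ε / 2) * M.R := by ring

lemma total_advances_le_frontier {Q : History V → Prop} (hx0 : x 0 = s)
    (hx : ∀ i < d, dist (x i) (x (i + 1)) ≤ (1 - M.ε) * M.R)
    (hQ : ∀ h, Q h → h.length ≠ 0 ∧ x d ∉ informed s h) (hval : Valid M (broadcast S) s h) :
    total (fun h y => ind (Q h ∧ Advances M s x d h y)) h ≤
      if h.length = 0 then 0 else (frontier M s x d h : ℝ) := by
  induction h with
  | nil => simp
  | cons y h ih =>
    have ih := ih hval.1
    rw [total_cons, List.length_cons, if_neg (Nat.succ_ne_zero _)]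
    by_cases hadv : Q h ∧ Advances M s x d h y
    · obtain ⟨hne, hd⟩ := hQ h hadv.1
      rw [if_neg hne] at ih
      have hlt : ((frontier M s x d h + 1 : ℕ) : ℝ) ≤ frontier M s x d (y :: h) := by
        exact_mod_cast frontier_lt_cons hval.1 hne hx0 hx hd hadv.2
      rw [ind_pos hadv]
      push_cast at hlt
      linarith
    · rw [ind_neg hadv, add_zero]
      refine ih.trans ?_
      split_ifs with hne
      · exact Nat.cast_nonneg _
      · exact_mod_cast frontier_le_cons hval.1 hne hx0 y

lemma total_advances_le {Q : History V → Prop} (hx0 : x 0 = s)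
    (hx : ∀ i < d, dist (x i) (x (i + 1)) ≤ (1 - M.ε) * M.R)
    (hQ : ∀ h, Q h → h.length ≠ 0 ∧ x d ∉ informed s h) (hval : Valid M (broadcast S) s h) :
    total (fun h y => ind (Q h ∧ Advances M s x d h y)) h ≤ d := by
  refine (total_advances_le_frontier hx0 hx hQ hval).trans ?_
  split_ifs
  · exact Nat.cast_nonneg _
  · exact_mod_cast frontier_le

lemma exists_path [Finite V] (hconn : (commGraph M V).Connected) (s v : V) :
    ∃ (d : ℕ) (x : ℕ → V), d ≤ (commGraph M V).diam ∧ x 0 = s ∧ x d = v ∧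
      ∀ i < d, dist (x i) (x (i + 1)) ≤ (1 - M.ε) * M.R := by
  obtain ⟨p, hp⟩ := hconn.exists_walk_length_eq_dist s v
  have : Nonempty V := ⟨s⟩
  refine ⟨p.length, p.getVert, ?_, p.getVert_zero, p.getVert_length, fun i hi =>
    (p.adj_getVert_succ hi).2⟩
  rw [hp]
  exact SimpleGraph.dist_le_diam (SimpleGraph.connected_iff_ediam_ne_top.1 hconn)

end Frontier

section SpreadRate

variable {M : Model} {S : ℕ}

/-- The rate at which the message spreads from the vicinity of a node that has often been
notified. -/
def Scale.spreadRate (c : Scale M) (S : ℕ) : ℝ := c.rate / (8 * S)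

lemma Scale.spreadRate_pos (c : Scale M) (hS : 1 ≤ S) : 0 < c.spreadRate S :=
  div_pos c.rate_pos (by positivity)

lemma Scale.spreadRate_le_one (c : Scale M) (hS : 1 ≤ S) : c.spreadRate S ≤ 1 := by
  have hSpos : (1 : ℝ) ≤ S := by exact_mod_cast hS
  rw [Scale.spreadRate, div_le_one (by linarith)]
  linarith [c.rate_le_one]

end SpreadRate

section Dissemination

lemma elections_pos {V : Type} {h : History V} (hdis : h.length % 3 = 0) (hne : h.length ≠ 0) :
    0 < elections h := by
  rw [elections_eq, Nat.cast_pos]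
  omega

lemma transmitProb_dissemination {V : Type} [MetricSpace V] {M : Model} {S : ℕ} {s : V}
    {h : History V} (hdis : h.length % 3 = 0) (hne : h.length ≠ 0) (v : V) :
    (transmitProb M (broadcast S) s h v : ℝ) = (node M S s h v).wins / (2 * elections h) := by
  have helections := elections_pos hdis hne
  have hwins : ((node M S s h v).wins : ℝ) ≤ elections h := by
    have := wins_le (M := M) (S := S) (s := s) h v
    rw [elections_eq, Nat.cast_le]
    omega
  rw [transmitProb_eq, prob_dissemination hdis hne, NNReal.coe_min]
  rw [elections_eq, show (h.length + 1) / 3 = h.length / 3 by omega] at *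
  push_cast
  refine min_eq_right ?_
  rw [div_le_div_iff₀ (by positivity) (by norm_num)]
  linarith

variable {V : Type} [Fintype V] [MetricSpace V] {M : Model} {S : ℕ} {s : V} {h : History V}

lemma moderate_dissemination (c : Scale M) (hV : Bounded M V)
    (hval : Valid M (broadcast S) s h) (hdis : h.length % 3 = 0) (hne : h.length ≠ 0) (x : V) :
    Moderate c (transmitProb M (broadcast S) s h) x := by
  have helections := elections_pos hdis hne
  refine moderate_of_le c hV (fun g G _ hG => ?_) x
  have hG0 : 0 ≤ G := by simpa using hG ∅ (by simp [Separated])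
  calc ∑ v, (transmitProb M (broadcast S) s h v : ℝ) * g v
      = (∑ w, ((node M S s h w).wins : ℝ) * g w) / (2 * elections h) := by
        rw [Finset.sum_div]
        refine Finset.sum_congr rfl fun v _ => ?_
        rw [transmitProb_dissemination hdis hne]
        ring
    _ ≤ G * elections h / (2 * elections h) := by gcongr; exact sum_wins_mul_le hval hG
    _ ≤ G := by
        rw [div_le_iff₀ (by positivity)]
        linarith [mul_nonneg hG0 helections.le]

open Classical in
lemma le_sum_transmitProb (hS : 1 ≤ S) (hval : Valid M (broadcast S) s h)
    (hdis : h.length % 3 = 0) (hne : h.length ≠ 0) {x : V}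
    (hx : elections h / (4 * S) ≤ hits M S s x h) :
    1 / (8 * S) ≤ ∑ u with dist u x < M.ε / 4 * M.R,
      (transmitProb M (broadcast S) s h u : ℝ) := by
  have helections := elections_pos hdis hne
  have : (0 : ℝ) < S := by exact_mod_cast hS
  simp only [transmitProb_dissemination hdis hne]
  rw [← Finset.sum_div, le_div_iff₀ (by positivity)]
  refine le_trans (le_of_eq ?_) (hx.trans (hits_le_sum_wins hval x))
  field_simp
  norm_num

variable (c : Scale M) {adv : Adversary V}

lemma le_roundLaw_spread (hV : Bounded M V) (hS : 1 ≤ S)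
    (hadm : Admissible M (broadcast S) s adv) {t : ℕ}
    (hh : h ∈ (law M (broadcast S) s adv t).support) (hdis : h.length % 3 = 0)
    (hne : h.length ≠ 0) {x : V} (hx : elections h / (4 * S) ≤ hits M S s x h) :
    ENNReal.ofReal (c.spreadRate S) ≤ (roundLaw M (broadcast S) s adv h).toOuterMeasure
      {y | ∃ u, dist u x < M.ε / 4 * M.R ∧ MassDelivers M y.2 u} := by
  classical
  have hval := valid_of_mem_support hadm hh
  have hclear := le_roundLaw_clear c hadm hh (fun v => prob_le_half hne v)
    (moderate_dissemination c hV hval hdis hne x) (U := {u | dist u x < M.ε / 4 * M.R})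
    fun u hu => by linarith [c.near_le, near_pos M, (Finset.mem_filter.1 hu).2]
  refine (ENNReal.ofReal_le_ofReal ?_).trans (hclear.trans
    (toOuterMeasure_mono_of_support fun y _ hy => ?_))
  · have hmass := mul_le_mul_of_nonneg_left (le_sum_transmitProb hS hval hdis hne hx) c.rate_pos.le
    rwa [mul_one_div] at hmass
  · obtain ⟨u, hu, hy, -⟩ := hy
    exact ⟨u, (Finset.mem_filter.1 hu).2, hy⟩

end Dissemination

section Rounds

/-- `h` is followed by a dissemination round, from round `t₁` on. -/
def LateDissemination {V : Type} (t₁ : ℕ) (h : History V) : Prop :=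
  h.length % 3 = 0 ∧ t₁ ≤ h.length

lemma le_total_lateDissemination {V : Type} (t₁ : ℕ) (h : History V) :
    (((h.length + 2) / 3 : ℕ) : ℝ) - ((t₁ + 2) / 3 : ℕ) ≤
      total (fun h _ => ind (LateDissemination t₁ h)) h := by
  induction h with
  | nil => simp
  | cons y h ih =>
    rw [total_cons, List.length_cons]
    by_cases hdis : h.length % 3 = 0
    · rw [show (h.length + 1 + 2) / 3 = (h.length + 2) / 3 + 1 by omega]
      by_cases ht : t₁ ≤ h.length
      · rw [ind_pos ⟨hdis, ht⟩]
        push_cast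
        linarith
      · have hearly : (((h.length + 2) / 3 + 1 : ℕ) : ℝ) ≤ ((t₁ + 2) / 3 : ℕ) := by
          rw [Nat.cast_le]
          omega
        have := total_nonneg (f := fun (h : History V) _ => ind (LateDissemination t₁ h))
          (fun _ _ => ind_nonneg _) h
        rw [ind_neg fun hlate => ht hlate.2]
        linarith
    · rw [ind_neg fun hlate => hdis hlate.1, add_zero,
        show (h.length + 1 + 2) / 3 = (h.length + 2) / 3 by omega]
      exact ih

variable {V : Type} [MetricSpace V] {M : Model} {S : ℕ} {s : V}

/-- `h` is followed by a late dissemination round, but some node has rarely been notified in `h`. -/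
def Uncovered (M : Model) (S : ℕ) (s : V) (t₁ : ℕ) (h : History V) : Prop :=
  LateDissemination t₁ h ∧ ∃ x, hits M S s x h < elections h / (4 * S)

/-- `h` is followed by a late dissemination round in which the message, not yet known to `v`, is
likely to spread. -/
def Pending (M : Model) (S : ℕ) (s : V) (t₁ : ℕ) (v : V) (h : History V) : Prop :=
  LateDissemination t₁ h ∧ ¬ Uncovered M S s t₁ h ∧ v ∉ informed s h

lemma total_lateDissemination_le {t₁ : ℕ} {v : V} {h : History V} (hv : v ∉ informed s h) :
    total (fun h _ => ind (LateDissemination t₁ h)) h ≤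
      total (fun h _ => ind (Pending M S s t₁ v h)) h +
        total (fun h _ => ind (Uncovered M S s t₁ h)) h := by
  induction h with
  | nil => simp
  | cons y h ih =>
    have hvh : v ∉ informed s h := fun hcon => hv (informed_subset_cons h y hcon)
    have hsplit : ind (LateDissemination t₁ h) ≤
        ind (Pending M S s t₁ v h) + ind (Uncovered M S s t₁ h) := by
      by_cases hu : Uncovered M S s t₁ h
      · rw [ind_pos hu]
        linarith [ind_le_one (LateDissemination t₁ h), ind_nonneg (Pending M S s t₁ v h)]
      · rw [ind_neg hu, add_zero]
        exact ind_mono fun hlate => ⟨hlate, hu, hvh⟩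
    rw [total_cons, total_cons, total_cons]
    linarith [ih hvh]

end Rounds

section Law

variable {V : Type} [Fintype V] [MetricSpace V] {M : Model} {c : Scale M} {S : ℕ} {s : V}
  {adv : Adversary V} {γ : ℝ}

lemma law_uncovered_le (hV : Bounded M V) (hS : c.IsLarge S) (hγ : 1 ≤ γ) (hγ' : γ ≤ 4 / 3)
    (hγS : γ ^ S ≤ 2) (hadm : Admissible M (broadcast S) s adv) {j m : ℕ} (hj : c.IsLarge j)
    (hm : m ≤ j / 50) (hcard : (Fintype.card V : ℝ) ≤ γ ^ m) (T : ℕ) :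
    (law M (broadcast S) s adv T).toOuterMeasure
        {h | 1 ≤ total (fun h _ => ind (Uncovered M S s (3 * j) h)) h} ≤
      ENNReal.ofReal (T * (4 * Fintype.card V * Real.exp (-(c.deviationRate * j)))) := by
  have hround (t : ℕ) : (law M (broadcast S) s adv t).toOuterMeasure
      {h | Uncovered M S s (3 * j) h} ≤
      ENNReal.ofReal (4 * Fintype.card V * Real.exp (-(c.deviationRate * j))) := by
    by_cases ht : 3 * j ≤ t
    · have hjt : j ≤ (t + 1) / 3 := by omega
      have hjt' : (j : ℝ) ≤ ((t + 1) / 3 : ℕ) := by exact_mod_cast hjt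
      refine (toOuterMeasure_mono_of_support fun h _ hu => hu.2).trans
        ((law_hits_lt_le c hV hS hγ hγ' hγS hadm (hj.mono hjt')
          (hm.trans (Nat.div_le_div_right hjt)) hcard).trans ?_)
      rw [ENNReal.ofReal_mul (by positivity), ENNReal.ofReal_mul (by norm_num),
        ENNReal.ofReal_natCast, ENNReal.ofReal_ofNat]
      gcongr
      exact c.deviationRate_pos.le
    · refine (toOuterMeasure_mono_of_support (t := ∅) fun h hh hu => ht ?_).trans (by simp)
      exact hu.1.2.trans_eq (length_of_mem_support hh)
  rw [ENNReal.ofReal_mul (Nat.cast_nonneg _), ENNReal.ofReal_natCast, law_eq_trajectory]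
  refine (trajectory_one_le_total_le _ T).trans
    ((Finset.sum_le_card_nsmul _ _ _ fun t _ => ?_).trans_eq
      (by rw [Finset.card_range, nsmul_eq_mul]))
  rw [← law_eq_trajectory]
  exact hround t

/-- Fix a shortest path from the source to `v`. Unless some node is rarely notified, every late
dissemination round moves the frontier along this path at a constant rate. -/
lemma law_slow_le (hV : Bounded M V) (hconn : (commGraph M V).Connected) (hS : 1 ≤ S)
    (hadm : Admissible M (broadcast S) s adv) {T j : ℕ} (hj : 1 ≤ j) (hjT : 6 * j ≤ T) (v : V) :
    (law M (broadcast S) s adv T).toOuterMeasure {h | v ∉ informed s h ∧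
        ¬ 1 ≤ total (fun h _ => ind (Uncovered M S s (3 * j) h)) h} ≤
      ENNReal.ofReal (Real.exp (-(c.spreadRate S / 2 *
        (c.spreadRate S / 2 * (j - 1) - (commGraph M V).diam)))) := by
  have hκ := c.spreadRate_pos hS
  obtain ⟨d, x, hd, hx0, rfl, hx⟩ := exists_path hconn s v
  have hchernoff := trajectory_chernoff (κ := roundLaw M (broadcast S) s adv)
    (P := Pending M S s (3 * j) (x d)) (B := Advances M s x d)
    (half_pos hκ).le (half_le_self hκ.le) (c.spreadRate_le_one hS)
    (fun t h hh hP => by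
      rw [← law_eq_trajectory] at hh
      obtain ⟨hlate, hcovered, -⟩ := hP
      have hlen := hlate.2
      exact le_roundLaw_spread c hV hS hadm hh hlate.1 (by omega)
        (not_lt.1 fun hlt => hcovered ⟨hlate, _, hlt⟩)) T
    (c.spreadRate S / 2 * (j - 1) - (commGraph M V).diam)
  rw [← law_eq_trajectory, sub_half] at hchernoff
  refine (toOuterMeasure_mono_of_support fun h hh hslow => ?_).trans hchernoff
  have hrounds := le_total_lateDissemination (3 * j) h
  rw [length_of_mem_support hh, show (3 * j + 2) / 3 = j by omega] at hrounds
  have hT : (2 * j : ℝ) ≤ ((T + 2) / 3 : ℕ) := by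
    exact_mod_cast (by omega : 2 * j ≤ (T + 2) / 3)
  have hpending : (j : ℝ) - 1 ≤ total (fun h _ => ind (Pending M S s (3 * j) (x d) h)) h := by
    linarith [total_lateDissemination_le (M := M) (S := S) (t₁ := 3 * j) hslow.1, hslow.2]
  have hadvances := total_advances_le (Q := Pending M S s (3 * j) (x d)) hx0 hx
    (fun h hQ => ⟨by have := hQ.1.2; omega, hQ.2.2⟩) (valid_of_mem_support hadm hh)
  rw [Set.mem_ofPred_eq, shortfall]
  linarith [mul_le_mul_of_nonneg_left hpending (half_pos hκ).le,
    Nat.cast_le (α := ℝ).2 hd]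

lemma law_not_informed_le (hV : Bounded M V) (hconn : (commGraph M V).Connected)
    (hS : c.IsLarge S) (hγ : 1 ≤ γ) (hγ' : γ ≤ 4 / 3) (hγS : γ ^ S ≤ 2)
    (hadm : Admissible M (broadcast S) s adv) {T j m : ℕ} (hj : c.IsLarge j) (hjT : 6 * j ≤ T)
    (hm : m ≤ j / 50) (hcard : (Fintype.card V : ℝ) ≤ γ ^ m) :
    (law M (broadcast S) s adv T).toOuterMeasure {h | ¬ ∀ v, v ∈ informed s h} ≤
      ENNReal.ofReal (T * (4 * Fintype.card V * Real.exp (-(c.deviationRate * j))) +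
        Fintype.card V * Real.exp (-(c.spreadRate S / 2 *
          (c.spreadRate S / 2 * (j - 1) - (commGraph M V).diam)))) := by
  have hS1 : 1 ≤ S := by exact_mod_cast hS.one_le
  have hj1 : 1 ≤ j := by exact_mod_cast hj.one_le
  rw [ENNReal.ofReal_add (by positivity) (by positivity),
    ENNReal.ofReal_mul (p := (Fintype.card V : ℝ)) (Nat.cast_nonneg _), ENNReal.ofReal_natCast]
  refine le_trans (toOuterMeasure_mono_of_support fun h _ hun => ?_)
    ((toOuterMeasure_or_le _ _).trans (add_le_add
      (law_uncovered_le hV hS hγ hγ' hγS hadm hj hm hcard T)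
      (toOuterMeasure_exists_le (law_slow_le (c := c) hV hconn hS1 hadm hj1 hjT))))
  obtain ⟨v, hv⟩ := not_forall.1 hun
  exact or_iff_not_imp_left.2 fun hcovered => ⟨v, hv, hcovered⟩

end Law

/-! ### The time bound -/

section TimeBound

lemma mul_exp_neg_le_one (x : ℝ) : x * Real.exp (-x) ≤ 1 :=
  (Real.mul_exp_neg_le_exp_neg_one x).trans (Real.exp_le_one_iff.2 (by norm_num))

lemma mul_exp_neg_le {n b y : ℝ} (hn : 0 < n) (hy : (b + 1) * Real.log n ≤ y) :
    n * Real.exp (-y) ≤ Real.exp (-(b * Real.log n)) := by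
  calc n * Real.exp (-y) = Real.exp (Real.log n - y) := by
        rw [sub_eq_add_neg, Real.exp_add, Real.exp_log hn]
    _ ≤ Real.exp (-(b * Real.log n)) := Real.exp_le_exp.2 (by linarith)

/-- One half of the exponent absorbs the linear factor `T`, the other half the constants and
`n`. -/
lemma mul_mul_exp_neg_le {a b j n T : ℝ} (ha : 0 < a) (hn : 0 < n) (hT : T ≤ 12 * j)
    (hj : (b + 1) * Real.log n + 96 / a ≤ a * j / 2) :
    T * (4 * n * Real.exp (-(a * j))) ≤ Real.exp (-(b * Real.log n)) := by
  calc T * (4 * n * Real.exp (-(a * j)))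
      ≤ 12 * j * (4 * n * Real.exp (-(a * j))) := by gcongr
    _ = a * j / 2 * Real.exp (-(a * j / 2)) * (96 / a * (n * Real.exp (-(a * j / 2)))) := by
        rw [show -(a * j) = -(a * j / 2) + -(a * j / 2) by ring, Real.exp_add]
        field_simp
        ring
    _ ≤ 1 * (96 / a * (n * Real.exp (-((b + 1) * Real.log n + 96 / a)))) := by
        gcongr
        exact mul_exp_neg_le_one _
    _ = 96 / a * Real.exp (-(96 / a)) * (n * Real.exp (-((b + 1) * Real.log n))) := by
        rw [neg_add, Real.exp_add]
        ring
    _ ≤ 1 * Real.exp (-(b * Real.log n)) := by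
        gcongr
        · exact mul_exp_neg_le_one _
        · exact mul_exp_neg_le hn le_rfl
    _ = Real.exp (-(b * Real.log n)) := one_mul _

lemma exp_neg_mul_log_le {n : ℝ} (hn : 2 ≤ n) (k : ℝ) :
    Real.exp (-((k + 1) * Real.log n)) ≤ 1 / 2 * n ^ (-k) := by
  have hpos : 0 < n := by linarith
  calc Real.exp (-((k + 1) * Real.log n)) = n⁻¹ * n ^ (-k) := by
        rw [Real.rpow_def_of_pos hpos, show -((k + 1) * Real.log n) = -Real.log n + Real.log n * -k
          by ring, Real.exp_add, Real.exp_neg, Real.exp_log hpos]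
    _ ≤ 1 / 2 * n ^ (-k) := by
        rw [one_div]
        gcongr

lemma half_le_log {n : ℝ} (hn : 2 ≤ n) : 1 / 2 ≤ Real.log n := by
  linarith [Real.log_two_gt_d9, Real.log_le_log two_pos hn]

lemma add_exp_neg_le_rpow_neg {κ a D T j k n : ℝ} (ha : 0 < a) (hn : 2 ≤ n) (hT : T ≤ 12 * j)
    (helection : (k + 2) * Real.log n + 96 / a ≤ a * j / 2)
    (hspread : (k + 2) * Real.log n ≤ κ / 2 * (κ / 2 * (j - 1) - D)) :
    T * (4 * n * Real.exp (-(a * j))) + n * Real.exp (-(κ / 2 * (κ / 2 * (j - 1) - D))) ≤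
      n ^ (-k) := by
  have hpos : 0 < n := by linarith
  rw [show k + 2 = k + 1 + 1 by ring] at helection hspread
  linarith [mul_mul_exp_neg_le ha hpos hT helection, mul_exp_neg_le hpos hspread,
    exp_neg_mul_log_le hn k]

lemma le_div_of_mul_le {x : ℝ} {T : ℕ} (hx : 1 / 2 ≤ x) (hT : 600 * x ≤ T) :
    x ≤ (T / 300 : ℕ) := by
  have h300 : 300 ≤ T := by exact_mod_cast (show (300 : ℝ) ≤ T by linarith)
  have : (T : ℝ) ≤ 600 * (T / 300 : ℕ) := by exact_mod_cast (by omega : T ≤ 600 * (T / 300))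
  linarith

lemma exists_time_constant {κ a g B : ℝ} (hκ : 0 < κ) (hκ1 : κ ≤ 1) (ha : 0 < a) (hg : 0 < g)
    (hB : 0 ≤ B) (k : ℕ) : ∃ C : ℝ, 0 < C ∧ ∀ n D T : ℕ, 2 ≤ n → C * (D + Real.log n) ≤ T →
      B ≤ (T / 6 : ℕ) ∧ Real.log n ≤ (T / 300 : ℕ) * g ∧
        T * (4 * n * Real.exp (-(a * (T / 6 : ℕ)))) +
          n * Real.exp (-(κ / 2 * (κ / 2 * ((T / 6 : ℕ) - 1) - D))) ≤ (n : ℝ) ^ (-(k : ℝ)) := by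
  obtain ⟨A, hA⟩ := (Set.toFinite {1, 2 * B, 1 / g, (k + 2 + 192 / a) / a,
    (k + 2) / κ ^ 2}).bddAbove
  simp only [mem_upperBounds, Set.mem_insert_iff, Set.mem_singleton_iff, forall_eq_or_imp,
    forall_eq] at hA
  obtain ⟨hA1, hAB, hAg, hAa, hAκ⟩ := hA
  refine ⟨600 * A, by positivity, fun n D T hn hT => ?_⟩
  have hn' : (2 : ℝ) ≤ n := by exact_mod_cast hn
  have hlog := half_le_log hn'
  have hD : (0 : ℝ) ≤ D := Nat.cast_nonneg D
  have hX : 1 / 2 ≤ D + Real.log n := by linarith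
  have hm : A * (D + Real.log n) ≤ (T / 300 : ℕ) :=
    le_div_of_mul_le (by nlinarith) (by rwa [← mul_assoc])
  have hm1 : 0 < T / 300 := by exact_mod_cast (by nlinarith : (0 : ℝ) < (T / 300 : ℕ))
  have hj : 4 * ((T / 300 : ℕ) : ℝ) + 1 ≤ (T / 6 : ℕ) := by
    exact_mod_cast (by omega : 4 * (T / 300) + 1 ≤ T / 6)
  have hbound : ∀ {x}, x ≤ A → x * (D + Real.log n) ≤ (T / 300 : ℕ) := fun hx =>
    (mul_le_mul_of_nonneg_right hx (by linarith)).trans hm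
  refine ⟨by nlinarith [hbound hAB], ?_, add_exp_neg_le_rpow_neg ha hn' ?_ ?_ ?_⟩
  · have h := hbound hAg
    rw [div_mul_eq_mul_div, div_le_iff₀ hg] at h
    linarith
  · exact_mod_cast (by omega : T ≤ 12 * (T / 6))
  · have h := hbound hAa
    rw [div_mul_eq_mul_div, div_le_iff₀' ha] at h
    have hj' := mul_le_mul_of_nonneg_left hj ha.le
    calc (k + 2) * Real.log n + 96 / a
        = (k + 2) * Real.log n + 192 / a * (1 / 2) := by ring
      _ ≤ (k + 2) * (D + Real.log n) + 192 / a * (D + Real.log n) := by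
        gcongr
        linarith
      _ ≤ a * (T / 6 : ℕ) / 2 := by nlinarith
  · have h := hbound hAκ
    rw [div_mul_eq_mul_div, div_le_iff₀' (by positivity)] at h
    nlinarith [mul_le_mul_of_nonneg_left hj (sq_nonneg κ), mul_nonneg k.cast_nonneg hD,
      mul_le_mul_of_nonneg_right hκ1 hD]

end TimeBound

end WirelessBroadcast

end

theorem mainTheorem6 (M : WirelessBroadcast.Model) :
    ∃ A : WirelessBroadcast.Algorithm, ∀ k : ℕ, ∃ C : ℝ, 0 < C ∧
      ∀ (V : Type) [Fintype V] [MetricSpace V],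
        WirelessBroadcast.BoundedIndependence V (M.ε * M.R / 8) M.lam M.Cind →
        (WirelessBroadcast.commGraph M V).Connected →
        ∀ (s : V) (adv : WirelessBroadcast.Adversary V),
          WirelessBroadcast.Admissible M A s adv →
          ∀ T : ℕ,
            C * (((WirelessBroadcast.commGraph M V).diam : ℝ) + Real.log (Fintype.card V)) ≤ T →
            (WirelessBroadcast.law M A s adv T).toOuterMeasure
                {h | ¬ ∀ v : V, v ∈ WirelessBroadcast.informed s h} ≤
              ENNReal.ofReal ((Fintype.card V : ℝ) ^ (-(k : ℝ))) := by
  obtain ⟨c⟩ := WirelessBroadcast.exists_scale M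
  obtain ⟨S, hS⟩ := c.exists_isLarge
  obtain ⟨γ, hγ, hγ', hγS⟩ := WirelessBroadcast.exists_growth S
  refine ⟨WirelessBroadcast.broadcast S, fun k => ?_⟩
  have hS1 : 1 ≤ S := by exact_mod_cast hS.one_le
  obtain ⟨C, hC, htime⟩ := WirelessBroadcast.exists_time_constant (c.spreadRate_pos hS1)
    (c.spreadRate_le_one hS1) c.deviationRate_pos (Real.log_pos hγ) (Nat.cast_nonneg S) k
  refine ⟨C, hC, fun V _ _ hV hconn s adv hadm T hT => ?_⟩
  rcases Nat.lt_or_ge (Fintype.card V) 2 with hsmall | hlarge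
  · have hsingle : Fintype.card V = 1 := by
      have := Fintype.card_pos_iff.2 ⟨s⟩
      omega
    simpa [hsingle] using WirelessBroadcast.toOuterMeasure_le_one _ _
  · obtain ⟨hST, hlog, hfailure⟩ := htime _ _ T hlarge hT
    have hcard : (Fintype.card V : ℝ) ≤ γ ^ (T / 300) := by
      rwa [← Real.log_le_log_iff (by positivity) (by positivity), Real.log_pow]
    exact (WirelessBroadcast.law_not_informed_le hV hconn hS hγ.le hγ' hγS hadm (hS.mono hST)
      (Nat.mul_div_le T 6) (Nat.div_div_eq_div_mul T 6 50).ge hcard).trans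
      (ENNReal.ofReal_le_ofReal hfailure)
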